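/- Let $Z=\mathbb R^{d_1}\times\mathbb T^{d_2}$ with $d:=d_1+d_2\ge 1$ and $\mathbb T=\mathbb R/2\pi\mathbb Z$, and consider the initial value problem $$i\partial_t u+\Delta u=F(u,\bar u)\quad\text{on }[0,T]\times Z,\qquad u(0)=\phi,\qquad F(u,\bar u)=\sum_{j=1}^n\nu_j u^{q_j}\bar u^{p_j-q_j},\tag{1}$$ where the pairs of integers $(p_1,q_1),\dots,(p_n,q_n)$ are mutually different, $p_j\ge 2$, $0\le q_j\le p_j$ and $\nu_j\in\mathbb C\setminus\{0\}$. Let $H^\infty(Z)=\bigcap_{\sigma\in\mathbb R}H^\sigma(Z)$. For $s\in\mathbb R$ we say that norm inflation in $H^s(Z)$ (NI$_s$) occurs if for every $\delta>0$ there are $\phi\in H^\infty(Z)$ and $T>0$ with $\|\phi\|_{H^s}<\delta$ and $0<T<\delta$ such that the corresponding smooth solution $u\in C([0,T];H^\infty(Z))$ of (1) exists on $[0,T]$ and $\|u(T)\|_{H^s}>\delta^{-1}$. With $s_c(d,p)=\frac d2-\frac2{p-1}$, we say that $s\in\mathbb R$ is admissible for the term $u^q\bar u^{p-q}$ on $Z$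 if at least one of the following holds: (i) $s<\min\{s_c(d,p),0\}$; (ii) $s=s_c(d,p)=-\frac d2$, that is, $(d,p,s)=(1,3,-\frac12)$ or $(2,2,-1)$; (iii) $d=1$, $(p,q)\in\{(2,0),(2,2)\}$ and $s<-1$; (iv) $Z=\mathbb R^d$ with $1\le d\le 3$, $(p,q)=(2,1)$ and $s<-\frac14$; (v) $d\le 3$, $d_2\ge 1$, $(p,q)=(2,1)$ and $s<0$; (vi) $Z=\mathbb T$, $(p,q)\in\{(4,1),(4,2),(4,3)\}$ and $s<0$. **Theorem.** Unless $Z=\mathbb T$ and $F$ contains the term $u\bar u$, NI$_s$ occurs for (1) whenever $s$ is admissible for at least one term $u^{q_j}\bar u^{p_j-q_j}$ of $F$. If $Z=\mathbb T$ and $F$ contains the term $u\bar u$, then NI$_s$ occurs for (1) in the following cases: - $s<0$, if $F$ has a term of degree at least $5$, or one of $u^3\bar u$, $u^2\bar u^2$, $u\bar u^3$; - $s<-\frac16$, if $F$ has $u^4$ or $\bar u^4$ but no other term of degree at least $4$; - $s\le-\frac12$, if $F$ has a term of degree $3$ but none of degree at least $4$; - $s<0$, if $F$ has no term of degree at least $3$.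 -/

import Mathlib

open Filter MeasureTheory

noncomputable section

namespace NLS

/-- The spatial domain `Z = ℝ^{d₁} × 𝕋^{d₂}`, where `𝕋 = ℝ / 2πℤ`. -/
abbrev Space (d₁ d₂ : ℕ) : Type := (Fin d₁ → ℝ) × (Fin d₂ → AddCircle (2 * Real.pi))

/-- The frequency domain `Ẑ = ℝ^{d₁} × ℤ^{d₂}`, the Pontryagin dual of `Z`. -/
abbrev Freq (d₁ d₂ : ℕ) : Type := (Fin d₁ → ℝ) × (Fin d₂ → ℤ)

/-- The Haar measure on `Ẑ`: Lebesgue measure on `ℝ^{d₁}` times counting measure on `ℤ^{d₂}`. -/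
def freqMeasure (d₁ d₂ : ℕ) : Measure (Freq d₁ d₂) :=
  (volume : Measure (Fin d₁ → ℝ)).prod Measure.count

/-- The square `|ξ|²` of the Euclidean length of a frequency. -/
def normSq {d₁ d₂ : ℕ} (ξ : Freq d₁ d₂) : ℝ :=
  ∑ i, ξ.1 i ^ 2 + ∑ j, (ξ.2 j : ℝ) ^ 2

/-- The Japanese bracket `⟨ξ⟩ = (1 + |ξ|²)^{1/2}`. -/
def bracket {d₁ d₂ : ℕ} (ξ : Freq d₁ d₂) : ℝ := Real.sqrt (1 + normSq ξ)

/-- The character `e^{i x·ξ}`. On the circle `ℝ / 2πℤ`, Mathlib's `fourier k` is `y ↦ e^{iky}`. -/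
def character {d₁ d₂ : ℕ} (ξ : Freq d₁ d₂) (x : Space d₁ d₂) : ℂ :=
  Complex.exp (Complex.I * ((∑ i, x.1 i * ξ.1 i : ℝ) : ℂ)) * ∏ j, fourier (ξ.2 j) (x.2 j)

/-- `⟨ξ⟩^s g(ξ)`. -/
def weighted {d₁ d₂ : ℕ} (s : ℝ) (g : Freq d₁ d₂ → ℂ) (ξ : Freq d₁ d₂) : ℂ :=
  ((bracket ξ ^ s : ℝ) : ℂ) * g ξ

/-- `‖⟨ξ⟩^s g‖_{L²(Ẑ)}`, the `H^s` norm of the function whose Fourier transform is `g`. -/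
def freqNorm {d₁ d₂ : ℕ} (s : ℝ) (g : Freq d₁ d₂ → ℂ) : ℝ :=
  (eLpNorm (weighted s g) 2 (freqMeasure d₁ d₂)).toReal

/-- `H^∞(Z) = ⋂_σ H^σ(Z)`: a function `f` on `Z` together with its Fourier transform `f̂`, where
`⟨ξ⟩^σ f̂ ∈ L²(Ẑ)` for every real `σ` (so that `f̂ ∈ L¹(Ẑ)` and the Fourier inversion integral
converges absolutely). The inversion formula determines `f̂` from `f` almost everywhere, and
says that `f` is the smooth representative of its class. The Fourier transform is normalised
so that no constant stands in the inversion formula; another normalisation changes the `H^s`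
norms by a constant factor only. -/
structure HInfty (d₁ d₂ : ℕ) where
  /-- the function on `Z` -/
  toFun : Space d₁ d₂ → ℂ
  /-- its Fourier transform on `Ẑ` -/
  hat : Freq d₁ d₂ → ℂ
  memLp_weighted : ∀ σ : ℝ, MemLp (weighted σ hat) 2 (freqMeasure d₁ d₂)
  inversion : ∀ x, toFun x = ∫ ξ, hat ξ * character ξ x ∂(freqMeasure d₁ d₂)

/-- The Sobolev norm `‖f‖_{H^s(Z)} = ‖⟨ξ⟩^s f̂‖_{L²(Ẑ)}`. -/
def HInfty.sobolevNorm {d₁ d₂ : ℕ} (s : ℝ) (f : HInfty d₁ d₂) : ℝ := freqNorm s f.hat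

/-- The Laplacian on `Z`: the sum of the second derivatives along the coordinate directions. -/
def laplacian {d₁ d₂ : ℕ} (f : Space d₁ d₂ → ℂ) (x : Space d₁ d₂) : ℂ :=
  ∑ i, iteratedDeriv 2 (fun h : ℝ => f (x + (Pi.single i h, 0))) 0 +
    ∑ j, iteratedDeriv 2
      (fun h : ℝ => f (x + (0, Pi.single j (h : AddCircle (2 * Real.pi))))) 0

/-- The polynomial `F(w, w̄) = ∑_j ν_j w^{q_j} w̄^{p_j - q_j}`. -/
def nonlinearity {n : ℕ} (p q : Fin n → ℕ) (ν : Fin n → ℂ) (w : ℂ) : ℂ :=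
  ∑ j, ν j * w ^ q j * (starRingEnd ℂ w) ^ (p j - q j)

/-- `u` is the (unique) smooth solution on `[0,T] × Z` of `i∂_t u + Δu = F(u)`, `u(0) = φ`: it belongs to
`C([0,T]; H^∞(Z))` and satisfies the equation pointwise, with one-sided time derivatives at the
end points. Values of `u` outside `[0,T]` play no role. -/
structure IsSmoothSolution {d₁ d₂ : ℕ} (F : ℂ → ℂ) (φ : HInfty d₁ d₂) (T : ℝ)
    (u : ℝ → HInfty d₁ d₂) : Prop where
  initial : (u 0).toFun = φ.toFun
  continuous : ∀ σ : ℝ, ∀ t ∈ Set.Icc 0 T,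
    Tendsto (fun τ => freqNorm σ ((u τ).hat - (u t).hat)) (nhdsWithin t (Set.Icc 0 T)) (nhds 0)
  equation : ∀ t ∈ Set.Icc 0 T, ∀ x : Space d₁ d₂, ∃ v : ℂ,
    HasDerivWithinAt (fun τ => (u τ).toFun x) v (Set.Icc 0 T) t ∧
      Complex.I * v + laplacian (u t).toFun x = F ((u t).toFun x)

/-- Norm inflation in `H^s(ℝ^{d₁} × 𝕋^{d₂})` for the equation `i∂_t u + Δu = F(u)`. -/
def NormInflation (d₁ d₂ : ℕ) (F : ℂ → ℂ) (s : ℝ) : Prop :=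
  ∀ δ : ℝ, 0 < δ → ∃ (φ : HInfty d₁ d₂) (T : ℝ) (u : ℝ → HInfty d₁ d₂),
    φ.sobolevNorm s < δ ∧ 0 < T ∧ T < δ ∧
      IsSmoothSolution F φ T u ∧ δ⁻¹ < (u T).sobolevNorm s

/-- The scaling-critical index `s_c(d,p) = d/2 - 2/(p-1)`. -/
def criticalIndex (d p : ℕ) : ℝ := (d : ℝ) / 2 - 2 / ((p : ℝ) - 1)

/-- The range of `s` attached to the single term `u^q ū^{p-q}` on `Z = ℝ^{d₁} × 𝕋^{d₂}`. -/
def SingleTermRange (d₁ d₂ p q : ℕ) (s : ℝ) : Prop :=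
  s < min (criticalIndex (d₁ + d₂) p) 0 ∨
  (s = criticalIndex (d₁ + d₂) p ∧ s = -((d₁ + d₂ : ℕ) : ℝ) / 2) ∨
  (d₁ + d₂ = 1 ∧ p = 2 ∧ (q = 0 ∨ q = 2) ∧ s < -1) ∨
  (d₂ = 0 ∧ 1 ≤ d₁ ∧ d₁ ≤ 3 ∧ p = 2 ∧ q = 1 ∧ s < -1 / 4) ∨
  (d₁ + d₂ ≤ 3 ∧ 1 ≤ d₂ ∧ p = 2 ∧ q = 1 ∧ s < 0) ∨
  (d₁ = 0 ∧ d₂ = 1 ∧ p = 4 ∧ (q = 1 ∨ q = 2 ∨ q = 3) ∧ s < 0)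

end NLS

end

set_option linter.unusedSectionVars false

noncomputable section

/-! On the Fourier side and in the interaction picture v(t) = e^{-itΔ}u(t), the equation becomes an
ordinary differential equation in a Banach algebra, and over short times its solution is close to
the second Picard iterate. The data are B g, where g consists of boundedly many bumps of volume m at
distance about N from the origin. Dividing the Haar measure by m makes all norms of g of order one
and gives a monomial of degree p the coefficient (Bm)^{p-1}. If Θ bounds these coefficients, the
correction to the free evolution has relative size TΘ, up to an error quadratic in TΘ
(`exists_smoothSolution`). The algebra consists of continuous integrable functions vanishing at
infinity, multiplied by e^{-a|ξ|}; the weight puts every element in H^∞.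

For s < 0 the data have H^s norm at most of order B m^{1/2} N^s. If the interactions of g reach a
set E of low frequencies, the solution has H^s norm at least of order TΘB ‖⟨ξ⟩^s‖_{L²(E)}, without
the factor N^s (`exists_solution_of_duhamel_lower`). Inflation is then a choice of parameters, and
three mechanisms supply the interactions.

(1) High to low (`exists_solution_high_to_low`). With bumps at ±N and ±2N, some choice of P of them
sums to zero, where P is the top degree. If TN² is small, no oscillation occurs. If Bm is large,
only the terms of degree P matter; by symmetry of g they all have the same nonnegative Fourier
transform, and a constant phase z keeps their coefficients from cancelling. Powers of a large
parameter give s < min(s_c, 0), and s < -1 for quadratic equations in one dimension. The case s =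
s_c = -d/2 uses the logarithmic divergence of ‖⟨ξ⟩^{-d/2}‖_{L²}.

(2) A term u ū (`exists_solution_resonant`). One bump at N interacts with its own conjugate, and the
main phases N² cancel, so that T need only be small against the inverse of N times the width of the
bump in the direction of N. A bump of width 1/N gives s < -1/4 on ℝ^d; in a periodic direction the
width can be zero, which gives s < 0 for quadratic equations.

(3) Quartic terms on the circle (`exists_solution_torus`). The frequencies 2N, -N, 3N have exact
four-wave resonances with output 0, and if T is a multiple of 2π/N² every nonresonant interaction
integrates to zero. This gives s < 0.

Since s_c increases with the degree, a range of s attached to a lower-order term is covered by the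
top-degree terms whenever terms of higher degree would spoil the mechanism for that term. -/

namespace NLS

open Topology
open scoped ZeroAtInfty BoundedContinuousFunction

/-! ### The Banach space of integrable continuous functions vanishing at infinity -/

section WienerSpace

variable {G : Type*} [NormedAddCommGroup G] [MeasurableSpace G]

/-- The integrable continuous functions vanishing at infinity, as a subspace of `C₀ × L¹`. -/
def wienerSubmodule (μ : Measure G) : Submodule ℂ (C₀(G, ℂ) × Lp ℂ 1 μ) where
  carrier := {x | x.2 =ᵐ[μ] x.1}
  add_mem' {x y} hx hy := by
    change (x.2 + y.2 : Lp ℂ 1 μ) =ᵐ[μ] (x.1 + y.1 : C₀(G, ℂ))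
    filter_upwards [Lp.coeFn_add x.2 y.2, hx, hy] with ξ h h1 h2
    rw [h, Pi.add_apply, h1, h2]; rfl
  zero_mem' := by
    change (0 : Lp ℂ 1 μ) =ᵐ[μ] (0 : C₀(G, ℂ))
    filter_upwards [Lp.coeFn_zero ℂ 1 μ] with ξ h
    rw [h]; rfl
  smul_mem' c x hx := by
    change (c • x.2 : Lp ℂ 1 μ) =ᵐ[μ] (c • x.1 : C₀(G, ℂ))
    filter_upwards [Lp.coeFn_smul c x.2, hx] with ξ h h1
    rw [h, Pi.smul_apply, h1]; rfl

/-- The Banach space of integrable continuous functions vanishing at infinity, with the larger of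
the supremum norm and the `L¹` norm. -/
def Wiener (μ : Measure G) : Type _ := wienerSubmodule μ

namespace Wiener

variable {μ : Measure G}

instance : NormedAddCommGroup (Wiener μ) :=
  inferInstanceAs (NormedAddCommGroup (wienerSubmodule μ))

instance : NormedSpace ℂ (Wiener μ) := inferInstanceAs (NormedSpace ℂ (wienerSubmodule μ))

instance : CoeFun (Wiener μ) fun _ => G → ℂ := ⟨fun x => x.1.1⟩

theorem ae_eq (x : Wiener μ) : x.1.2 =ᵐ[μ] x := x.2

theorem continuous (x : Wiener μ) : Continuous x := x.1.1.continuous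

theorem tendsto_zero (x : Wiener μ) : Tendsto x (cocompact G) (𝓝 0) :=
  zero_at_infty x.1.1

theorem integrable (x : Wiener μ) : Integrable x μ :=
  (L1.integrable_coeFn x.1.2).congr x.ae_eq

@[simp] theorem add_apply (x y : Wiener μ) (ξ : G) : (x + y) ξ = x ξ + y ξ := rfl
@[simp] theorem sub_apply (x y : Wiener μ) (ξ : G) : (x - y) ξ = x ξ - y ξ := rfl
@[simp] theorem smul_apply (c : ℂ) (x : Wiener μ) (ξ : G) : (c • x) ξ = c * x ξ := rfl
@[simp] theorem zero_apply (ξ : G) : (0 : Wiener μ) ξ = 0 := rfl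

theorem ext {x y : Wiener μ} (h : ∀ ξ, x ξ = y ξ) : x = y := by
  have h1 : x.1.1 = y.1.1 := ZeroAtInftyContinuousMap.ext h
  refine Subtype.ext (Prod.ext h1 (Lp.ext ?_))
  filter_upwards [x.ae_eq, y.ae_eq] with ξ hx hy
  rw [hx, hy, h]

/-- The element of the Wiener space with given values. -/
def mk (f : G → ℂ) (hc : Continuous f) (h0 : Tendsto f (cocompact G) (𝓝 0))
    (hi : Integrable f μ) : Wiener μ :=
  ⟨(⟨⟨f, hc⟩, h0⟩, hi.toL1 f), hi.coeFn_toL1⟩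

theorem norm_snd (x : Wiener μ) : ‖x.1.2‖ = ∫ ξ, ‖x ξ‖ ∂μ := by
  rw [L1.norm_eq_integral_norm]
  refine integral_congr_ae ?_
  filter_upwards [x.ae_eq] with ξ h
  rw [h]

theorem norm_apply_le (x : Wiener μ) (ξ : G) : ‖x ξ‖ ≤ ‖x‖ := by
  have h1 : ‖x ξ‖ ≤ ‖x.1.1‖ := by
    rw [← ZeroAtInftyContinuousMap.norm_toBCF_eq_norm]
    exact x.1.1.toBCF.norm_coe_le_norm ξ
  exact h1.trans (le_max_left _ _)

theorem integral_norm_le (x : Wiener μ) : ∫ ξ, ‖x ξ‖ ∂μ ≤ ‖x‖ :=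
  (norm_snd x).symm.le.trans (le_max_right _ _)

theorem norm_le {x : Wiener μ} {C : ℝ} (hC : 0 ≤ C) (h : ∀ ξ, ‖x ξ‖ ≤ C)
    (hi : ∫ ξ, ‖x ξ‖ ∂μ ≤ C) : ‖x‖ ≤ C := by
  refine max_le ?_ ((norm_snd x).le.trans hi)
  change ‖x.1.1‖ ≤ C
  rw [← ZeroAtInftyContinuousMap.norm_toBCF_eq_norm]
  exact (BoundedContinuousFunction.norm_le hC).2 h

/-- An `L¹`-convergent sequence has a subsequence converging almost everywhere, and its limit must
agree with the uniform limit of the continuous representatives. -/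
theorem isClosed_wiener : IsClosed (wienerSubmodule μ : Set (C₀(G, ℂ) × Lp ℂ 1 μ)) := by
  refine isSeqClosed_iff_isClosed.1 ?_
  intro x y hx hxy
  have h1 : Tendsto (fun n => (x n).1) atTop (𝓝 y.1) := (continuous_fst.tendsto y).comp hxy
  have h2 : Tendsto (fun n => (x n).2) atTop (𝓝 y.2) := (continuous_snd.tendsto y).comp hxy
  obtain ⟨ns, hns, hae⟩ := (tendstoInMeasure_of_tendsto_Lp h2).exists_seq_tendsto_ae
  have h3 := ZeroAtInftyContinuousMap.tendsto_iff_tendstoUniformly.1 h1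
  change y.2 =ᵐ[μ] y.1
  filter_upwards [hae, ae_all_iff.2 hx] with ξ h4 h5
  refine tendsto_nhds_unique h4 ?_
  simp_rw [h5]
  exact ((h3.tendsto_at ξ).comp hns.tendsto_atTop)

instance : CompleteSpace (Wiener μ) := by
  have := (isClosed_wiener (μ := μ)).completeSpace_coe
  exact this

/-- Evaluation at a point. -/
def evalCLM (ξ : G) : Wiener μ →L[ℂ] ℂ :=
  LinearMap.mkContinuous ⟨⟨fun x => x ξ, fun _ _ => rfl⟩, fun _ _ => rfl⟩ 1
    fun x => by rw [one_mul]; exact x.norm_apply_le ξ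

variable [BorelSpace G] [SecondCountableTopology G]

/-- Integration against a bounded continuous function. -/
def integralCLM (c : G →ᵇ ℂ) : Wiener μ →L[ℂ] ℂ :=
  have hi : ∀ x : Wiener μ, Integrable (fun ξ => c ξ * x ξ) μ := fun x =>
    x.integrable.bdd_mul c.continuous.aestronglyMeasurable
      (ae_of_all _ fun ξ => c.norm_coe_le_norm ξ)
  LinearMap.mkContinuous ⟨⟨fun x => ∫ ξ, c ξ * x ξ ∂μ, fun x y => by
      rw [← integral_add (hi x) (hi y)]; simp only [add_apply, mul_add]⟩, fun a x => by
      rw [RingHom.id_apply, smul_eq_mul, ← integral_const_mul]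
      exact integral_congr_ae (ae_of_all _ fun ξ => by simp only [smul_apply]; ring)⟩ ‖c‖
    fun x => by
      refine (norm_integral_le_integral_norm _).trans ?_
      calc ∫ ξ, ‖c ξ * x ξ‖ ∂μ ≤ ∫ ξ, ‖c‖ * ‖x ξ‖ ∂μ := by
            refine integral_mono (hi x).norm (x.integrable.norm.const_mul _) fun ξ => ?_
            simp only [norm_mul]
            gcongr
            exact c.norm_coe_le_norm ξ
        _ ≤ ‖c‖ * ‖x‖ := by
            rw [integral_const_mul]
            gcongr
            exact x.integral_norm_le

theorem integralCLM_apply (c : G →ᵇ ℂ) (x : Wiener μ) :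
    integralCLM c x = ∫ ξ, c ξ * x ξ ∂μ := rfl

/-- Multiplication of an element of the Wiener space by a bounded continuous function. -/
def mulBCF (c : G →ᵇ ℂ) (x : Wiener μ) : Wiener μ :=
  mk (fun ξ => c ξ * x ξ) (c.continuous.mul x.continuous)
    (by
      refine squeeze_zero_norm (a := fun ξ => ‖c‖ * ‖x ξ‖) (fun ξ => ?_) ?_
      · rw [norm_mul]
        gcongr
        exact c.norm_coe_le_norm ξ
      · simpa using (x.tendsto_zero.norm).const_mul ‖c‖)
    (x.integrable.bdd_mul c.continuous.aestronglyMeasurable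
      (ae_of_all _ fun ξ => c.norm_coe_le_norm ξ))

@[simp] theorem mulBCF_apply (c : G →ᵇ ℂ) (x : Wiener μ) (ξ : G) :
    mulBCF c x ξ = c ξ * x ξ := rfl

theorem norm_mulBCF_le (c : G →ᵇ ℂ) (x : Wiener μ) : ‖mulBCF c x‖ ≤ ‖c‖ * ‖x‖ := by
  have h : ∀ ξ, ‖mulBCF c x ξ‖ ≤ ‖c‖ * ‖x ξ‖ := fun ξ => by
    rw [mulBCF_apply, norm_mul]
    gcongr
    exact c.norm_coe_le_norm ξ
  refine norm_le (by positivity) (fun ξ => (h ξ).trans ?_) ?_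
  · gcongr
    exact x.norm_apply_le ξ
  · refine (integral_mono (mulBCF c x).integrable.norm (x.integrable.norm.const_mul _) h).trans ?_
    rw [integral_const_mul]
    gcongr
    exact x.integral_norm_le

/-- The action of bounded continuous functions on the Wiener space. -/
def mulCLM : (G →ᵇ ℂ) →L[ℂ] Wiener μ →L[ℂ] Wiener μ :=
  LinearMap.mkContinuous₂ (LinearMap.mk₂ ℂ mulBCF
    (fun c d x => ext fun ξ => by simp [add_mul])
    (fun a c x => ext fun ξ => by simp [mul_assoc])
    (fun c x y => ext fun ξ => by simp [mul_add])
    (fun a c x => ext fun ξ => by simp [mul_left_comm])) 1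
    (fun c x => by simpa using norm_mulBCF_le c x)

@[simp] theorem mulCLM_apply (c : G →ᵇ ℂ) (x : Wiener μ) (ξ : G) :
    mulCLM c x ξ = c ξ * x ξ := rfl

theorem norm_mulCLM_apply_le (c : G →ᵇ ℂ) (x : Wiener μ) : ‖mulCLM c x‖ ≤ ‖c‖ * ‖x‖ :=
  norm_mulBCF_le c x

section Reflection

variable [μ.IsNegInvariant]

/-- The reflection `ξ ↦ conj (x (-ξ))`, the counterpart of complex conjugation. -/
def conjRefl (x : Wiener μ) : Wiener μ :=
  mk (fun ξ => starRingEnd ℂ (x (-ξ))) (Complex.continuous_conj.comp (x.continuous.comp continuous_neg))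
    (by
      have h := (Complex.continuous_conj.tendsto 0).comp
        (x.tendsto_zero.comp (Homeomorph.neg G).isClosedEmbedding.tendsto_cocompact)
      rw [map_zero] at h
      exact h)
    (by
      have h := x.integrable.comp_neg
      exact (RCLike.conjLIE (K := ℂ)).integrable_comp_iff.2 h)

@[simp] theorem conjRefl_apply (x : Wiener μ) (ξ : G) :
    conjRefl x ξ = starRingEnd ℂ (x (-ξ)) := rfl

theorem norm_conjRefl_le (x : Wiener μ) : ‖conjRefl x‖ ≤ ‖x‖ := by
  refine norm_le (norm_nonneg _) (fun ξ => ?_) ?_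
  · rw [conjRefl_apply, RCLike.norm_conj]
    exact x.norm_apply_le _
  · simp only [conjRefl_apply, RCLike.norm_conj]
    rw [integral_neg_eq_self (fun ξ => ‖x ξ‖) μ]
    exact x.integral_norm_le

theorem conjRefl_sub (x y : Wiener μ) : conjRefl (x - y) = conjRefl x - conjRefl y :=
  ext fun ξ => by simp

end Reflection

end Wiener
end WienerSpace

/-! ### The weighted convolution algebra and the free phases -/

section WienerConvolution

variable {G : Type*} [NormedAddCommGroup G] [MeasurableSpace G]

/-- Convolution of complex functions. -/
def conv (μ : Measure G) (f g : G → ℂ) : G → ℂ :=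
  convolution f g (ContinuousLinearMap.mul ℂ ℂ) μ

theorem conv_apply (μ : Measure G) (f g : G → ℂ) (ξ : G) :
    conv μ f g ξ = ∫ η, f η * g (ξ - η) ∂μ := rfl

namespace Wiener

variable {μ : Measure G}

/-- The exponentially decaying function obtained from an element of the Wiener space. -/
def hat (a : ℝ) (x : Wiener μ) (ξ : G) : ℂ := (Real.exp (-a * ‖ξ‖) : ℂ) * x ξ

theorem continuous_hat (a : ℝ) (x : Wiener μ) : Continuous (hat a x) := by
  have := x.continuous
  unfold hat
  fun_prop

theorem norm_hat (a : ℝ) (x : Wiener μ) (ξ : G) :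
    ‖hat a x ξ‖ = Real.exp (-a * ‖ξ‖) * ‖x ξ‖ := by
  rw [hat, norm_mul, Complex.norm_real, Real.norm_of_nonneg (Real.exp_pos _).le]

theorem norm_hat_le {a : ℝ} (ha : 0 ≤ a) (x : Wiener μ) (ξ : G) : ‖hat a x ξ‖ ≤ ‖x ξ‖ := by
  rw [norm_hat]
  refine mul_le_of_le_one_left (norm_nonneg _) (Real.exp_le_one_iff.2 ?_)
  nlinarith [norm_nonneg ξ]

variable [BorelSpace G] [SecondCountableTopology G]

theorem integrable_hat {a : ℝ} (ha : 0 ≤ a) (x : Wiener μ) : Integrable (hat a x) μ :=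
  x.integrable.mono (continuous_hat a x).aestronglyMeasurable (ae_of_all _ (norm_hat_le ha x))

section Mul

variable [ProperSpace G] [μ.IsAddHaarMeasure]

theorem integrable_norm_conv (x y : Wiener μ) :
    Integrable (fun ξ => ∫ η, ‖x η‖ * ‖y (ξ - η)‖ ∂μ) μ :=
  Integrable.integrable_convolution (ContinuousLinearMap.mul ℝ ℝ) x.integrable.norm y.integrable.norm

theorem integral_norm_conv (x y : Wiener μ) :
    ∫ ξ, ∫ η, ‖x η‖ * ‖y (ξ - η)‖ ∂μ ∂μ = (∫ ξ, ‖x ξ‖ ∂μ) * ∫ ξ, ‖y ξ‖ ∂μ :=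
  integral_convolution (ContinuousLinearMap.mul ℝ ℝ) x.integrable.norm y.integrable.norm

theorem integrable_mul_norm_sub (x y : Wiener μ) (ξ : G) :
    Integrable (fun η => ‖x η‖ * ‖y (ξ - η)‖) μ :=
  x.integrable.norm.mul_bdd (c := ‖y‖) (by
    have := y.continuous
    exact (by fun_prop : Continuous fun η => ‖y (ξ - η)‖).aestronglyMeasurable)
    (ae_of_all _ fun η => by rw [norm_norm]; exact y.norm_apply_le _)

theorem norm_conv_pointwise_le (x y : Wiener μ) (ξ : G) :
    ∫ η, ‖x η‖ * ‖y (ξ - η)‖ ∂μ ≤ ‖x‖ * ‖y‖ := by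
  calc ∫ η, ‖x η‖ * ‖y (ξ - η)‖ ∂μ ≤ ∫ η, ‖x η‖ * ‖y‖ ∂μ := by
        refine integral_mono (integrable_mul_norm_sub x y ξ) (x.integrable.norm.mul_const _) fun η => ?_
        dsimp only
        gcongr
        exact y.norm_apply_le _
    _ ≤ ‖x‖ * ‖y‖ := by
        rw [integral_mul_const]
        gcongr
        exact x.integral_norm_le

/-- For fixed η the factor y(ξ - η) tends to zero as ξ leaves compact sets, and the integrand is
dominated by the integrable function ‖y‖ |x|. -/
theorem tendsto_norm_conv (x y : Wiener μ) :
    Tendsto (fun ξ => ∫ η, ‖x η‖ * ‖y (ξ - η)‖ ∂μ) (cocompact G) (𝓝 0) := by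
  have hcg : (cocompact G).IsCountablyGenerated := by
    rw [← Metric.cobounded_eq_cocompact, ← comap_norm_atTop]
    infer_instance
  have h := tendsto_integral_filter_of_dominated_convergence (μ := μ) (l := cocompact G)
    (F := fun ξ η => ‖x η‖ * ‖y (ξ - η)‖) (f := fun _ => 0) (fun η => ‖x η‖ * ‖y‖)
    (Eventually.of_forall fun ξ => (integrable_mul_norm_sub x y ξ).aestronglyMeasurable)
    (Eventually.of_forall fun ξ => ae_of_all _ fun η => by
      rw [norm_mul, norm_norm, norm_norm]
      gcongr
      exact y.norm_apply_le _)
    (x.integrable.norm.mul_const _)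
    (ae_of_all _ fun η => by
      have h1 := (y.tendsto_zero.comp
        (Homeomorph.subRight η).isClosedEmbedding.tendsto_cocompact).norm.const_mul ‖x η‖
      simpa using h1)
  simpa using h

/-- The triangle inequality gives e^{a|ξ|} ≤ e^{a|η|} e^{a|ξ-η|}, so the weights of the two factors
absorb the weight of the product. Hence the weighted product obeys the same bounds as plain
convolution, with constant one. -/
theorem norm_exp_mul_conv_hat_le {a : ℝ} (ha : 0 ≤ a) (x y : Wiener μ) (ξ : G) :
    ‖(Real.exp (a * ‖ξ‖) : ℂ) * conv μ (hat a x) (hat a y) ξ‖ ≤ ∫ η, ‖x η‖ * ‖y (ξ - η)‖ ∂μ := by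
  rw [conv_apply, ← integral_const_mul]
  refine (norm_integral_le_integral_norm _).trans ?_
  refine integral_mono_of_nonneg (ae_of_all _ fun η => norm_nonneg _)
    (integrable_mul_norm_sub x y ξ) (ae_of_all _ fun η => ?_)
  dsimp only
  rw [norm_mul, norm_mul, norm_hat, norm_hat, Complex.norm_real,
    Real.norm_of_nonneg (Real.exp_pos _).le]
  calc Real.exp (a * ‖ξ‖) * (Real.exp (-a * ‖η‖) * ‖x η‖ * (Real.exp (-a * ‖ξ - η‖) * ‖y (ξ - η)‖))
      = Real.exp (a * ‖ξ‖ + -a * ‖η‖ + -a * ‖ξ - η‖) * (‖x η‖ * ‖y (ξ - η)‖) := by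
        rw [Real.exp_add, Real.exp_add]; ring
    _ ≤ ‖x η‖ * ‖y (ξ - η)‖ := by
        refine mul_le_of_le_one_left (by positivity) (Real.exp_le_one_iff.2 ?_)
        have : ‖ξ‖ ≤ ‖η‖ + ‖ξ - η‖ := by simpa using norm_add_le η (ξ - η)
        nlinarith

theorem continuous_conv_hat {a : ℝ} (ha : 0 ≤ a) (x y : Wiener μ) :
    Continuous (conv μ (hat a x) (hat a y)) := by
  refine BddAbove.continuous_convolution_right_of_integrable _ ?_ (integrable_hat ha x)
    (continuous_hat a y)
  refine ⟨‖y‖, ?_⟩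
  rintro _ ⟨ξ, rfl⟩
  exact (norm_hat_le ha y ξ).trans (y.norm_apply_le ξ)

/-- Convolution, transported to the Wiener space by the exponential weight. -/
def mulFun {a : ℝ} (ha : 0 ≤ a) (x y : Wiener μ) : Wiener μ :=
  mk (fun ξ => (Real.exp (a * ‖ξ‖) : ℂ) * conv μ (hat a x) (hat a y) ξ)
    ((by fun_prop : Continuous fun ξ : G => (Real.exp (a * ‖ξ‖) : ℂ)).mul (continuous_conv_hat ha x y))
    (squeeze_zero_norm (norm_exp_mul_conv_hat_le ha x y) (tendsto_norm_conv x y))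
    ((integrable_norm_conv x y).mono'
      ((by fun_prop : Continuous fun ξ : G => (Real.exp (a * ‖ξ‖) : ℂ)).mul
        (continuous_conv_hat ha x y)).aestronglyMeasurable
      (ae_of_all _ (norm_exp_mul_conv_hat_le ha x y)))

theorem mulFun_apply {a : ℝ} (ha : 0 ≤ a) (x y : Wiener μ) (ξ : G) :
    mulFun ha x y ξ = (Real.exp (a * ‖ξ‖) : ℂ) * conv μ (hat a x) (hat a y) ξ := rfl

theorem norm_mulFun_le {a : ℝ} (ha : 0 ≤ a) (x y : Wiener μ) : ‖mulFun ha x y‖ ≤ ‖x‖ * ‖y‖ := by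
  refine norm_le (by positivity)
    (fun ξ => (norm_exp_mul_conv_hat_le ha x y ξ).trans (norm_conv_pointwise_le x y ξ)) ?_
  refine (integral_mono (mulFun ha x y).integrable.norm (integrable_norm_conv x y)
    (norm_exp_mul_conv_hat_le ha x y)).trans ?_
  rw [integral_norm_conv]
  gcongr
  exacts [x.integral_norm_le, y.integral_norm_le]

theorem integrable_hat_mul_hat_sub {a : ℝ} (ha : 0 ≤ a) (x y : Wiener μ) (ξ : G) :
    Integrable (fun η => hat a x η * hat a y (ξ - η)) μ := by
  refine (integrable_mul_norm_sub x y ξ).mono' ?_ (ae_of_all _ fun η => ?_)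
  · have h1 := continuous_hat a x
    have h2 := continuous_hat a y
    exact (by fun_prop : Continuous fun η => hat a x η * hat a y (ξ - η)).aestronglyMeasurable
  · rw [norm_mul]
    gcongr
    exacts [norm_hat_le ha x η, norm_hat_le ha y _]

/-- The weighted convolution product. -/
def mulL {a : ℝ} (ha : 0 ≤ a) : Wiener μ →L[ℂ] Wiener μ →L[ℂ] Wiener μ :=
  LinearMap.mkContinuous₂ (LinearMap.mk₂ ℂ (mulFun ha)
    (fun x x' y => ext fun ξ => by
      rw [add_apply, mulFun_apply, mulFun_apply, mulFun_apply, ← mul_add, conv_apply, conv_apply,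
        conv_apply, ← integral_add (integrable_hat_mul_hat_sub ha x y ξ)
          (integrable_hat_mul_hat_sub ha x' y ξ)]
      congr 2 with η
      simp only [hat, add_apply]; ring)
    (fun c x y => ext fun ξ => by
      rw [smul_apply, mulFun_apply, mulFun_apply, mul_left_comm, conv_apply, conv_apply,
        ← integral_const_mul c]
      refine congrArg _ (integral_congr_ae (ae_of_all _ fun η => ?_))
      simp only [hat, smul_apply]; ring)
    (fun x y y' => ext fun ξ => by
      rw [add_apply, mulFun_apply, mulFun_apply, mulFun_apply, ← mul_add, conv_apply, conv_apply,
        conv_apply, ← integral_add (integrable_hat_mul_hat_sub ha x y ξ)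
          (integrable_hat_mul_hat_sub ha x y' ξ)]
      congr 2 with η
      simp only [hat, add_apply]; ring)
    (fun c x y => ext fun ξ => by
      rw [smul_apply, mulFun_apply, mulFun_apply, mul_left_comm, conv_apply, conv_apply,
        ← integral_const_mul c]
      refine congrArg _ (integral_congr_ae (ae_of_all _ fun η => ?_))
      simp only [hat, smul_apply]; ring)) 1
    (fun x y => by rw [one_mul]; exact norm_mulFun_le ha x y)

theorem norm_mulL_le {a : ℝ} (ha : 0 ≤ a) (x y : Wiener μ) : ‖mulL ha x y‖ ≤ ‖x‖ * ‖y‖ :=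
  norm_mulFun_le ha x y

theorem hat_mulL {a : ℝ} (ha : 0 ≤ a) (x y : Wiener μ) :
    hat a (mulL ha x y) = conv μ (hat a x) (hat a y) := by
  funext ξ
  change (Real.exp (-a * ‖ξ‖) : ℂ) * ((Real.exp (a * ‖ξ‖) : ℂ) * _) = _
  rw [← mul_assoc, ← Complex.ofReal_mul, ← Real.exp_add]
  simp

theorem hat_conjRefl (a : ℝ) (x : Wiener μ) (ξ : G) :
    hat a (conjRefl x) ξ = starRingEnd ℂ (hat a x (-ξ)) := by
  rw [hat, hat, conjRefl_apply, map_mul, Complex.conj_ofReal, norm_neg]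

end Mul

section Phase

variable [ProperSpace G]

/-- The unimodular multiplier `e^{-itω}`. -/
def phase (ω : C(G, ℝ)) (t : ℝ) : G →ᵇ ℂ :=
  BoundedContinuousFunction.ofNormedAddCommGroup
    (fun ξ => Complex.exp (-(t * ω ξ : ℝ) * Complex.I)) (by fun_prop) 1
    (fun ξ => by rw [← Complex.ofReal_neg, Complex.norm_exp_ofReal_mul_I])

theorem phase_apply (ω : C(G, ℝ)) (t : ℝ) (ξ : G) :
    phase ω t ξ = Complex.exp (-(t * ω ξ : ℝ) * Complex.I) := rfl

theorem norm_phase_apply (ω : C(G, ℝ)) (t : ℝ) (ξ : G) : ‖phase ω t ξ‖ = 1 := by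
  rw [phase_apply, ← Complex.ofReal_neg, Complex.norm_exp_ofReal_mul_I]

theorem norm_phase_le (ω : C(G, ℝ)) (t : ℝ) : ‖phase ω t‖ ≤ 1 :=
  (BoundedContinuousFunction.norm_le zero_le_one).2 fun ξ => (norm_phase_apply ω t ξ).le

theorem norm_phase_sub_le (ω : C(G, ℝ)) (s t : ℝ) (ξ : G) :
    ‖phase ω s ξ - phase ω t ξ‖ ≤ |s - t| * |ω ξ| := by
  have h : phase ω s ξ - phase ω t ξ =
      phase ω t ξ * (Complex.exp (Complex.I * ((-((s - t) * ω ξ) : ℝ) : ℂ)) - 1) := by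
    rw [mul_sub, phase_apply, phase_apply, ← Complex.exp_add, mul_one]
    congr 2
    push_cast
    ring
  rw [h, norm_mul, norm_phase_apply, one_mul]
  refine (Real.norm_exp_I_mul_ofReal_sub_one_le).trans ?_
  rw [norm_neg, norm_mul, Real.norm_eq_abs, Real.norm_eq_abs]

theorem norm_mulCLM_phase_le (ω : C(G, ℝ)) (t : ℝ) (x : Wiener μ) :
    ‖mulCLM (phase ω t) x‖ ≤ ‖x‖ :=
  (norm_mulCLM_apply_le _ _).trans (mul_le_of_le_one_left (norm_nonneg _) (norm_phase_le ω t))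

/-- The free evolution is strongly continuous. -/
theorem continuous_mulCLM_phase (ω : C(G, ℝ)) (x : Wiener μ) :
    Continuous fun t => mulCLM (phase ω t) x := by
  rw [continuous_iff_continuousAt]
  intro t
  rw [ContinuousAt, tendsto_iff_norm_sub_tendsto_zero]
  -- The `L¹` half of the norm follows by dominated convergence. There is no continuity in operator
  -- norm, since ω may be unbounded.
  have hint : Tendsto (fun s => ∫ ξ, ‖(mulCLM (phase ω s) x - mulCLM (phase ω t) x) ξ‖ ∂μ)
      (𝓝 t) (𝓝 0) := by
    have h := tendsto_integral_filter_of_dominated_convergence (μ := μ) (l := 𝓝 t)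
      (F := fun s ξ => ‖(mulCLM (phase ω s) x - mulCLM (phase ω t) x) ξ‖) (f := fun _ => 0)
      (fun ξ => 2 * ‖x ξ‖)
      (Eventually.of_forall fun s => (Wiener.continuous _).norm.aestronglyMeasurable)
      (Eventually.of_forall fun s => ae_of_all _ fun ξ => by
        rw [norm_norm, sub_apply, mulCLM_apply, mulCLM_apply, ← sub_mul, norm_mul]
        gcongr
        refine (norm_sub_le _ _).trans ?_
        rw [norm_phase_apply, norm_phase_apply]; norm_num)
      (x.integrable.norm.const_mul _)
      (ae_of_all _ fun ξ => by
        have hc : Continuous fun s => ‖(mulCLM (phase ω s) x - mulCLM (phase ω t) x) ξ‖ := by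
          simp only [sub_apply, mulCLM_apply, phase_apply]
          fun_prop
        have h1 := hc.tendsto t
        simpa using h1)
    simpa using h
  rw [Metric.tendsto_nhds]
  intro ε hε
  -- For the supremum half, x is small outside a ball, and on the ball ω is bounded, so the phases
  -- converge uniformly there.
  have h1 : ∀ᶠ ξ in cocompact G, ‖x ξ‖ < ε / 4 := by
    have := (x.tendsto_zero.norm)
    rw [norm_zero] at this
    exact this.eventually (gt_mem_nhds (by positivity))
  rw [← Metric.cobounded_eq_cocompact, ← comap_norm_atTop] at h1
  obtain ⟨R, hR⟩ : ∃ R : ℝ, ∀ ξ : G, R ≤ ‖ξ‖ → ‖x ξ‖ < ε / 4 := by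
    rw [eventually_comap] at h1
    obtain ⟨R, hR⟩ := eventually_atTop.1 h1
    exact ⟨R, fun ξ h => hR _ h ξ rfl⟩
  obtain ⟨C, hC⟩ := (isCompact_closedBall (0 : G) R).exists_bound_of_continuousOn
    ω.continuous.continuousOn
  have h2 : ∀ᶠ s in 𝓝 t, |s - t| * (|C| * ‖x‖) < ε / 2 := by
    have : Tendsto (fun s => |s - t| * (|C| * ‖x‖)) (𝓝 t) (𝓝 0) := by
      have hc : Continuous fun s => |s - t| * (|C| * ‖x‖) := by fun_prop
      simpa using hc.tendsto t
    exact this.eventually (gt_mem_nhds (by positivity))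
  have h3 := hint.eventually (gt_mem_nhds (half_pos hε))
  filter_upwards [h2, h3] with s h4 h5
  rw [Real.dist_eq, sub_zero, abs_of_nonneg (norm_nonneg _)]
  refine lt_of_le_of_lt (norm_le (half_pos hε).le (fun ξ => ?_) h5.le) (half_lt_self hε)
  rw [sub_apply, mulCLM_apply, mulCLM_apply, ← sub_mul, norm_mul]
  rcases le_total R ‖ξ‖ with h | h
  · have : ‖phase ω s ξ - phase ω t ξ‖ ≤ 2 := by
      refine (norm_sub_le _ _).trans ?_
      rw [norm_phase_apply, norm_phase_apply]; norm_num
    nlinarith [hR ξ h, norm_nonneg (x ξ)]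
  · have h6 : |ω ξ| ≤ |C| :=
      (hC ξ (by simpa using h)).trans (le_abs_self C)
    calc ‖phase ω s ξ - phase ω t ξ‖ * ‖x ξ‖ ≤ |s - t| * |C| * ‖x‖ := by
          gcongr
          · exact (norm_phase_sub_le ω s t ξ).trans (by gcongr)
          · exact x.norm_apply_le ξ
      _ ≤ ε / 2 := by rw [mul_assoc]; exact h4.le

end Phase

end Wiener
end WienerConvolution

/-! ### Monomials as iterated products -/

section IteratedProduct

/-- The iterated product `x 0 * (x 1 * (… * x n))` with respect to a binary operation. -/
def iterProd {E : Type*} (m : E → E → E) : (n : ℕ) → (Fin (n + 1) → E) → E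
  | 0, x => x 0
  | n + 1, x => m (x 0) (iterProd m n fun i => x i.succ)

/-- Used twice: with Φ the passage to the weighted Fourier side, where the product is convolution,
and with Φ the synthesis at a point of `Z`, where it is multiplication of complex numbers. -/
theorem map_iterProd {E E' : Type*} {m : E → E → E} {m' : E' → E' → E'} {Φ : E → E'}
    (h : ∀ a b, Φ (m a b) = m' (Φ a) (Φ b)) (n : ℕ) (x : Fin (n + 1) → E) :
    Φ (iterProd m n x) = iterProd m' n fun i => Φ (x i) := by
  induction n with
  | zero => rfl
  | succ n ih => rw [iterProd, iterProd, h, ih]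

theorem iterProd_mul {R : Type*} [CommMonoid R] (n : ℕ) (x : Fin (n + 1) → R) :
    iterProd (fun a b => a * b) n x = ∏ i, x i := by
  induction n with
  | zero => simp [iterProd]
  | succ n ih => rw [iterProd, ih, Fin.prod_univ_succ x]

variable {E : Type*} [NormedAddCommGroup E] [NormedSpace ℂ E]

theorem norm_iterProd_le {m : E →L[ℂ] E →L[ℂ] E} (hm : ∀ x y, ‖m x y‖ ≤ ‖x‖ * ‖y‖) {D : ℝ}
    (hD : 0 ≤ D) (n : ℕ) (x : Fin (n + 1) → E) (hx : ∀ i, ‖x i‖ ≤ D) :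
    ‖iterProd (fun a b => m a b) n x‖ ≤ D ^ (n + 1) := by
  induction n with
  | zero => simpa [iterProd] using hx 0
  | succ n ih =>
    rw [iterProd, pow_succ']
    exact (hm _ _).trans (mul_le_mul (hx 0) (ih _ fun i => hx _) (norm_nonneg _) hD)

/-- Telescoping: one factor is replaced at a time, each replacement costing ε while the other n
factors are at most D. -/
theorem norm_iterProd_sub_le {m : E →L[ℂ] E →L[ℂ] E} (hm : ∀ x y, ‖m x y‖ ≤ ‖x‖ * ‖y‖) {D ε : ℝ}
    (hD : 0 ≤ D) (hε : 0 ≤ ε) (n : ℕ) (x y : Fin (n + 1) → E) (hx : ∀ i, ‖x i‖ ≤ D)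
    (hy : ∀ i, ‖y i‖ ≤ D) (h : ∀ i, ‖x i - y i‖ ≤ ε) :
    ‖iterProd (fun a b => m a b) n x - iterProd (fun a b => m a b) n y‖ ≤ (n + 1) * D ^ n * ε := by
  induction n with
  | zero => simpa [iterProd] using h 0
  | succ n ih =>
    set X := iterProd (fun a b => m a b) n fun i => x i.succ
    set Y := iterProd (fun a b => m a b) n fun i => y i.succ
    have h1 : m (x 0) X - m (y 0) Y = m (x 0) (X - Y) + m (x 0 - y 0) Y := by
      simp only [map_sub, sub_apply]; abel
    change ‖m (x 0) X - m (y 0) Y‖ ≤ _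
    rw [h1]
    have hX := ih (fun i => x i.succ) (fun i => y i.succ) (fun i => hx _) (fun i => hy _)
      (fun i => h _)
    have hY : ‖Y‖ ≤ D ^ (n + 1) := norm_iterProd_le hm hD n _ fun i => hy _
    calc ‖m (x 0) (X - Y) + m (x 0 - y 0) Y‖ ≤ D * ((n + 1) * D ^ n * ε) + ε * D ^ (n + 1) := by
          refine (norm_add_le _ _).trans (add_le_add ((hm _ _).trans ?_) ((hm _ _).trans ?_))
          · exact mul_le_mul (hx 0) hX (norm_nonneg _) hD
          · exact mul_le_mul (h 0) hY (norm_nonneg _) hε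
      _ = ((n + 1 : ℕ) + 1) * D ^ (n + 1) * ε := by push_cast; ring

theorem continuous_iterProd (m : E →L[ℂ] E →L[ℂ] E) (n : ℕ) (x : ℝ → Fin (n + 1) → E)
    (hx : ∀ i, Continuous fun t => x t i) :
    Continuous fun t => iterProd (fun a b => m a b) n (x t) := by
  induction n with
  | zero => exact hx 0
  | succ n ih =>
    have h1 := ih (fun t i => x t i.succ) fun i => hx _
    exact (m.continuous.comp (hx 0)).clm_apply h1

/-- The factors of the monomial `x^q x̄^(n+1-q)`, with `c` in the role of conjugation. -/
def factors {E : Type*} (c : E → E) (q n : ℕ) (x : E) (i : Fin (n + 1)) : E :=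
  if (i : ℕ) < q then x else c x

theorem map_factors {E E' : Type*} {c : E → E} {c' : E' → E'} {Φ : E → E'}
    (h : ∀ a, Φ (c a) = c' (Φ a)) (q n : ℕ) (x : E) (i : Fin (n + 1)) :
    Φ (factors c q n x i) = factors c' q n (Φ x) i := by
  unfold factors
  split_ifs <;> simp [h]

theorem prod_factors {R : Type*} [CommMonoid R] (c : R → R) {q n : ℕ} (hq : q ≤ n + 1) (x : R) :
    ∏ i, factors c q n x i = x ^ q * c x ^ (n + 1 - q) := by
  unfold factors
  rw [Fin.prod_univ_eq_prod_range (fun i => if i < q then x else c x), Finset.prod_ite,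
    Finset.prod_const, Finset.prod_const]
  have h1 : (Finset.range (n + 1)).filter (· < q) = Finset.range q := by
    ext i; simp; omega
  have h2 : ((Finset.range (n + 1)).filter (¬ · < q)) = Finset.Ico q (n + 1) := by
    ext i; simp; omega
  rw [h1, h2, Finset.card_range, Nat.card_Ico]

end IteratedProduct

/-! ### Picard iteration and the interaction picture -/

section Picard

open Metric ODE

/-- The solution of an ordinary differential equation given by the Picard–Lindelöf theorem,
with the error of its second Picard iterate. -/
theorem exists_solution_second_iterate {E : Type*} [NormedAddCommGroup E] [NormedSpace ℝ E]
    [CompleteSpace E] {f : ℝ → E → E} {x₀ : E} {K L T : ℝ} (hK : 0 ≤ K) (hL : 0 ≤ L) (hT : 0 ≤ T)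
    (hcont : ∀ x, Continuous fun t => f t x)
    (hlip : ∀ t, ∀ x ∈ closedBall x₀ 1, ∀ y ∈ closedBall x₀ 1, ‖f t x - f t y‖ ≤ K * ‖x - y‖)
    (hbd : ∀ t, ∀ x ∈ closedBall x₀ 1, ‖f t x‖ ≤ L) (hLT : L * T ≤ 1) :
    ∃ v : ℝ → E, v 0 = x₀ ∧
      (∀ t ∈ Set.Icc 0 T, HasDerivWithinAt v (f t (v t)) (Set.Icc 0 T) t) ∧
      ‖v T - x₀ - ∫ t in (0 : ℝ)..T, f t x₀‖ ≤ K * L * T ^ 2 := by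
  lift K to NNReal using hK
  lift L to NNReal using hL
  have hf : IsPicardLindelof f (tmin := 0) (tmax := T) ⟨0, le_rfl, hT⟩ x₀ 1 0 L K := by
    refine ⟨fun t _ => LipschitzOnWith.of_dist_le_mul fun x hx y hy => ?_,
      fun x _ => (hcont x).continuousOn, fun t _ x hx => hbd t x hx, ?_⟩
    · rw [dist_eq_norm, dist_eq_norm]; exact hlip t x hx y hy
    · simpa [hT] using hLT
  obtain ⟨α, hα⟩ := ODE.FunSpace.exists_isFixedPt_next hf (mem_closedBall_self le_rfl)
  have hball : ∀ t, α.compProj t ∈ closedBall x₀ 1 := fun t =>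
    α.compProj_mem_closedBall hf.mul_max_le
  have h0 : α.compProj 0 = x₀ := by
    have : α.compProj ((⟨0, le_rfl, hT⟩ : Set.Icc 0 T) : ℝ) = x₀ := by
      rw [FunSpace.compProj_val, ← hα, FunSpace.next_apply₀]
    exact this
  have hderiv : ∀ t ∈ Set.Icc 0 T,
      HasDerivWithinAt α.compProj (f t (α.compProj t)) (Set.Icc 0 T) t := by
    intro t ht
    apply hasDerivWithinAt_picard_Icc ⟨le_rfl, hT⟩ hf.continuousOn_uncurry
      α.continuous_compProj.continuousOn (fun _ ht' ↦ α.compProj_mem_closedBall hf.mul_max_le)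
      x₀ ht |>.congr_of_mem _ ht
    intro t' ht'
    nth_rw 1 [← hα]
    rw [FunSpace.compProj_of_mem ht', FunSpace.next_apply]
  refine ⟨α.compProj, h0, hderiv, ?_⟩
  -- The solution moves by at most LT, so its velocity differs from f(t, x₀) by at most KLT;
  -- integrating once more over [0,T] gives the error KLT².
  have h1 : ∀ t ∈ Set.Icc 0 T, ‖α.compProj t - x₀‖ ≤ L * T := by
    intro t ht
    have := norm_image_sub_le_of_norm_deriv_le_segment' hderiv
      (fun t _ => hbd t _ (hball t)) t ht
    rw [h0, sub_zero] at this
    exact this.trans (by gcongr; exact ht.2)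
  have h2 : ∀ t ∈ Set.Icc 0 T, HasDerivWithinAt
      (fun t => α.compProj t - ∫ s in (0 : ℝ)..t, f s x₀) (f t (α.compProj t) - f t x₀)
      (Set.Icc 0 T) t := fun t ht =>
    (hderiv t ht).sub ((intervalIntegral.integral_hasDerivAt_right
      ((hcont x₀).intervalIntegrable _ _) ((hcont x₀).stronglyMeasurableAtFilter _ _)
      (hcont x₀).continuousAt).hasDerivWithinAt)
  have h3 := norm_image_sub_le_of_norm_deriv_le_segment' h2 (C := K * (L * T))
    (fun t ht => (hlip t _ (hball t) _ (mem_closedBall_self zero_le_one)).trans (by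
      gcongr; exact h1 t ⟨ht.1, ht.2.le⟩)) T ⟨hT, le_rfl⟩
  rw [h0, intervalIntegral.integral_same, sub_zero, sub_zero] at h3
  rw [sub_right_comm]
  exact h3.trans (le_of_eq (by ring))

end Picard

section InteractionPicture

variable {E : Type*} [NormedAddCommGroup E] [NormedSpace ℂ E]

/-- The vector field of a polynomial Schrödinger equation in the interaction picture. -/
def interactionField (m : E →L[ℂ] E →L[ℂ] E) (c : E → E) (S : ℝ → E →L[ℂ] E) {n : ℕ}
    (p q : Fin n → ℕ) (κ : Fin n → ℂ) (t : ℝ) (x : E) : E :=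
  ∑ j, κ j • S (-t) (iterProd (fun a b => m a b) (p j - 1) (factors c (q j) (p j - 1) (S t x)))

/-- A uniformly bounded, strongly continuous family is jointly continuous: the change of the
argument costs at most its own norm, and at a fixed argument strong continuity applies. -/
theorem continuous_strong {S : ℝ → E →L[ℂ] E} (hS : ∀ t x, ‖S t x‖ ≤ ‖x‖)
    (hSc : ∀ x, Continuous fun t => S t x) {X : Type*} [TopologicalSpace X] {g : X → E}
    {r : X → ℝ} (hg : Continuous g) (hr : Continuous r) : Continuous fun s => S (r s) (g s) := by
  rw [continuous_iff_continuousAt]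
  intro s
  have h1 : Tendsto (fun s' => S (r s') (g s)) (𝓝 s) (𝓝 (S (r s) (g s))) :=
    ((hSc (g s)).comp hr).tendsto s
  have h2 : Tendsto (fun s' => S (r s') (g s' - g s)) (𝓝 s) (𝓝 0) := by
    refine squeeze_zero_norm (fun s' => hS _ _) ?_
    have : Continuous fun s' => ‖g s' - g s‖ := by fun_prop
    simpa using this.tendsto s
  have h3 := h1.add h2
  rw [add_zero] at h3
  refine h3.congr fun s' => ?_
  rw [← map_add]; congr 1; abel

theorem norm_factors_le {c : E → E} (hc : ∀ x, ‖c x‖ ≤ ‖x‖) (q n : ℕ) (x : E) (i : Fin (n + 1)) :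
    ‖factors c q n x i‖ ≤ ‖x‖ := by
  unfold factors
  split_ifs
  exacts [le_rfl, hc x]

theorem norm_factors_sub_le {c : E → E} (hc : ∀ x, ‖c x‖ ≤ ‖x‖) (hcs : ∀ x y, c (x - y) = c x - c y)
    (q n : ℕ) (x y : E) (i : Fin (n + 1)) :
    ‖factors c q n x i - factors c q n y i‖ ≤ ‖x - y‖ := by
  unfold factors
  split_ifs
  · exact le_rfl
  · rw [← hcs]; exact hc _

theorem continuous_interactionField (m : E →L[ℂ] E →L[ℂ] E) {c : E → E} (hc : ∀ x, ‖c x‖ ≤ ‖x‖)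
    (hcs : ∀ x y, c (x - y) = c x - c y) {S : ℝ → E →L[ℂ] E} (hS : ∀ t x, ‖S t x‖ ≤ ‖x‖)
    (hSc : ∀ x, Continuous fun t => S t x) {n : ℕ} (p q : Fin n → ℕ) (κ : Fin n → ℂ) (x : E) :
    Continuous fun t => interactionField m c S p q κ t x := by
  have hcc : Continuous c := by
    rw [continuous_iff_continuousAt]
    intro x
    rw [ContinuousAt, tendsto_iff_norm_sub_tendsto_zero]
    refine squeeze_zero (fun y => norm_nonneg _) (fun y => (by rw [← hcs]; exact hc _)) (?_ :
      Tendsto (fun y => ‖y - x‖) (𝓝 x) (𝓝 0))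
    have : Continuous fun y => ‖y - x‖ := by fun_prop
    simpa using this.tendsto x
  unfold interactionField
  refine continuous_finsetSum _ fun j _ => Continuous.const_smul ?_ _
  refine continuous_strong hS hSc ?_ continuous_neg
  refine continuous_iterProd m _ _ fun i => ?_
  unfold factors
  split_ifs
  exacts [hSc x, hcc.comp (hSc x)]

/-- Existence of a solution in the interaction picture, with the error of the second iterate. -/
theorem exists_interaction_solution [CompleteSpace E] {m : E →L[ℂ] E →L[ℂ] E}
    (hm : ∀ x y, ‖m x y‖ ≤ ‖x‖ * ‖y‖) {c : E → E} (hc : ∀ x, ‖c x‖ ≤ ‖x‖)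
    (hcs : ∀ x y, c (x - y) = c x - c y) {S : ℝ → E →L[ℂ] E} (hS : ∀ t x, ‖S t x‖ ≤ ‖x‖)
    (hSc : ∀ x, Continuous fun t => S t x) {n : ℕ} (p q : Fin n → ℕ) (κ : Fin n → ℂ) {P : ℕ}
    (hP : ∀ j, p j ≤ P) {D T : ℝ} {x₀ : E} (hx₀ : ‖x₀‖ + 1 ≤ D) (hT : 0 ≤ T)
    (hsmall : T * ∑ j, ‖κ j‖ ≤ (D ^ (P + 1))⁻¹) :
    ∃ v : ℝ → E, v 0 = x₀ ∧
      (∀ t ∈ Set.Icc 0 T,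
        HasDerivWithinAt v (interactionField m c S p q κ t (v t)) (Set.Icc 0 T) t) ∧
      ‖v T - x₀ - ∫ t in (0 : ℝ)..T, interactionField m c S p q κ t x₀‖ ≤
        (P + 1) * D ^ (2 * P + 1) * (T * ∑ j, ‖κ j‖) ^ 2 := by
  have hD1 : 1 ≤ D := by linarith [norm_nonneg x₀]
  have hD0 : 0 ≤ D := by linarith
  set Λ := ∑ j, ‖κ j‖ with hΛ
  have hΛ0 : 0 ≤ Λ := Finset.sum_nonneg fun j _ => norm_nonneg _
  have hball : ∀ x ∈ Metric.closedBall x₀ 1, ‖x‖ ≤ D := by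
    intro x hx
    rw [mem_closedBall_iff_norm] at hx
    calc ‖x‖ = ‖x₀ + (x - x₀)‖ := by congr 1; abel
      _ ≤ ‖x₀‖ + ‖x - x₀‖ := norm_add_le _ _
      _ ≤ D := by linarith
  obtain ⟨v, h0, h1, h2⟩ := exists_solution_second_iterate
    (f := interactionField m c S p q κ) (x₀ := x₀) (K := Λ * ((P + 1) * D ^ P))
    (L := Λ * D ^ (P + 1)) (T := T) (by positivity) (by positivity) hT
    (continuous_interactionField m hc hcs hS hSc p q κ)
    (fun t x hx y hy => by
      unfold interactionField
      rw [← Finset.sum_sub_distrib]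
      refine (norm_sum_le _ _).trans ?_
      rw [hΛ, Finset.sum_mul, Finset.sum_mul]
      refine Finset.sum_le_sum fun j _ => ?_
      rw [← smul_sub, ← map_sub, norm_smul, mul_assoc]
      gcongr
      refine (hS _ _).trans ?_
      refine (norm_iterProd_sub_le hm hD0 (norm_nonneg (x - y)) _ _ _
        (fun i => (norm_factors_le hc _ _ _ i).trans ((hS _ _).trans (hball x hx)))
        (fun i => (norm_factors_le hc _ _ _ i).trans ((hS _ _).trans (hball y hy)))
        (fun i => (norm_factors_sub_le hc hcs _ _ _ _ i).trans (by
          rw [← map_sub]; exact hS _ _))).trans ?_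
      gcongr
      · exact (Nat.sub_le _ _).trans (hP j)
      · exact (Nat.sub_le _ _).trans (hP j))
    (fun t x hx => by
      unfold interactionField
      refine (norm_sum_le _ _).trans ?_
      rw [hΛ, Finset.sum_mul]
      refine Finset.sum_le_sum fun j _ => ?_
      rw [norm_smul]
      gcongr
      refine (hS _ _).trans ((norm_iterProd_le hm hD0 _ _ fun i =>
        (norm_factors_le hc _ _ _ i).trans ((hS _ _).trans (hball x hx))).trans ?_)
      gcongr
      exact (Nat.sub_le _ _).trans (hP j))
    (by
      have : 0 < D ^ (P + 1) := by positivity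
      rw [mul_right_comm, mul_comm Λ T]
      calc T * Λ * D ^ (P + 1) ≤ (D ^ (P + 1))⁻¹ * D ^ (P + 1) := by gcongr
        _ = 1 := inv_mul_cancel₀ this.ne')
  refine ⟨v, h0, h1, h2.trans (le_of_eq ?_)⟩
  rw [show 2 * P + 1 = P + (P + 1) by ring, pow_add D P]
  ring

end InteractionPicture

/-! ### Frequencies, brackets and characters -/

section Frequencies

variable {d₁ d₂ : ℕ}

instance : (Measure.count : Measure (Fin d₂ → ℤ)).IsAddHaarMeasure := by
  refine Measure.isAddHaarMeasure_of_isCompact_nonempty_interior _ {0} isCompact_singleton ?_ ?_ ?_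
  · rw [interior_eq_iff_isOpen.2 (isOpen_discrete _)]
    exact Set.singleton_nonempty 0
  · simp
  · simp

instance : (freqMeasure d₁ d₂).IsAddHaarMeasure := by
  unfold freqMeasure
  infer_instance

theorem normSq_nonneg (ξ : Freq d₁ d₂) : 0 ≤ normSq ξ := by
  unfold normSq
  positivity

theorem continuous_normSq : Continuous (normSq : Freq d₁ d₂ → ℝ) := by
  unfold normSq
  have : ∀ j, Continuous fun ξ : Freq d₁ d₂ => ((ξ.2 j : ℤ) : ℝ) := fun j =>
    (continuous_of_discreteTopology (f := fun k : ℤ => (k : ℝ))).comp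
      ((continuous_apply j).comp continuous_snd)
  fun_prop

theorem abs_fst_le_norm (ξ : Freq d₁ d₂) (i : Fin d₁) : |ξ.1 i| ≤ ‖ξ‖ :=
  (norm_le_pi_norm ξ.1 i).trans (le_max_left _ _)

theorem abs_snd_le_norm (ξ : Freq d₁ d₂) (j : Fin d₂) : |(ξ.2 j : ℝ)| ≤ ‖ξ‖ :=
  (norm_le_pi_norm ξ.2 j).trans (le_max_right _ _)

theorem normSq_le (ξ : Freq d₁ d₂) : normSq ξ ≤ (d₁ + d₂ : ℕ) * ‖ξ‖ ^ 2 := by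
  have h1 : ∀ i, ξ.1 i ^ 2 ≤ ‖ξ‖ ^ 2 := fun i => by
    rw [← sq_abs]; gcongr; exact abs_fst_le_norm ξ i
  have h2 : ∀ j, (ξ.2 j : ℝ) ^ 2 ≤ ‖ξ‖ ^ 2 := fun j => by
    rw [← sq_abs]; gcongr; exact abs_snd_le_norm ξ j
  unfold normSq
  refine (add_le_add (Finset.sum_le_sum fun i _ => h1 i) (Finset.sum_le_sum fun j _ => h2 j)).trans ?_
  simp only [Finset.sum_const, Finset.card_univ, Fintype.card_fin, nsmul_eq_mul]
  push_cast
  linarith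

theorem one_le_bracket (ξ : Freq d₁ d₂) : 1 ≤ bracket ξ := by
  unfold bracket
  rw [Real.one_le_sqrt]
  linarith [normSq_nonneg ξ]

theorem bracket_pos (ξ : Freq d₁ d₂) : 0 < bracket ξ := zero_lt_one.trans_le (one_le_bracket ξ)

theorem bracket_sq (ξ : Freq d₁ d₂) : bracket ξ ^ 2 = 1 + normSq ξ :=
  Real.sq_sqrt (by linarith [normSq_nonneg ξ])

theorem continuous_bracket : Continuous (bracket : Freq d₁ d₂ → ℝ) := by
  unfold bracket
  have := continuous_normSq (d₁ := d₁) (d₂ := d₂)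
  fun_prop

theorem bracket_sq_le (ξ : Freq d₁ d₂) : bracket ξ ^ 2 ≤ (1 + (d₁ + d₂ : ℕ)) * (1 + ‖ξ‖) ^ 2 := by
  rw [bracket_sq]
  have h1 := normSq_le ξ
  have h2 := norm_nonneg ξ
  have h3 : (0 : ℝ) ≤ (d₁ + d₂ : ℕ) := Nat.cast_nonneg _
  nlinarith [mul_nonneg h3 h2]

theorem exists_pow_mul_exp_le {a : ℝ} (ha : 0 < a) (n : ℕ) :
    ∃ C : ℝ, ∀ r : ℝ, 0 ≤ r → (1 + r) ^ n * Real.exp (-a * r) ≤ C := by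
  -- The constant comes from x^n / n! ≤ e^x at x = a(1 + r).
  refine ⟨n.factorial * Real.exp a / a ^ n, fun r hr => ?_⟩
  have h := Real.pow_div_factorial_le_exp (a * (1 + r)) (by positivity) n
  rw [div_le_iff₀ (by positivity), mul_pow] at h
  rw [le_div_iff₀ (by positivity)]
  calc (1 + r) ^ n * Real.exp (-a * r) * a ^ n = a ^ n * (1 + r) ^ n * Real.exp (-a * r) := by ring
    _ ≤ Real.exp (a * (1 + r)) * n.factorial * Real.exp (-a * r) := by gcongr
    _ = n.factorial * (Real.exp (a * (1 + r)) * Real.exp (-a * r)) := by ring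
    _ = n.factorial * Real.exp a := by rw [← Real.exp_add]; ring_nf

theorem exists_bracket_rpow_mul_exp_le {a : ℝ} (ha : 0 < a) (σ : ℝ) :
    ∃ C : ℝ, 0 ≤ C ∧ ∀ ξ : Freq d₁ d₂, bracket ξ ^ σ * Real.exp (-a * ‖ξ‖) ≤ C := by
  obtain ⟨k, hk⟩ := exists_nat_ge σ
  obtain ⟨C, hC⟩ := exists_pow_mul_exp_le ha (2 * k)
  have h : ∀ ξ : Freq d₁ d₂,
      bracket ξ ^ σ * Real.exp (-a * ‖ξ‖) ≤ (1 + (d₁ + d₂ : ℕ) : ℝ) ^ k * C := by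
    intro ξ
    have h1 : bracket ξ ^ σ ≤ bracket ξ ^ ((2 * k : ℕ) : ℝ) := by
      refine Real.rpow_le_rpow_of_exponent_le (one_le_bracket ξ) ?_
      push_cast
      have : (0 : ℝ) ≤ k := Nat.cast_nonneg k
      linarith
    rw [Real.rpow_natCast, pow_mul] at h1
    have h2 : (bracket ξ ^ 2) ^ k ≤ ((1 + (d₁ + d₂ : ℕ)) * (1 + ‖ξ‖) ^ 2) ^ k := by
      gcongr
      exact bracket_sq_le ξ
    calc bracket ξ ^ σ * Real.exp (-a * ‖ξ‖)
        ≤ ((1 + (d₁ + d₂ : ℕ)) * (1 + ‖ξ‖) ^ 2) ^ k * Real.exp (-a * ‖ξ‖) := by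
          gcongr
          exact h1.trans h2
      _ = (1 + (d₁ + d₂ : ℕ) : ℝ) ^ k * ((1 + ‖ξ‖) ^ (2 * k) * Real.exp (-a * ‖ξ‖)) := by
          rw [mul_pow, ← pow_mul]; ring
      _ ≤ _ := by
          gcongr
          exact hC _ (norm_nonneg ξ)
  exact ⟨_, le_trans (mul_nonneg (Real.rpow_nonneg (bracket_pos 0).le _) (Real.exp_pos _).le) (h 0), h⟩

theorem character_add (ξ η : Freq d₁ d₂) (x : Space d₁ d₂) :
    character (ξ + η) x = character ξ x * character η x := by
  unfold character
  simp only [Prod.fst_add, Prod.snd_add, Pi.add_apply, fourier_add, Finset.prod_mul_distrib, mul_add,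
    Finset.sum_add_distrib, Complex.ofReal_add, Complex.exp_add]
  ring

theorem character_neg (ξ : Freq d₁ d₂) (x : Space d₁ d₂) :
    character (-ξ) x = starRingEnd ℂ (character ξ x) := by
  unfold character
  simp only [Prod.fst_neg, Prod.snd_neg, Pi.neg_apply, fourier_neg, map_mul, map_prod,
    ← Complex.exp_conj, Complex.conj_I, Complex.conj_ofReal, mul_neg, Finset.sum_neg_distrib,
    Complex.ofReal_neg, neg_mul]

theorem norm_character (ξ : Freq d₁ d₂) (x : Space d₁ d₂) : ‖character ξ x‖ = 1 := by
  unfold character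
  rw [norm_mul, Complex.norm_exp_I_mul_ofReal, norm_prod, one_mul]
  refine Finset.prod_eq_one fun j _ => ?_
  rw [fourier_apply]
  exact Circle.norm_coe _

theorem continuous_character (x : Space d₁ d₂) : Continuous fun ξ : Freq d₁ d₂ => character ξ x := by
  unfold character
  have : ∀ j, Continuous fun ξ : Freq d₁ d₂ => (fourier (ξ.2 j) (x.2 j) : ℂ) := fun j =>
    (continuous_of_discreteTopology (f := fun k : ℤ => (fourier k (x.2 j) : ℂ))).comp
      ((continuous_apply j).comp continuous_snd)
  fun_prop

theorem character_add_single_fst (ξ : Freq d₁ d₂) (x : Space d₁ d₂) (i : Fin d₁) (h : ℝ) :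
    character ξ (x + (Pi.single i h, 0)) = character ξ x * Complex.exp (Complex.I * ((h * ξ.1 i : ℝ) : ℂ)) := by
  unfold character
  have : ∑ k, (x + (Pi.single i h, 0) : Space d₁ d₂).1 k * ξ.1 k = ∑ k, x.1 k * ξ.1 k + h * ξ.1 i := by
    simp only [Prod.fst_add, Pi.add_apply, add_mul, Finset.sum_add_distrib]
    congr 1
    rw [Finset.sum_eq_single i (fun k _ hk => by simp [hk]) (by simp)]
    simp
  rw [this, Complex.ofReal_add, mul_add, Complex.exp_add, Prod.snd_add, add_zero]
  ring

theorem character_add_single_snd (ξ : Freq d₁ d₂) (x : Space d₁ d₂) (j : Fin d₂) (h : ℝ) :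
    character ξ (x + (0, Pi.single j (h : AddCircle (2 * Real.pi)))) =
      character ξ x * Complex.exp (Complex.I * ((h * (ξ.2 j : ℝ) : ℝ) : ℂ)) := by
  unfold character
  have : ∏ k, (fourier (ξ.2 k) ((x + (0, Pi.single j (h : AddCircle (2 * Real.pi))) : Space d₁ d₂).2 k) : ℂ) =
      (∏ k, fourier (ξ.2 k) (x.2 k)) * Complex.exp (Complex.I * ((h * (ξ.2 j : ℝ) : ℝ) : ℂ)) := by
    have h1 : ∀ k, (fourier (ξ.2 k)
        ((x + (0, Pi.single j (h : AddCircle (2 * Real.pi))) : Space d₁ d₂).2 k) : ℂ) =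
        fourier (ξ.2 k) (x.2 k) * fourier (ξ.2 k) ((Pi.single j (h : AddCircle (2 * Real.pi)) : Fin d₂ → _) k) := by
      intro k
      rw [Prod.snd_add, Pi.add_apply, fourier_apply, fourier_apply, fourier_apply, smul_add,
        AddCircle.toCircle_add, Circle.coe_mul]
    simp only [h1, Finset.prod_mul_distrib]
    congr 1
    rw [Finset.prod_eq_single j (fun k _ hk => by simp [hk]) (by simp), Pi.single_eq_same,
      fourier_coe_apply]
    congr 1
    push_cast
    field_simp
  rw [this, Prod.fst_add, add_zero]
  ring

end Frequencies

/-! ### The Laplacian of a Fourier integral -/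

section Oscillatory

variable {G : Type*} [MeasurableSpace G] [TopologicalSpace G] [BorelSpace G] [SecondCountableTopology G]
  {μ : Measure G}

theorem hasDerivAt_integral_exp {g : G → ℂ} {l : G → ℝ} (hl : Continuous l) (hg : Continuous g)
    (hi : Integrable g μ) (hi' : Integrable (fun ξ => (l ξ : ℂ) * g ξ) μ) (h₀ : ℝ) :
    HasDerivAt (fun h : ℝ => ∫ ξ, g ξ * Complex.exp (Complex.I * ((h * l ξ : ℝ) : ℂ)) ∂μ)
      (∫ ξ, Complex.I * ((l ξ : ℂ) * g ξ) * Complex.exp (Complex.I * ((h₀ * l ξ : ℝ) : ℂ)) ∂μ) h₀ := by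
  refine (hasDerivAt_integral_of_dominated_loc_of_deriv_le (𝕜 := ℝ) (μ := μ) (s := Set.univ)
    (bound := fun ξ => ‖(l ξ : ℂ) * g ξ‖)
    (F := fun h ξ => g ξ * Complex.exp (Complex.I * ((h * l ξ : ℝ) : ℂ)))
    (F' := fun h ξ => Complex.I * ((l ξ : ℂ) * g ξ) * Complex.exp (Complex.I * ((h * l ξ : ℝ) : ℂ)))
    univ_mem ?_ ?_ ?_ ?_ hi'.norm ?_).2
  · exact Eventually.of_forall fun h => (by fun_prop : Continuous _).aestronglyMeasurable
  · refine hi.mul_bdd (c := 1) (by fun_prop : Continuous _).aestronglyMeasurable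
      (ae_of_all _ fun ξ => ?_)
    rw [Complex.norm_exp_I_mul_ofReal]
  · exact (by fun_prop : Continuous _).aestronglyMeasurable
  · refine ae_of_all _ fun ξ h _ => ?_
    rw [norm_mul, Complex.norm_exp_I_mul_ofReal, norm_mul, Complex.norm_I, one_mul, mul_one]
  · refine ae_of_all _ fun ξ h _ => ?_
    have h1 : HasDerivAt (fun h : ℝ => Complex.I * ((h * l ξ : ℝ) : ℂ)) (Complex.I * (l ξ : ℂ)) h := by
      have h2 : HasDerivAt (fun h : ℝ => ((h * l ξ : ℝ) : ℂ)) ((1 * l ξ : ℝ) : ℂ) h :=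
        ((hasDerivAt_id h).mul_const (l ξ)).ofReal_comp
      rw [one_mul] at h2
      exact h2.const_mul _
    have h3 := (h1.cexp).const_mul (g ξ)
    exact h3.congr_deriv (by ring)

theorem iteratedDeriv_two_integral_exp {g : G → ℂ} {l : G → ℝ} (hl : Continuous l) (hg : Continuous g)
    (hi : Integrable g μ) (hi' : Integrable (fun ξ => (l ξ : ℂ) * g ξ) μ)
    (hi'' : Integrable (fun ξ => (l ξ : ℂ) * ((l ξ : ℂ) * g ξ)) μ) :
    iteratedDeriv 2 (fun h : ℝ => ∫ ξ, g ξ * Complex.exp (Complex.I * ((h * l ξ : ℝ) : ℂ)) ∂μ) 0 =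
      ∫ ξ, -((l ξ : ℂ) ^ 2 * g ξ) ∂μ := by
  have h1 : deriv (fun h : ℝ => ∫ ξ, g ξ * Complex.exp (Complex.I * ((h * l ξ : ℝ) : ℂ)) ∂μ) =
      fun h => ∫ ξ, (Complex.I * ((l ξ : ℂ) * g ξ)) * Complex.exp (Complex.I * ((h * l ξ : ℝ) : ℂ)) ∂μ :=
    funext fun h => (hasDerivAt_integral_exp hl hg hi hi' h).deriv
  rw [iteratedDeriv_succ, iteratedDeriv_one, h1, (hasDerivAt_integral_exp
    (g := fun ξ => Complex.I * ((l ξ : ℂ) * g ξ)) hl (by fun_prop) (hi'.const_mul _) (by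
      refine (hi''.const_mul Complex.I).congr (ae_of_all _ fun ξ => ?_)
      dsimp only; ring) 0).deriv]
  refine integral_congr_ae (ae_of_all _ fun ξ => ?_)
  dsimp only
  rw [zero_mul, Complex.ofReal_zero, mul_zero, Complex.exp_zero]
  linear_combination ((l ξ : ℂ) ^ 2 * g ξ) * Complex.I_sq

variable {d₁ d₂ : ℕ}

/-- Moving along a coordinate direction multiplies the character by e^{ihξ_c}, so each second
derivative at h = 0 produces -ξ_c² under the integral. The hypothesis with (1 + ‖ξ‖)² dominates
every integrand that occurs. -/
theorem laplacian_integral_character {g : Freq d₁ d₂ → ℂ} (hg : Continuous g)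
    (hi : Integrable (fun ξ => (((1 + ‖ξ‖) ^ 2 : ℝ) : ℂ) * g ξ) (freqMeasure d₁ d₂))
    (x : Space d₁ d₂) :
    laplacian (fun x => ∫ ξ, g ξ * character ξ x ∂freqMeasure d₁ d₂) x =
      -∫ ξ, (normSq ξ : ℂ) * g ξ * character ξ x ∂freqMeasure d₁ d₂ := by
  have hχ := continuous_character (d₁ := d₁) (d₂ := d₂) x
  have hdom : ∀ r : Freq d₁ d₂ → ℝ, Continuous r → (∀ ξ, |r ξ| ≤ (1 + ‖ξ‖) ^ 2) →
      Integrable (fun ξ => (r ξ : ℂ) * (g ξ * character ξ x)) (freqMeasure d₁ d₂) := by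
    intro r hr hb
    refine hi.mono (by fun_prop : Continuous _).aestronglyMeasurable (ae_of_all _ fun ξ => ?_)
    rw [norm_mul, norm_mul, norm_mul, norm_character, mul_one, Complex.norm_real, Complex.norm_real,
      Real.norm_eq_abs, Real.norm_of_nonneg (by positivity)]
    gcongr
    exact hb ξ
  have h2 : ∀ l : Freq d₁ d₂ → ℝ, Continuous l → (∀ ξ, |l ξ| ≤ ‖ξ‖) →
      iteratedDeriv 2 (fun h : ℝ => ∫ ξ, (g ξ * character ξ x) *
        Complex.exp (Complex.I * ((h * l ξ : ℝ) : ℂ)) ∂freqMeasure d₁ d₂) 0 =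
      ∫ ξ, -((l ξ : ℂ) ^ 2 * (g ξ * character ξ x)) ∂freqMeasure d₁ d₂ ∧
      Integrable (fun ξ => (l ξ : ℂ) ^ 2 * (g ξ * character ξ x)) (freqMeasure d₁ d₂) := by
    intro l hl hb
    have hsq : Integrable (fun ξ => ((l ξ ^ 2 : ℝ) : ℂ) * (g ξ * character ξ x)) (freqMeasure d₁ d₂) :=
      hdom _ (by fun_prop) fun ξ => by
        rw [abs_pow]
        have := hb ξ
        have := abs_nonneg (l ξ)
        gcongr
        linarith
    refine ⟨iteratedDeriv_two_integral_exp hl (by fun_prop) ?_ (hdom l hl fun ξ => ?_) ?_, ?_⟩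
    · have := hdom (fun _ => 1) (by fun_prop) fun ξ => by
        rw [abs_one]; nlinarith [norm_nonneg ξ]
      simpa using this
    · have := hb ξ
      nlinarith [norm_nonneg ξ]
    · refine hsq.congr (ae_of_all _ fun ξ => ?_)
      dsimp only; push_cast; ring
    · simpa using hsq
  have hc1 : ∀ i, Continuous fun ξ : Freq d₁ d₂ => ξ.1 i := fun i => by fun_prop
  have hc2 : ∀ j, Continuous fun ξ : Freq d₁ d₂ => ((ξ.2 j : ℤ) : ℝ) := fun j =>
    (continuous_of_discreteTopology (f := fun k : ℤ => (k : ℝ))).comp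
      ((continuous_apply j).comp continuous_snd)
  unfold laplacian
  simp only [character_add_single_fst, character_add_single_snd, ← mul_assoc]
  have e1 := fun i => h2 _ (hc1 i) fun ξ => abs_fst_le_norm ξ i
  have e2 := fun j => h2 _ (hc2 j) fun ξ => abs_snd_le_norm ξ j
  simp only [← mul_assoc] at e1 e2
  rw [Finset.sum_congr rfl fun i _ => (e1 i).1, Finset.sum_congr rfl fun j _ => (e2 j).1]
  simp only [integral_neg, Finset.sum_neg_distrib]
  rw [← neg_add, ← integral_finsetSum _ fun i _ => (e1 i).2, ← integral_finsetSum _ fun j _ => (e2 j).2,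
    ← integral_add (integrable_finsetSum _ fun i _ => (e1 i).2)
      (integrable_finsetSum _ fun j _ => (e2 j).2)]
  refine congrArg _ (integral_congr_ae (ae_of_all _ fun ξ => ?_))
  dsimp only
  unfold normSq
  push_cast
  rw [← Finset.sum_mul, ← Finset.sum_mul, ← Finset.sum_mul, ← Finset.sum_mul]
  ring

end Oscillatory

theorem isNegInvariant_of_isAddHaarMeasure {G : Type*} [NormedAddCommGroup G] [ProperSpace G]
    [MeasurableSpace G] [BorelSpace G] (μ : Measure G) [μ.IsAddHaarMeasure] : μ.IsNegInvariant :=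
  inferInstance

instance {d₁ d₂ : ℕ} (μ : Measure (Freq d₁ d₂)) [μ.IsAddHaarMeasure] : μ.IsNegInvariant :=
  isNegInvariant_of_isAddHaarMeasure μ

/-! ### From the interaction picture to smooth solutions -/

section Smoothing

variable {d₁ d₂ : ℕ}

/-- The dispersion relation of the free Schrödinger equation. -/
def dispersion (d₁ d₂ : ℕ) : C(Freq d₁ d₂, ℝ) := ⟨normSq, continuous_normSq⟩

theorem exists_normSq_pow_mul_exp_le {a : ℝ} (ha : 0 < a) (k : ℕ) :
    ∃ C : ℝ, 0 ≤ C ∧ ∀ ξ : Freq d₁ d₂, normSq ξ ^ k * Real.exp (-a * ‖ξ‖) ≤ C := by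
  obtain ⟨C, hC, h⟩ := exists_bracket_rpow_mul_exp_le (d₁ := d₁) (d₂ := d₂) ha ((2 * k : ℕ) : ℝ)
  refine ⟨C, hC, fun ξ => le_trans ?_ (h ξ)⟩
  rw [Real.rpow_natCast, pow_mul, bracket_sq]
  have := normSq_nonneg ξ
  gcongr
  linarith

theorem norm_ofReal_exp (r : ℝ) : ‖(Real.exp r : ℂ)‖ = Real.exp r := by
  rw [Complex.norm_real, Real.norm_of_nonneg (Real.exp_pos _).le]

theorem norm_exp_neg_ofReal_mul_I (r : ℝ) : ‖Complex.exp (-(r : ℂ) * Complex.I)‖ = 1 := by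
  rw [← Complex.ofReal_neg, Complex.norm_exp_ofReal_mul_I]

/-- The free evolution followed by an exponentially decaying multiplier. -/
def smoothing (d₁ d₂ : ℕ) {a : ℝ} (ha : 0 < a) (t : ℝ) : Freq d₁ d₂ →ᵇ ℂ :=
  BoundedContinuousFunction.ofNormedAddCommGroup
    (fun ξ => Complex.exp (-(t * normSq ξ : ℝ) * Complex.I) * (Real.exp (-a * ‖ξ‖) : ℂ))
    (by have := continuous_normSq (d₁ := d₁) (d₂ := d₂); fun_prop) 1
    (fun ξ => by
      rw [norm_mul, norm_exp_neg_ofReal_mul_I, norm_ofReal_exp, one_mul, Real.exp_le_one_iff]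
      nlinarith [norm_nonneg ξ])

theorem smoothing_apply {a : ℝ} (ha : 0 < a) (t : ℝ) (ξ : Freq d₁ d₂) :
    smoothing d₁ d₂ ha t ξ =
      Complex.exp (-(t * normSq ξ : ℝ) * Complex.I) * (Real.exp (-a * ‖ξ‖) : ℂ) := rfl

/-- The time derivative of `smoothing`. -/
def smoothingDeriv (d₁ d₂ : ℕ) {a : ℝ} (ha : 0 < a) (t : ℝ) : Freq d₁ d₂ →ᵇ ℂ :=
  BoundedContinuousFunction.ofNormedAddCommGroup
    (fun ξ => -(normSq ξ : ℂ) * Complex.I *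
      (Complex.exp (-(t * normSq ξ : ℝ) * Complex.I) * (Real.exp (-a * ‖ξ‖) : ℂ)))
    (by have := continuous_normSq (d₁ := d₁) (d₂ := d₂); fun_prop)
    (exists_normSq_pow_mul_exp_le (d₁ := d₁) (d₂ := d₂) ha 1).choose
    (fun ξ => by
      have h := (exists_normSq_pow_mul_exp_le (d₁ := d₁) (d₂ := d₂) ha 1).choose_spec.2 ξ
      rw [pow_one] at h
      rw [norm_mul, norm_mul, norm_neg, Complex.norm_I, mul_one, norm_mul, norm_exp_neg_ofReal_mul_I,
        norm_ofReal_exp, one_mul, Complex.norm_real, Real.norm_of_nonneg (normSq_nonneg ξ)]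
      exact h)

theorem smoothingDeriv_apply {a : ℝ} (ha : 0 < a) (t : ℝ) (ξ : Freq d₁ d₂) :
    smoothingDeriv d₁ d₂ ha t ξ = -(normSq ξ : ℂ) * Complex.I * smoothing d₁ d₂ ha t ξ := rfl

theorem norm_exp_I_mul_sub_one_sub_le (y : ℝ) :
    ‖Complex.exp (Complex.I * y) - 1 - Complex.I * y‖ ≤ 2 * y ^ 2 := by
  have hy : ‖Complex.I * (y : ℂ)‖ = |y| := by
    rw [norm_mul, Complex.norm_I, one_mul, Complex.norm_real, Real.norm_eq_abs]
  rcases le_total |y| 1 with h | h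
  · refine (Complex.norm_exp_sub_one_sub_id_le (hy.le.trans h)).trans ?_
    rw [hy, sq_abs]
    nlinarith [sq_nonneg y]
  · refine (norm_sub_le _ _).trans ?_
    have h1 : ‖Complex.exp (Complex.I * y) - 1‖ ≤ |y| := Real.norm_exp_I_mul_ofReal_sub_one_le
    rw [hy]
    nlinarith [sq_abs y]

/-- The factor e^{-a|ξ|} makes the free evolution differentiable in the supremum norm: the
second-order remainder is of size (s - t)² |ξ|⁴ e^{-a|ξ|}, which is bounded uniformly in ξ. Without
the factor the evolution is only strongly continuous. -/
theorem hasDerivAt_smoothing {a : ℝ} (ha : 0 < a) (t : ℝ) :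
    HasDerivAt (smoothing d₁ d₂ ha) (smoothingDeriv d₁ d₂ ha t) t := by
  obtain ⟨C, hC, hb⟩ := exists_normSq_pow_mul_exp_le (d₁ := d₁) (d₂ := d₂) ha 2
  rw [hasDerivAt_iff_isLittleO]
  have h1 : (fun s => smoothing d₁ d₂ ha s - smoothing d₁ d₂ ha t - (s - t) • smoothingDeriv d₁ d₂ ha t)
      =O[𝓝 t] fun s => (s - t) ^ 2 := by
    refine Asymptotics.IsBigO.of_bound (2 * C) (Eventually.of_forall fun s => ?_)
    refine (BoundedContinuousFunction.norm_le (by positivity)).2 fun ξ => ?_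
    have e : (smoothing d₁ d₂ ha s - smoothing d₁ d₂ ha t - (s - t) • smoothingDeriv d₁ d₂ ha t) ξ =
        smoothing d₁ d₂ ha t ξ * (Complex.exp (Complex.I * ((-((s - t) * normSq ξ) : ℝ) : ℂ)) - 1 -
          Complex.I * ((-((s - t) * normSq ξ) : ℝ) : ℂ)) := by
      have e1 : smoothing d₁ d₂ ha s ξ =
          smoothing d₁ d₂ ha t ξ * Complex.exp (Complex.I * ((-((s - t) * normSq ξ) : ℝ) : ℂ)) := by
        rw [smoothing_apply, smoothing_apply, mul_right_comm, ← Complex.exp_add]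
        congr 2
        push_cast; ring
      rw [BoundedContinuousFunction.sub_apply, BoundedContinuousFunction.sub_apply,
        BoundedContinuousFunction.coe_smul, e1]
      dsimp only
      rw [smoothingDeriv_apply, Complex.real_smul]
      push_cast; ring
    rw [e, norm_mul, smoothing_apply, norm_mul, norm_exp_neg_ofReal_mul_I, norm_ofReal_exp, one_mul]
    calc Real.exp (-a * ‖ξ‖) * _ ≤ Real.exp (-a * ‖ξ‖) * (2 * (-((s - t) * normSq ξ)) ^ 2) := by
          gcongr
          exact norm_exp_I_mul_sub_one_sub_le _
      _ = 2 * (normSq ξ ^ 2 * Real.exp (-a * ‖ξ‖)) * (s - t) ^ 2 := by ring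
      _ ≤ 2 * C * (s - t) ^ 2 := by gcongr; exact hb ξ
      _ = 2 * C * ‖(s - t) ^ 2‖ := by rw [Real.norm_of_nonneg (sq_nonneg _)]
  refine h1.trans_isLittleO ?_
  refine Asymptotics.isLittleO_iff.2 fun ε hε => ?_
  filter_upwards [Metric.ball_mem_nhds t hε] with s hs
  rw [norm_pow, pow_two]
  have : ‖s - t‖ ≤ ε := by rw [← dist_eq_norm]; exact (Metric.mem_ball.1 hs).le
  gcongr

end Smoothing

namespace Wiener

variable {d₁ d₂ : ℕ} {μ : Measure (Freq d₁ d₂)}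

theorem hat_sub {a : ℝ} (x y : Wiener μ) (ξ : Freq d₁ d₂) :
    hat a (x - y) ξ = hat a x ξ - hat a y ξ := by
  simp only [hat, sub_apply]; ring

/-- Boundedness and integrability together give square integrability; the Sobolev norms enter
through this. -/
theorem integrable_sq (x : Wiener μ) : Integrable (fun ξ => ‖x ξ‖ ^ 2) μ := by
  refine (x.integrable.norm.const_mul ‖x‖).mono' (x.continuous.norm.pow 2).aestronglyMeasurable
    (ae_of_all _ fun ξ => ?_)
  rw [norm_pow, norm_norm, pow_two]
  gcongr
  exact x.norm_apply_le ξ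

theorem integral_sq_le (x : Wiener μ) : ∫ ξ, ‖x ξ‖ ^ 2 ∂μ ≤ ‖x‖ ^ 2 := by
  calc ∫ ξ, ‖x ξ‖ ^ 2 ∂μ ≤ ∫ ξ, ‖x‖ * ‖x ξ‖ ∂μ := by
        refine integral_mono x.integrable_sq (x.integrable.norm.const_mul ‖x‖) fun ξ => ?_
        dsimp only
        rw [pow_two]
        gcongr
        exact x.norm_apply_le ξ
    _ ≤ ‖x‖ ^ 2 := by
        rw [integral_const_mul, pow_two]
        gcongr
        exact x.integral_norm_le

theorem memLp_two (x : Wiener μ) : MemLp x 2 μ :=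
  (memLp_two_iff_integrable_sq_norm x.continuous.aestronglyMeasurable).2 x.integrable_sq

end Wiener

theorem toReal_eLpNorm_two {α : Type*} [MeasurableSpace α] {μ : Measure α} {f : α → ℂ}
    (hf : MemLp f 2 μ) : (eLpNorm f 2 μ).toReal = Real.sqrt (∫ ξ, ‖f ξ‖ ^ 2 ∂μ) := by
  rw [hf.eLpNorm_eq_integral_rpow_norm (by norm_num) (by norm_num), ENNReal.toReal_ofReal (by positivity),
    Real.sqrt_eq_rpow]
  norm_num

namespace Wiener

variable {d₁ d₂ : ℕ} {μ : Measure (Freq d₁ d₂)}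

theorem norm_weighted_hat_le {a B σ C : ℝ} (hB : 0 ≤ B)
    (hC : ∀ ξ : Freq d₁ d₂, bracket ξ ^ σ * Real.exp (-a * ‖ξ‖) ≤ C) (x : Wiener μ) (ξ : Freq d₁ d₂) :
    ‖weighted σ (fun ξ => (B : ℂ) * hat a x ξ) ξ‖ ≤ C * B * ‖x ξ‖ := by
  rw [weighted, norm_mul, norm_mul, norm_hat, Complex.norm_real, Complex.norm_real,
    Real.norm_of_nonneg (Real.rpow_nonneg (bracket_pos ξ).le _), Real.norm_of_nonneg hB]
  calc _ = (bracket ξ ^ σ * Real.exp (-a * ‖ξ‖)) * B * ‖x ξ‖ := by ring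
    _ ≤ _ := by gcongr; exact hC ξ

theorem continuous_weighted {σ : ℝ} {g : Freq d₁ d₂ → ℂ} (hg : Continuous g) :
    Continuous (weighted σ g) := by
  unfold weighted
  have h := continuous_bracket (d₁ := d₁) (d₂ := d₂)
  have h1 : Continuous fun ξ : Freq d₁ d₂ => bracket ξ ^ σ :=
    h.rpow_const fun ξ => Or.inl (bracket_pos ξ).ne'
  fun_prop

variable {m : ℝ} (hμ : freqMeasure d₁ d₂ = ENNReal.ofReal m • μ)
include hμ

theorem memLp_weighted_hat {a B : ℝ} (ha : 0 < a) (hB : 0 ≤ B) (x : Wiener μ) (σ : ℝ) :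
    MemLp (weighted σ fun ξ => (B : ℂ) * hat a x ξ) 2 (freqMeasure d₁ d₂) := by
  obtain ⟨C, -, hC⟩ := exists_bracket_rpow_mul_exp_le (d₁ := d₁) (d₂ := d₂) ha σ
  have h2 : MemLp x 2 (freqMeasure d₁ d₂) := by
    rw [hμ]; exact x.memLp_two.smul_measure ENNReal.ofReal_ne_top
  exact h2.of_le_mul (continuous_weighted (continuous_const.mul
    (continuous_hat a x))).aestronglyMeasurable (ae_of_all _ (norm_weighted_hat_le hB hC x))

/-- Every Sobolev weight is absorbed by e^{-a|ξ|}. Continuity in the Wiener norm therefore implies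
continuity in all `H^σ` simultaneously. -/
theorem exists_freqNorm_hat_le {a B : ℝ} (ha : 0 < a) (hB : 0 ≤ B) (hm : 0 < m) (σ : ℝ) :
    ∃ C : ℝ, ∀ x : Wiener μ, freqNorm σ (fun ξ => (B : ℂ) * hat a x ξ) ≤ C * ‖x‖ := by
  obtain ⟨C, hC0, hC⟩ := exists_bracket_rpow_mul_exp_le (d₁ := d₁) (d₂ := d₂) ha σ
  refine ⟨C * B * Real.sqrt m, fun x => ?_⟩
  have h2 : MemLp x 2 (freqMeasure d₁ d₂) := by
    rw [hμ]; exact x.memLp_two.smul_measure ENNReal.ofReal_ne_top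
  have h1 := eLpNorm_le_mul_eLpNorm_of_ae_le_mul (μ := freqMeasure d₁ d₂)
    (ae_of_all _ (norm_weighted_hat_le hB hC x)) 2
  have h3 := ENNReal.toReal_mono (ENNReal.mul_ne_top ENNReal.ofReal_ne_top h2.2.ne) h1
  refine h3.trans ?_
  rw [ENNReal.toReal_mul, ENNReal.toReal_ofReal (by positivity), toReal_eLpNorm_two h2, mul_assoc (C * B)]
  gcongr
  rw [hμ, integral_smul_measure, ENNReal.toReal_ofReal hm.le, smul_eq_mul, Real.sqrt_mul hm.le]
  gcongr
  exact (Real.sqrt_le_sqrt x.integral_sq_le).trans (by rw [Real.sqrt_sq (norm_nonneg _)])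

omit hμ

/-- The function on `Z` synthesised from the exponentially weighted element `x`. -/
def synth (a : ℝ) (z : Space d₁ d₂) (x : Wiener μ) : ℂ := ∫ ξ, hat a x ξ * character ξ z ∂μ

variable [μ.IsAddHaarMeasure]

/-- The convolution theorem: since the character is multiplicative in ξ, multiplying both factors by
it turns the integral of a convolution into a product of integrals. So synthesis at a point is an
algebra homomorphism. -/
theorem synth_mulL {a : ℝ} (ha : 0 ≤ a) (z : Space d₁ d₂) (x y : Wiener μ) :
    synth a z (mulL ha x y) = synth a z x * synth a z y := by
  have hint : ∀ x : Wiener μ, Integrable (fun ξ => hat a x ξ * character ξ z) μ := fun x =>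
    (integrable_hat ha x).mul_bdd (c := 1) (continuous_character z).aestronglyMeasurable
      (ae_of_all _ fun ξ => (norm_character ξ z).le)
  have h := integral_convolution (μ := μ) (ν := μ) (ContinuousLinearMap.mul ℂ ℂ) (hint x) (hint y)
  unfold synth
  rw [hat_mulL]
  refine Eq.trans (integral_congr_ae (ae_of_all _ fun ξ => ?_)) h
  dsimp only
  rw [conv_apply, convolution_def, ← integral_mul_const]
  refine integral_congr_ae (ae_of_all _ fun η => ?_)
  dsimp only [ContinuousLinearMap.mul_apply']
  have : character ξ z = character η z * character (ξ - η) z := by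
    rw [← character_add, add_sub_cancel]
  rw [this]
  ring

theorem synth_conjRefl {a : ℝ} (z : Space d₁ d₂) (x : Wiener μ) :
    synth a z (conjRefl x) = starRingEnd ℂ (synth a z x) := by
  unfold synth
  rw [← integral_conj, ← integral_neg_eq_self _ μ]
  refine integral_congr_ae (ae_of_all _ fun ξ => ?_)
  dsimp only
  rw [hat_conjRefl, neg_neg, character_neg, map_mul]

end Wiener

namespace Wiener

variable {d₁ d₂ : ℕ} {μ : Measure (Freq d₁ d₂)} {a B m : ℝ}

theorem integrable_pow_mul_hat (ha : 0 < a) (k : ℕ) (x : Wiener μ) :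
    Integrable (fun ξ => (((1 + ‖ξ‖) ^ k : ℝ) : ℂ) * hat a x ξ) μ := by
  obtain ⟨C, hC⟩ := exists_pow_mul_exp_le ha k
  have h1 : Continuous fun ξ => (((1 + ‖ξ‖) ^ k : ℝ) : ℂ) * hat a x ξ := by
    have := continuous_hat a x
    fun_prop
  refine (x.integrable.norm.const_mul C).mono' h1.aestronglyMeasurable (ae_of_all _ fun ξ => ?_)
  rw [norm_mul, norm_hat, Complex.norm_real, Real.norm_of_nonneg (by positivity), ← mul_assoc]
  gcongr
  exact hC _ (norm_nonneg ξ)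

/-- The free Schrödinger evolution on the Wiener space. -/
def evolution (t : ℝ) : Wiener μ →L[ℂ] Wiener μ := mulCLM (phase (dispersion d₁ d₂) t)

theorem evolution_apply (t : ℝ) (x : Wiener μ) (ξ : Freq d₁ d₂) :
    evolution t x ξ = Complex.exp (-(t * normSq ξ : ℝ) * Complex.I) * x ξ := rfl

/-- The smooth function whose Fourier transform is `B e^{-a‖ξ‖} x(ξ)`. -/
def toHInfty (hμ : freqMeasure d₁ d₂ = ENNReal.ofReal m • μ) (ha : 0 < a) (hB : 0 ≤ B)
    (x : Wiener μ) : HInfty d₁ d₂ where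
  toFun z := ∫ ξ, ((B : ℂ) * hat a x ξ) * character ξ z ∂freqMeasure d₁ d₂
  hat ξ := (B : ℂ) * hat a x ξ
  memLp_weighted := memLp_weighted_hat hμ ha hB x
  inversion _ := rfl

theorem toHInfty_toFun (hμ : freqMeasure d₁ d₂ = ENNReal.ofReal m • μ) (ha : 0 < a) (hB : 0 ≤ B)
    (hm : 0 < m) (x : Wiener μ) (z : Space d₁ d₂) :
    (toHInfty hμ ha hB x).toFun z = (B * m : ℝ) * synth a z x := by
  unfold toHInfty synth
  dsimp only
  rw [hμ, integral_smul_measure, ENNReal.toReal_ofReal hm.le, Complex.real_smul, Complex.ofReal_mul,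
    mul_comm (B : ℂ) (m : ℂ), mul_assoc (m : ℂ), ← integral_const_mul (B : ℂ)]
  simp only [mul_assoc]

/-- The character at a point, as a bounded continuous function of the frequency. -/
def charBCF (z : Space d₁ d₂) : Freq d₁ d₂ →ᵇ ℂ :=
  BoundedContinuousFunction.ofNormedAddCommGroup (fun ξ => character ξ z) (continuous_character z) 1
    fun ξ => (norm_character ξ z).le

theorem integralCLM_smoothing (ha : 0 < a) (z : Space d₁ d₂) (t : ℝ) (x : Wiener μ) :
    integralCLM (charBCF z) (mulCLM (smoothing d₁ d₂ ha t) x) = synth a z (evolution t x) := by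
  rw [integralCLM_apply, synth]
  refine integral_congr_ae (ae_of_all _ fun ξ => ?_)
  dsimp only
  rw [mulCLM_apply, smoothing_apply, hat, evolution_apply]
  change character ξ z * _ = _
  ring

theorem integralCLM_smoothingDeriv (ha : 0 < a) (z : Space d₁ d₂) (t : ℝ) (x : Wiener μ) :
    integralCLM (charBCF z) (mulCLM (smoothingDeriv d₁ d₂ ha t) x) =
      -Complex.I * ∫ ξ, (normSq ξ : ℂ) * hat a (evolution t x) ξ * character ξ z ∂μ := by
  rw [integralCLM_apply, ← integral_const_mul]
  refine integral_congr_ae (ae_of_all _ fun ξ => ?_)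
  dsimp only
  rw [mulCLM_apply, smoothingDeriv_apply, smoothing_apply, hat, evolution_apply]
  change character ξ z * _ = _
  ring

theorem evolution_evolution_neg (t : ℝ) (x : Wiener μ) : evolution t (evolution (-t) x) = x :=
  ext fun ξ => by
    rw [evolution_apply, evolution_apply, ← mul_assoc, ← Complex.exp_add]
    have : -((t * normSq ξ : ℝ) : ℂ) * Complex.I + -((-t * normSq ξ : ℝ) : ℂ) * Complex.I = 0 := by
      push_cast; ring
    rw [this, Complex.exp_zero, one_mul]

theorem evolution_zero (x : Wiener μ) : evolution 0 x = x :=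
  ext fun ξ => by rw [evolution_apply]; simp

theorem norm_evolution_le (t : ℝ) (x : Wiener μ) : ‖evolution t x‖ ≤ ‖x‖ :=
  norm_mulCLM_phase_le _ t x

theorem continuous_evolution (x : Wiener μ) : Continuous fun t => evolution t x :=
  continuous_mulCLM_phase _ x

/-- The synthesis of the free evolution of a differentiable curve is differentiable. -/
theorem hasDerivWithinAt_synth (ha : 0 < a) (z : Space d₁ d₂) {v : ℝ → Wiener μ} {v' : Wiener μ}
    {s : Set ℝ} {t : ℝ} (hv : HasDerivWithinAt v v' s t) :
    HasDerivWithinAt (fun t => synth a z (evolution t (v t)))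
      (synth a z (evolution t v') -
        Complex.I * ∫ ξ, (normSq ξ : ℂ) * hat a (evolution t (v t)) ξ * character ξ z ∂μ) s t := by
  -- The curve is not differentiable in the Wiener space itself. The weight is moved onto the phase,
  -- where `hasDerivAt_smoothing` applies, and the product rule is used for the bilinear action on
  -- v.
  have hb := ((mulCLM (μ := μ)).isBoundedBilinearMap.hasFDerivAt
    (smoothing d₁ d₂ ha t, v t)).restrictScalars ℝ
  have h1 := hb.comp_hasDerivWithinAt t
    (((hasDerivAt_smoothing (d₁ := d₁) (d₂ := d₂) ha t).hasDerivWithinAt (s := s)).prodMk hv)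
  have h2 := ((integralCLM (μ := μ) (charBCF z)).hasFDerivAt.restrictScalars ℝ).comp_hasDerivWithinAt t h1
  have h3 : (fun t => synth a z (evolution t (v t))) =
      (integralCLM (μ := μ) (charBCF z)) ∘ ((fun p : (Freq d₁ d₂ →ᵇ ℂ) × Wiener μ => mulCLM p.1 p.2) ∘
        fun t => (smoothing d₁ d₂ ha t, v t)) :=
    funext fun t => (integralCLM_smoothing ha z t (v t)).symm
  rw [h3]
  refine h2.congr_deriv ?_
  rw [sub_eq_add_neg, ← neg_mul, ← integralCLM_smoothing ha, ← integralCLM_smoothingDeriv ha, ← map_add]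
  rfl

variable [μ.IsAddHaarMeasure]

theorem synth_sum_smul (ha : 0 < a) (z : Space d₁ d₂) {n : ℕ} (κ : Fin n → ℂ) (x : Fin n → Wiener μ) :
    synth a z (∑ j, κ j • x j) = ∑ j, κ j * synth a z (x j) := by
  have h : ∀ x : Wiener μ, synth a z x = integralCLM (charBCF z) (mulCLM (smoothing d₁ d₂ ha 0) x) := by
    intro x
    rw [integralCLM_smoothing, evolution_zero]
  simp only [h, map_sum, map_smul, smul_eq_mul]

theorem synth_evolution_interactionField (ha : 0 < a) (z : Space d₁ d₂) {n : ℕ} (p q : Fin n → ℕ)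
    (hp : ∀ j, 1 ≤ p j) (hq : ∀ j, q j ≤ p j) (κ : Fin n → ℂ) (t : ℝ) (x : Wiener μ) :
    synth a z (evolution t (interactionField (mulL ha.le) conjRefl evolution p q κ t x)) =
      ∑ j, κ j * (synth a z (evolution t x) ^ q j *
        starRingEnd ℂ (synth a z (evolution t x)) ^ (p j - q j)) := by
  unfold interactionField
  simp only [map_sum, map_smul, evolution_evolution_neg]
  rw [synth_sum_smul ha]
  refine Finset.sum_congr rfl fun j _ => ?_
  rw [map_iterProd (Φ := synth a z) (m' := fun a b => a * b) (synth_mulL ha.le z), iterProd_mul]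
  have h1 : ∀ i, synth a z (factors conjRefl (q j) (p j - 1) (evolution t x) i) =
      factors (starRingEnd ℂ) (q j) (p j - 1) (synth a z (evolution t x)) i :=
    map_factors (Φ := synth a z) (c' := starRingEnd ℂ) (synth_conjRefl z) (q j) (p j - 1) (evolution t x)
  have h2 : p j - 1 + 1 = p j := Nat.sub_add_cancel (hp j)
  rw [Finset.prod_congr rfl fun i _ => h1 i, prod_factors _ (by rw [h2]; exact hq j), h2]

/-- A solution in the interaction picture gives a smooth solution of the Schrödinger equation. -/
theorem isSmoothSolution (hμ : freqMeasure d₁ d₂ = ENNReal.ofReal m • μ) (ha : 0 < a) (hB : 0 < B)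
    (hm : 0 < m) {n : ℕ} (p q : Fin n → ℕ) (ν : Fin n → ℂ) (hp : ∀ j, 1 ≤ p j) (hq : ∀ j, q j ≤ p j)
    {T : ℝ} {v : ℝ → Wiener μ} (hv : ∀ t ∈ Set.Icc 0 T, HasDerivWithinAt v
      (interactionField (mulL ha.le) conjRefl evolution p q
        (fun j => -Complex.I * ν j * ((B * m : ℝ) : ℂ) ^ (p j - 1)) t (v t)) (Set.Icc 0 T) t) :
    IsSmoothSolution (nonlinearity p q ν) (toHInfty hμ ha hB.le (v 0)) T
      fun t => toHInfty hμ ha hB.le (evolution t (v t)) where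
  initial := by simp only [evolution_zero]
  continuous σ t ht := by
    obtain ⟨C, hC⟩ := exists_freqNorm_hat_le hμ ha hB.le hm σ
    have h1 : ∀ τ, (toHInfty hμ ha hB.le (evolution τ (v τ))).hat -
        (toHInfty hμ ha hB.le (evolution t (v t))).hat =
        fun ξ => (B : ℂ) * hat a (evolution τ (v τ) - evolution t (v t)) ξ := by
      intro τ
      funext ξ
      rw [hat_sub, mul_sub]
      rfl
    have hcont : ContinuousOn (fun τ => evolution τ (v τ)) (Set.Icc 0 T) := by
      -- Continuity in time combines differentiability of v with the joint continuity of the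
      -- uniformly bounded evolution.
      have hvc : ContinuousOn v (Set.Icc 0 T) := fun t ht => (hv t ht).continuousWithinAt
      rw [continuousOn_iff_continuous_domRestrict] at hvc ⊢
      exact continuous_strong norm_evolution_le continuous_evolution hvc continuous_subtype_val
    have h2 : Tendsto (fun τ => C * ‖evolution τ (v τ) - evolution t (v t)‖) (𝓝[Set.Icc 0 T] t) (𝓝 0) := by
      have := ((hcont t ht).sub_const (evolution t (v t))).norm.const_mul C
      simpa [ContinuousWithinAt] using this
    refine squeeze_zero (fun τ => ENNReal.toReal_nonneg) (fun τ => ?_) h2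
    rw [h1]
    exact hC _
  equation t ht z := by
    have hd := (hasDerivWithinAt_synth ha z (hv t ht)).const_mul ((B * m : ℝ) : ℂ)
    refine ⟨_, hd.congr (fun s _ => toHInfty_toFun hμ ha hB.le hm _ z)
      (toHInfty_toFun hμ ha hB.le hm _ z), ?_⟩
    have hlap : laplacian (toHInfty hμ ha hB.le (evolution t (v t))).toFun z =
        -(((B * m : ℝ) : ℂ) *
          ∫ ξ, (normSq ξ : ℂ) * hat a (evolution t (v t)) ξ * character ξ z ∂μ) := by
      have h1 : Integrable (fun ξ => (((1 + ‖ξ‖) ^ 2 : ℝ) : ℂ) * ((B : ℂ) * hat a (evolution t (v t)) ξ))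
          (freqMeasure d₁ d₂) := by
        have h2 := (integrable_pow_mul_hat ha 2 (evolution t (v t))).const_mul (B : ℂ)
        rw [hμ]
        refine (h2.smul_measure ENNReal.ofReal_ne_top).congr (ae_of_all _ fun ξ => ?_)
        dsimp only; ring
      have h3 := laplacian_integral_character (continuous_const.mul (continuous_hat a _)) h1 z
      refine Eq.trans h3 ?_
      rw [hμ, integral_smul_measure, ENNReal.toReal_ofReal hm.le, Complex.real_smul, Complex.ofReal_mul,
        mul_comm (B : ℂ) (m : ℂ), mul_assoc (m : ℂ), ← integral_const_mul (B : ℂ)]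
      refine congrArg (fun w => -((m : ℂ) * w)) (integral_congr_ae (ae_of_all _ fun ξ => ?_))
      simp only [Pi.mul_apply]
      ring
    rw [hlap, toHInfty_toFun hμ ha hB.le hm, synth_evolution_interactionField ha z p q hp hq,
      nonlinearity]
    set Ψ := synth a z (evolution t (v t))
    set J := ∫ ξ, (normSq ξ : ℂ) * hat a (evolution t (v t)) ξ * character ξ z ∂μ
    set M : ℂ := ((B * m : ℝ) : ℂ) with hM
    have hMc : starRingEnd ℂ (M * Ψ) = M * starRingEnd ℂ Ψ := by
      rw [map_mul, hM, Complex.conj_ofReal]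
    -- The function on `Z` is M Ψ with M = Bm real. A monomial of degree p yields M^p, of which one
    -- factor M is carried by the unknown; this is the origin of the power p - 1 in the
    -- coefficients.
    have hsum : ∑ j, ν j * (M * Ψ) ^ q j * starRingEnd ℂ (M * Ψ) ^ (p j - q j) =
        Complex.I * (M * ∑ j, -Complex.I * ν j * M ^ (p j - 1) *
          (Ψ ^ q j * starRingEnd ℂ Ψ ^ (p j - q j))) := by
      rw [hMc, Finset.mul_sum, Finset.mul_sum]
      refine Finset.sum_congr rfl fun j _ => ?_
      have e : M ^ q j * M ^ (p j - q j) = M * M ^ (p j - 1) := by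
        rw [← pow_add, Nat.add_sub_cancel' (hq j), ← pow_succ', Nat.sub_add_cancel (hp j)]
      rw [mul_pow, mul_pow]
      linear_combination (ν j * Ψ ^ q j * starRingEnd ℂ Ψ ^ (p j - q j)) * e +
        (ν j * M * M ^ (p j - 1) * Ψ ^ q j * starRingEnd ℂ Ψ ^ (p j - q j)) * Complex.I_sq
    rw [hsum]
    linear_combination (-(M * J)) * Complex.I_sq

end Wiener

/-! ### Solutions with prescribed Fourier data and their second iterate -/

section Expansion

variable {d₁ d₂ : ℕ}

/-- The Haar measure on the frequency space scaled by `1 / m`. -/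
def scaledMeasure (d₁ d₂ : ℕ) (m : ℝ) : Measure (Freq d₁ d₂) :=
  ENNReal.ofReal m⁻¹ • freqMeasure d₁ d₂

theorem isAddHaarMeasure_scaledMeasure {m : ℝ} (hm : 0 < m) :
    (scaledMeasure d₁ d₂ m).IsAddHaarMeasure :=
  Measure.IsAddHaarMeasure.smul _ (by simpa using hm) ENNReal.ofReal_ne_top

theorem freqMeasure_eq_smul_scaledMeasure {m : ℝ} (hm : 0 < m) :
    freqMeasure d₁ d₂ = ENNReal.ofReal m • scaledMeasure d₁ d₂ m := by
  rw [scaledMeasure, smul_smul, ← ENNReal.ofReal_mul hm.le, mul_inv_cancel₀ hm.ne', ENNReal.ofReal_one,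
    one_smul]

/-- The reflection `ξ ↦ conj (f (-ξ))`, which is complex conjugation on the Fourier side. -/
def reflConj (f : Freq d₁ d₂ → ℂ) (ξ : Freq d₁ d₂) : ℂ := starRingEnd ℂ (f (-ξ))

/-- The free Schrödinger evolution on the Fourier side. -/
def freeEvolution (t : ℝ) (f : Freq d₁ d₂ → ℂ) (ξ : Freq d₁ d₂) : ℂ :=
  Complex.exp (-(t * normSq ξ : ℝ) * Complex.I) * f ξ

/-- The Fourier transform of the monomial `f^q f̄^(p-q)`. -/
def monomialHat (m : ℝ) (p q : ℕ) (f : Freq d₁ d₂ → ℂ) : Freq d₁ d₂ → ℂ :=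
  iterProd (conv (scaledMeasure d₁ d₂ m)) (p - 1) (factors reflConj q (p - 1) f)

/-- The integrand of the second Picard iterate, on the Fourier side and in the interaction picture. -/
def duhamelIntegrand (m B : ℝ) {n : ℕ} (p q : Fin n → ℕ) (ν : Fin n → ℂ) (g : Freq d₁ d₂ → ℂ)
    (ξ : Freq d₁ d₂) (t : ℝ) : ℂ :=
  ∑ j, -Complex.I * ν j * ((B * m : ℝ) : ℂ) ^ (p j - 1) *
    (Complex.exp ((t * normSq ξ : ℝ) * Complex.I) * monomialHat m (p j) (q j) (freeEvolution t g) ξ)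

/-- The dimensionless size of the nonlinear interaction over the time `T`. -/
def interactionSize (m B T : ℝ) {n : ℕ} (p : Fin n → ℕ) (ν : Fin n → ℂ) : ℝ :=
  T * ∑ j, ‖ν j‖ * (B * m) ^ (p j - 1)

/-- The weight e^{-a|ξ|} disappears from the explicit form of the vector field, so the second
iterate can be computed with unweighted convolutions and does not depend on a. -/
theorem hat_interactionField {m a B : ℝ} (ha : 0 < a) [(scaledMeasure d₁ d₂ m).IsAddHaarMeasure]
    {n : ℕ} (p q : Fin n → ℕ) (ν : Fin n → ℂ) (t : ℝ) (x : Wiener (scaledMeasure d₁ d₂ m))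
    (ξ : Freq d₁ d₂) :
    Wiener.hat a (interactionField (Wiener.mulL ha.le) Wiener.conjRefl Wiener.evolution p q
        (fun j => -Complex.I * ν j * ((B * m : ℝ) : ℂ) ^ (p j - 1)) t x) ξ =
      duhamelIntegrand m B p q ν (Wiener.hat a x) ξ t := by
  have hsum : ∀ (κ : Fin n → ℂ) (y : Fin n → Wiener (scaledMeasure d₁ d₂ m)),
      Wiener.hat a (∑ j, κ j • y j) ξ = ∑ j, κ j * Wiener.hat a (y j) ξ := by
    intro κ y
    have h : ∀ z : Wiener (scaledMeasure d₁ d₂ m),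
        Wiener.hat a z ξ = (Real.exp (-a * ‖ξ‖) : ℂ) * Wiener.evalCLM ξ z := fun z => rfl
    simp only [h, map_sum, map_smul, smul_eq_mul, Finset.mul_sum]
    exact Finset.sum_congr rfl fun j _ => by ring
  unfold interactionField duhamelIntegrand
  rw [hsum]
  refine Finset.sum_congr rfl fun j _ => ?_
  congr 1
  have h1 : ∀ y : Wiener (scaledMeasure d₁ d₂ m), Wiener.hat a (Wiener.evolution (-t) y) ξ =
      Complex.exp ((t * normSq ξ : ℝ) * Complex.I) * Wiener.hat a y ξ := by
    intro y
    rw [Wiener.hat, Wiener.hat, Wiener.evolution_apply]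
    have : -((-t * normSq ξ : ℝ) : ℂ) = ((t * normSq ξ : ℝ) : ℂ) := by push_cast; ring
    rw [this]; ring
  have h2 : Wiener.hat a (Wiener.evolution t x) = freeEvolution t (Wiener.hat a x) := by
    funext η
    rw [Wiener.hat, freeEvolution, Wiener.hat, Wiener.evolution_apply]; ring
  rw [h1, map_iterProd (Φ := Wiener.hat a) (Wiener.hat_mulL ha.le), monomialHat]
  refine congrArg _ (congrFun (congrArg _ (funext fun i => ?_)) ξ)
  rw [← h2]
  exact map_factors (Φ := Wiener.hat a) (c' := reflConj)
    (fun y => funext fun η => Wiener.hat_conjRefl a y η) _ _ _ i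

/-- For small interaction size there is a smooth solution with Fourier data `B g`, and it is given by
its second Picard iterate up to a quadratic error. -/
theorem exists_smoothSolution {n : ℕ} (p q : Fin n → ℕ) (ν : Fin n → ℂ) (hp : ∀ j, 1 ≤ p j)
    (hq : ∀ j, q j ≤ p j) {P : ℕ} (hP : ∀ j, p j ≤ P) {R B m T : ℝ} (hR : 0 ≤ R) (hB : 0 < B)
    (hm : 0 < m) (hT : 0 ≤ T) {g : Freq d₁ d₂ → ℂ} (hg : Continuous g) (hgs : HasCompactSupport g)
    (hgR : ∀ ξ, ‖g ξ‖ ≤ R) (hgi : ∫ ξ, ‖g ξ‖ ∂scaledMeasure d₁ d₂ m ≤ R)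
    (hsmall : interactionSize m B T p ν ≤ ((2 * R + 1) ^ (P + 1))⁻¹) :
    ∃ (φ : HInfty d₁ d₂) (u : ℝ → HInfty d₁ d₂), (φ.hat = fun ξ => (B : ℂ) * g ξ) ∧
      IsSmoothSolution (nonlinearity p q ν) φ T u ∧
      ∀ ξ, ‖(u T).hat ξ - B * Complex.exp (-(T * normSq ξ : ℝ) * Complex.I) *
          (g ξ + ∫ t in (0 : ℝ)..T, duhamelIntegrand m B p q ν g ξ t)‖ ≤
        B * ((P + 1) * (2 * R + 1) ^ (2 * P + 1) * interactionSize m B T p ν ^ 2) := by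
  have hHaar := isAddHaarMeasure_scaledMeasure (d₁ := d₁) (d₂ := d₂) hm
  have hμ := freqMeasure_eq_smul_scaledMeasure (d₁ := d₁) (d₂ := d₂) hm
  obtain ⟨r, hr⟩ := hgs.isCompact.isBounded.exists_norm_le
  -- With this rate the weight e^{a|ξ|} is at most 2 on the support of g, so that the weighted datum
  -- has norm at most 2R.
  set a : ℝ := Real.log 2 / (|r| + 1) with ha_def
  have ha : 0 < a := div_pos (Real.log_pos one_lt_two) (by positivity)
  have hexp : ∀ ξ, ‖(Real.exp (a * ‖ξ‖) : ℂ) * g ξ‖ ≤ 2 * ‖g ξ‖ := by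
    intro ξ
    rw [norm_mul, norm_ofReal_exp]
    by_cases h : g ξ = 0
    · simp [h]
    · have h1 : ‖ξ‖ ≤ |r| + 1 := by
        have := hr ξ (subset_tsupport g h)
        linarith [le_abs_self r]
      gcongr
      rw [← Real.le_log_iff_exp_le two_pos, ha_def, div_mul_eq_mul_div, div_le_iff₀ (by positivity)]
      gcongr
  have hc : Continuous fun ξ : Freq d₁ d₂ => (Real.exp (a * ‖ξ‖) : ℂ) * g ξ := by fun_prop
  have hcs : HasCompactSupport fun ξ : Freq d₁ d₂ => (Real.exp (a * ‖ξ‖) : ℂ) * g ξ := hgs.mul_left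
  have hint : Integrable g (scaledMeasure d₁ d₂ m) := hg.integrable_of_hasCompactSupport hgs
  let x₀ : Wiener (scaledMeasure d₁ d₂ m) :=
    Wiener.mk _ hc hcs.is_zero_at_infty (hc.integrable_of_hasCompactSupport hcs)
  have hx₀ : Wiener.hat a x₀ = g := by
    funext ξ
    change (Real.exp (-a * ‖ξ‖) : ℂ) * ((Real.exp (a * ‖ξ‖) : ℂ) * g ξ) = g ξ
    rw [← mul_assoc, ← Complex.ofReal_mul, ← Real.exp_add]
    simp
  have hnorm : ‖x₀‖ ≤ 2 * R := by
    refine Wiener.norm_le (by positivity) (fun ξ => (hexp ξ).trans (by gcongr; exact hgR ξ)) ?_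
    refine (integral_mono x₀.integrable.norm (hint.norm.const_mul 2) hexp).trans ?_
    rw [integral_const_mul]
    gcongr
  have hκ : ∑ j, ‖-Complex.I * ν j * ((B * m : ℝ) : ℂ) ^ (p j - 1)‖ =
      ∑ j, ‖ν j‖ * (B * m) ^ (p j - 1) := by
    refine Finset.sum_congr rfl fun j _ => ?_
    rw [norm_mul, norm_mul, norm_neg, Complex.norm_I, one_mul, norm_pow, Complex.norm_real,
      Real.norm_of_nonneg (by positivity)]
  obtain ⟨v, hv0, hv, herr⟩ := exists_interaction_solution (m := Wiener.mulL ha.le)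
    (Wiener.norm_mulL_le ha.le) (c := Wiener.conjRefl) Wiener.norm_conjRefl_le Wiener.conjRefl_sub
    (S := Wiener.evolution) Wiener.norm_evolution_le Wiener.continuous_evolution p q
    (fun j => -Complex.I * ν j * ((B * m : ℝ) : ℂ) ^ (p j - 1)) hP (D := 2 * R + 1) (T := T)
    (x₀ := x₀) (by linarith) hT (by rw [hκ]; exact hsmall)
  refine ⟨Wiener.toHInfty hμ ha hB.le (v 0), fun t => Wiener.toHInfty hμ ha hB.le (Wiener.evolution t (v t)),
    ?_, Wiener.isSmoothSolution hμ ha hB hm p q ν hp hq hv, fun ξ => ?_⟩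
  · rw [hv0, ← hx₀]; rfl
  set f := fun t => interactionField (Wiener.mulL ha.le) Wiener.conjRefl Wiener.evolution p q
    (fun j => -Complex.I * ν j * ((B * m : ℝ) : ℂ) ^ (p j - 1)) t x₀ with hf
  have hfc : Continuous f := continuous_interactionField _ Wiener.norm_conjRefl_le Wiener.conjRefl_sub
    Wiener.norm_evolution_le Wiener.continuous_evolution p q _ x₀
  have h1 : ∫ t in (0 : ℝ)..T, duhamelIntegrand m B p q ν g ξ t =
      Wiener.hat a (∫ t in (0 : ℝ)..T, f t) ξ := by
    have h2 := ((Real.exp (-a * ‖ξ‖) : ℂ) • Wiener.evalCLM (μ := scaledMeasure d₁ d₂ m)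
      ξ).intervalIntegral_comp_comm (hfc.intervalIntegrable (μ := volume) 0 T)
    refine Eq.trans ?_ h2
    congr 1
    funext t
    rw [← hx₀, ← hat_interactionField ha]
    rfl
  have h3 : (Wiener.toHInfty hμ ha hB.le (Wiener.evolution T (v T))).hat ξ -
      B * Complex.exp (-(T * normSq ξ : ℝ) * Complex.I) *
        (g ξ + ∫ t in (0 : ℝ)..T, duhamelIntegrand m B p q ν g ξ t) =
      B * Complex.exp (-(T * normSq ξ : ℝ) * Complex.I) *
        Wiener.hat a (v T - x₀ - ∫ t in (0 : ℝ)..T, f t) ξ := by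
    rw [h1, ← hx₀, Wiener.hat_sub, Wiener.hat_sub]
    have : (Wiener.toHInfty hμ ha hB.le (Wiener.evolution T (v T))).hat ξ =
        B * (Complex.exp (-(T * normSq ξ : ℝ) * Complex.I) * Wiener.hat a (v T) ξ) := by
      change (B : ℂ) * Wiener.hat a _ ξ = _
      rw [Wiener.hat, Wiener.hat, Wiener.evolution_apply]; ring
    rw [this]; ring
  rw [h3, norm_mul, norm_mul, norm_exp_neg_ofReal_mul_I, mul_one, Complex.norm_real,
    Real.norm_of_nonneg hB.le]
  gcongr
  refine (Wiener.norm_hat_le ha.le _ ξ).trans ((Wiener.norm_apply_le _ ξ).trans (herr.trans ?_))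
  rw [hκ]
  exact le_rfl

end Expansion

/-! ### Coordinates, boxes and bumps in frequency space -/

section Coordinates

variable {d₁ d₂ : ℕ}

/-- A coordinate of a frequency. -/
def coord : Fin d₁ ⊕ Fin d₂ → Freq d₁ d₂ → ℝ
  | .inl i, ξ => ξ.1 i
  | .inr j, ξ => (ξ.2 j : ℝ)

/-- The standard basis of the frequency space. -/
def basisFreq : Fin d₁ ⊕ Fin d₂ → Freq d₁ d₂
  | .inl i => (Pi.single i 1, 0)
  | .inr j => (0, Pi.single j 1)

theorem coord_add (c : Fin d₁ ⊕ Fin d₂) (ξ η : Freq d₁ d₂) :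
    coord c (ξ + η) = coord c ξ + coord c η := by
  cases c <;> simp [coord]

theorem coord_neg (c : Fin d₁ ⊕ Fin d₂) (ξ : Freq d₁ d₂) : coord c (-ξ) = -coord c ξ := by
  cases c <;> simp [coord]

theorem coord_sub (c : Fin d₁ ⊕ Fin d₂) (ξ η : Freq d₁ d₂) :
    coord c (ξ - η) = coord c ξ - coord c η := by
  rw [sub_eq_add_neg, coord_add, coord_neg, ← sub_eq_add_neg]

theorem coord_zsmul_basisFreq (c c' : Fin d₁ ⊕ Fin d₂) (k : ℤ) :
    coord c (k • basisFreq c') = if c = c' then (k : ℝ) else 0 := by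
  rcases c with i | i <;> rcases c' with j | j <;> simp [coord, basisFreq, Pi.single_apply]

theorem normSq_eq_sum_coord (ξ : Freq d₁ d₂) : normSq ξ = ∑ c, coord c ξ ^ 2 := by
  rw [Fintype.sum_sum_type]; rfl

theorem coord_sq_le_normSq (c : Fin d₁ ⊕ Fin d₂) (ξ : Freq d₁ d₂) : coord c ξ ^ 2 ≤ normSq ξ := by
  rw [normSq_eq_sum_coord]
  exact Finset.single_le_sum (f := fun c => coord c ξ ^ 2) (fun c _ => sq_nonneg _) (Finset.mem_univ c)

theorem normSq_le_of_coord_le {ξ : Freq d₁ d₂} {r : ℝ} (h : ∀ c, |coord c ξ| ≤ r) :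
    normSq ξ ≤ (d₁ + d₂ : ℕ) * r ^ 2 := by
  rw [normSq_eq_sum_coord]
  calc ∑ c, coord c ξ ^ 2 ≤ ∑ _c : Fin d₁ ⊕ Fin d₂, r ^ 2 := by
        refine Finset.sum_le_sum fun c _ => ?_
        rw [← sq_abs]
        gcongr
        exact h c
    _ = (d₁ + d₂ : ℕ) * r ^ 2 := by simp

theorem normSq_zsmul_add (c : Fin d₁ ⊕ Fin d₂) (k : ℤ) (ζ : Freq d₁ d₂) :
    normSq (k • basisFreq c + ζ) = (k : ℝ) ^ 2 + 2 * k * coord c ζ + normSq ζ := by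
  rw [normSq_eq_sum_coord, normSq_eq_sum_coord]
  have : ∀ c', coord c' (k • basisFreq c + ζ) ^ 2 =
      (if c' = c then (k : ℝ) ^ 2 + 2 * k * coord c ζ else 0) + coord c' ζ ^ 2 := by
    intro c'
    rw [coord_add, coord_zsmul_basisFreq]
    split_ifs with h
    · subst h; ring
    · ring
  simp only [this, Finset.sum_add_distrib, Finset.sum_ite_eq', Finset.mem_univ, if_true]

end Coordinates

section Boxes

variable {d₁ d₂ : ℕ}

theorem freqMeasure_Icc (l u : Fin d₁ → ℝ) (L U : Fin d₂ → ℤ) :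
    freqMeasure d₁ d₂ (Set.Icc l u ×ˢ Set.Icc L U) =
      (∏ i, ENNReal.ofReal (u i - l i)) * ∏ j, ((U j + 1 - L j).toNat : ENNReal) := by
  rw [freqMeasure, Measure.prod_prod, Real.volume_Icc_pi]
  congr 1
  rw [← Finset.coe_Icc, Measure.count_apply_finset, Pi.card_Icc]
  push_cast
  simp only [Int.card_Icc]

/-- The box of half-widths `α` in the real directions and `β` in the integer directions. -/
def box (α : Fin d₁ → ℝ) (β : Fin d₂ → ℕ) : Set (Freq d₁ d₂) :=
  Set.Icc (-α) α ×ˢ Set.Icc (-fun j => (β j : ℤ)) fun j => (β j : ℤ)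

/-- The volume of a box, up to a constant factor. -/
def boxVol (α : Fin d₁ → ℝ) (β : Fin d₂ → ℕ) : ℝ := (∏ i, α i) * ∏ j, ((β j : ℝ) + 1)

theorem mem_box {α : Fin d₁ → ℝ} {β : Fin d₂ → ℕ} {ξ : Freq d₁ d₂} :
    ξ ∈ box α β ↔ (∀ i, |ξ.1 i| ≤ α i) ∧ ∀ j, |ξ.2 j| ≤ β j := by
  simp only [box, Set.mem_prod, Set.mem_Icc, Pi.le_def, Pi.neg_apply, abs_le, forall_and]

theorem isCompact_box (α : Fin d₁ → ℝ) (β : Fin d₂ → ℕ) : IsCompact (box α β) := by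
  refine isCompact_Icc.prod ?_
  rw [← Finset.coe_Icc]
  exact (Finset.finite_toSet _).isCompact

theorem measurableSet_box (α : Fin d₁ → ℝ) (β : Fin d₂ → ℕ) : MeasurableSet (box α β) :=
  (isCompact_box α β).measurableSet

theorem boxVol_pos {α : Fin d₁ → ℝ} (hα : ∀ i, 0 < α i) (β : Fin d₂ → ℕ) : 0 < boxVol α β :=
  mul_pos (Finset.prod_pos fun i _ => hα i) (Finset.prod_pos fun j _ => by positivity)

theorem neg_mem_box {α : Fin d₁ → ℝ} {β : Fin d₂ → ℕ} {ξ : Freq d₁ d₂} : -ξ ∈ box α β ↔ ξ ∈ box α β := by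
  simp [mem_box]

theorem freqMeasure_box_le {α : Fin d₁ → ℝ} (hα : ∀ i, 0 < α i) (β : Fin d₂ → ℕ) :
    freqMeasure d₁ d₂ (box (2 • α) β) ≤ ENNReal.ofReal (4 ^ (d₁ + d₂) * boxVol α β) := by
  rw [box, freqMeasure_Icc, boxVol]
  have h1 : (∏ i, ENNReal.ofReal ((2 • α) i - (-(2 • α)) i)) = ENNReal.ofReal (∏ i, 4 * α i) := by
    rw [ENNReal.ofReal_prod_of_nonneg fun i _ => by have := hα i; positivity]
    refine Finset.prod_congr rfl fun i _ => ?_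
    congr 1
    simp; ring
  have h2 : (∏ j, (((β j : ℤ) + 1 - (-fun j => (β j : ℤ)) j).toNat : ENNReal)) ≤
      ENNReal.ofReal (∏ j, 4 * ((β j : ℝ) + 1)) := by
    rw [ENNReal.ofReal_prod_of_nonneg fun i _ => by positivity]
    refine Finset.prod_le_prod' fun j _ => ?_
    have : ((β j : ℤ) + 1 - (-fun j => (β j : ℤ)) j).toNat = 2 * β j + 1 := by
      rw [Pi.neg_apply]; omega
    rw [this, ← ENNReal.ofReal_natCast]
    refine ENNReal.ofReal_le_ofReal ?_
    push_cast
    have : (0 : ℝ) ≤ β j := Nat.cast_nonneg _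
    linarith
  rw [h1]
  refine (mul_le_mul' le_rfl h2).trans (le_of_eq ?_)
  rw [← ENNReal.ofReal_mul (Finset.prod_nonneg fun i _ => by have := hα i; positivity)]
  congr 1
  rw [Finset.prod_mul_distrib, Finset.prod_mul_distrib]
  simp only [Finset.prod_const, Finset.card_univ, Fintype.card_fin]
  ring

/-- In a real direction [-α, α] and [ξ - α, ξ + α] overlap in length 2α - |ξ| ≥ α; in an integer
direction they share 2β + 1 - |ξ| ≥ β + 1 points. This explains the normalisation in `boxVol`. -/
theorem le_freqMeasure_box_inter {α : Fin d₁ → ℝ} (hα : ∀ i, 0 < α i) (β : Fin d₂ → ℕ)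
    {ξ : Freq d₁ d₂} (hξ : ξ ∈ box α β) :
    ENNReal.ofReal (boxVol α β) ≤ freqMeasure d₁ d₂ {η | η ∈ box α β ∧ ξ - η ∈ box α β} := by
  rw [mem_box] at hξ
  have hsub : (Set.Icc (fun i => max (-α i) (ξ.1 i - α i)) (fun i => min (α i) (ξ.1 i + α i)) ×ˢ
      Set.Icc (fun j => max (-(β j : ℤ)) (ξ.2 j - β j)) (fun j => min (β j : ℤ) (ξ.2 j + β j))) ⊆
      {η : Freq d₁ d₂ | η ∈ box α β ∧ ξ - η ∈ box α β} := by
    rintro η ⟨⟨h1, h2⟩, h3, h4⟩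
    simp only [Set.mem_ofPred_eq, mem_box, Prod.fst_sub, Prod.snd_sub, Pi.sub_apply, abs_le]
    simp only [Pi.le_def, max_le_iff, le_min_iff] at h1 h2 h3 h4
    refine ⟨⟨fun i => ?_, fun j => ?_⟩, fun i => ?_, fun j => ?_⟩
    · have := h1 i; have := h2 i; constructor <;> linarith
    · have := h3 j; have := h4 j; constructor <;> linarith
    · have := h1 i; have := h2 i; constructor <;> linarith
    · have := h3 j; have := h4 j; constructor <;> linarith
  refine le_trans ?_ (measure_mono hsub)
  rw [freqMeasure_Icc, boxVol, ENNReal.ofReal_mul (Finset.prod_nonneg fun i _ => (hα i).le),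
    ENNReal.ofReal_prod_of_nonneg fun i _ => (hα i).le,
    ENNReal.ofReal_prod_of_nonneg fun i _ => by positivity]
  refine mul_le_mul' (Finset.prod_le_prod' fun i _ => ENNReal.ofReal_le_ofReal ?_)
    (Finset.prod_le_prod' fun j _ => ?_)
  · have := abs_le.1 (hξ.1 i)
    have := hα i
    rcases min_choice (α i) (ξ.1 i + α i) with h | h <;>
      rcases max_choice (-α i) (ξ.1 i - α i) with h' | h' <;> rw [h, h'] <;> linarith
  · have := abs_le.1 (hξ.2 j)
    rw [← Nat.cast_add_one, ENNReal.ofReal_natCast]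
    refine Nat.cast_le.2 ?_
    omega

/-- A continuous even bump equal to one on the box `box α β` and vanishing off `box (2 • α) β`. -/
def bump (α : Fin d₁ → ℝ) (β : Fin d₂ → ℕ) (ξ : Freq d₁ d₂) : ℝ :=
  (∏ i, max 0 (min 1 (2 - |ξ.1 i| / α i))) * if ∀ j, |ξ.2 j| ≤ β j then 1 else 0

variable {α : Fin d₁ → ℝ} {β : Fin d₂ → ℕ}

theorem continuous_bump : Continuous (bump (d₁ := d₁) (d₂ := d₂) α β) := by
  unfold bump
  have h1 : Continuous fun ξ : Freq d₁ d₂ => (if ∀ j, |ξ.2 j| ≤ β j then (1 : ℝ) else 0) :=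
    (continuous_of_discreteTopology (f := fun k : Fin d₂ → ℤ => (if ∀ j, |k j| ≤ β j then (1 : ℝ) else 0))).comp
      continuous_snd
  have h2 : Continuous fun ξ : Freq d₁ d₂ => ∏ i, max 0 (min 1 (2 - |ξ.1 i| / α i)) := by
    refine continuous_finsetProd _ fun i _ => ?_
    have : Continuous fun ξ : Freq d₁ d₂ => |ξ.1 i| / α i := by
      have : Continuous fun ξ : Freq d₁ d₂ => ξ.1 i := by fun_prop
      exact this.abs.div_const _
    fun_prop
  exact h2.mul h1

theorem bump_nonneg (ξ : Freq d₁ d₂) : 0 ≤ bump α β ξ := by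
  unfold bump
  refine mul_nonneg (Finset.prod_nonneg fun i _ => le_max_left _ _) ?_
  split_ifs <;> norm_num

theorem bump_le_one (ξ : Freq d₁ d₂) : bump α β ξ ≤ 1 := by
  unfold bump
  refine mul_le_one₀ (Finset.prod_le_one (fun i _ => le_max_left _ _)
    fun i _ => max_le zero_le_one (min_le_left _ _)) (by split_ifs <;> norm_num) ?_
  split_ifs <;> norm_num

theorem bump_neg (ξ : Freq d₁ d₂) : bump α β (-ξ) = bump α β ξ := by
  unfold bump
  simp

theorem bump_eq_one (hα : ∀ i, 0 < α i) {ξ : Freq d₁ d₂} (h : ξ ∈ box α β) : bump α β ξ = 1 := by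
  rw [mem_box] at h
  unfold bump
  rw [if_pos h.2, mul_one]
  refine Finset.prod_eq_one fun i _ => ?_
  have : |ξ.1 i| / α i ≤ 1 := (div_le_one (hα i)).2 (h.1 i)
  rw [min_eq_left (by linarith), max_eq_right zero_le_one]

theorem bump_eq_zero (hα : ∀ i, 0 < α i) {ξ : Freq d₁ d₂} (h : ξ ∉ box (2 • α) β) : bump α β ξ = 0 := by
  unfold bump
  split_ifs with h1
  · rw [mem_box] at h
    push Not at h
    have h2 : ∃ i, (2 • α) i < |ξ.1 i| := by
      by_contra! h3
      obtain ⟨j, hj⟩ := h h3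
      exact absurd (h1 j) (not_le.2 hj)
    obtain ⟨i, hi⟩ := h2
    have : 2 < |ξ.1 i| / α i := by
      rw [lt_div_iff₀ (hα i)]
      simpa using hi
    rw [mul_one]
    refine Finset.prod_eq_zero (Finset.mem_univ i) ?_
    exact max_eq_left ((min_le_right _ _).trans (by linarith))
  · rw [mul_zero]

theorem coord_le_of_mem_box {r : ℝ} (hα : ∀ i, α i ≤ r) (hβ : ∀ j, (β j : ℝ) ≤ r) {ξ : Freq d₁ d₂}
    (h : ξ ∈ box α β) (c : Fin d₁ ⊕ Fin d₂) : |coord c ξ| ≤ r := by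
  rw [mem_box] at h
  cases c with
  | inl i => exact (h.1 i).trans (hα i)
  | inr j =>
    refine le_trans ?_ (hβ j)
    have := h.2 j
    rw [coord]
    exact_mod_cast this

end Boxes

/-! ### Monomials under a nearly constant phase -/

namespace Wiener

variable {d₁ d₂ : ℕ} {μ : Measure (Freq d₁ d₂)} [μ.IsAddHaarMeasure]

/-- A compactly supported continuous function as an element of the Wiener space. -/
def ofCompact (g : Freq d₁ d₂ → ℂ) (hg : Continuous g) (hgs : HasCompactSupport g) : Wiener μ :=
  mk g hg hgs.is_zero_at_infty (hg.integrable_of_hasCompactSupport hgs)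

/-- The unweighted convolution product. -/
def star : Wiener μ →L[ℂ] Wiener μ →L[ℂ] Wiener μ := mulL le_rfl

theorem hat_zero (x : Wiener μ) : hat 0 x = x := by
  funext ξ
  simp [hat]

theorem coe_star (x y : Wiener μ) : (star x y : Freq d₁ d₂ → ℂ) = conv μ x y := by
  have h := hat_mulL (le_refl (0 : ℝ)) x y
  rwa [hat_zero, hat_zero, hat_zero] at h

theorem norm_star_le (x y : Wiener μ) : ‖star x y‖ ≤ ‖x‖ * ‖y‖ := norm_mulL_le le_rfl x y

/-- The monomial `x^q x̄^(p-q)` with respect to convolution. -/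
def monomial (p q : ℕ) (x : Wiener μ) : Wiener μ :=
  iterProd (fun a b => star a b) (p - 1) (factors conjRefl q (p - 1) x)

theorem norm_monomial_le {p : ℕ} (hp : 1 ≤ p) (q : ℕ) {R : ℝ} {x : Wiener μ} (hx : ‖x‖ ≤ R) :
    ‖monomial p q x‖ ≤ R ^ p := by
  have h := norm_iterProd_le (m := star) norm_star_le ((norm_nonneg x).trans hx) (p - 1)
    (factors conjRefl q (p - 1) x) fun i => (norm_factors_le norm_conjRefl_le _ _ _ i).trans hx
  rwa [Nat.sub_add_cancel hp] at h

theorem norm_monomial_sub_le {p : ℕ} (hp : 1 ≤ p) (q : ℕ) {R ε : ℝ} {x y : Wiener μ} (hx : ‖x‖ ≤ R)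
    (hy : ‖y‖ ≤ R) (h : ‖x - y‖ ≤ ε * R) : ‖monomial p q x - monomial p q y‖ ≤ p * ε * R ^ p := by
  have hR : 0 ≤ R := (norm_nonneg x).trans hx
  have h1 := norm_iterProd_sub_le (m := star) norm_star_le hR ((norm_nonneg _).trans h) (p - 1)
    (factors conjRefl q (p - 1) x) (factors conjRefl q (p - 1) y)
    (fun i => (norm_factors_le norm_conjRefl_le _ _ _ i).trans hx)
    (fun i => (norm_factors_le norm_conjRefl_le _ _ _ i).trans hy)
    (fun i => (norm_factors_sub_le norm_conjRefl_le conjRefl_sub _ _ _ _ i).trans h)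
  refine h1.trans (le_of_eq ?_)
  obtain ⟨n, rfl⟩ : ∃ n, p = n + 1 := ⟨p - 1, (Nat.sub_add_cancel hp).symm⟩
  simp only [Nat.add_sub_cancel]
  push_cast
  ring

theorem iterProd_smul (n : ℕ) (c : Fin (n + 1) → ℂ) (x : Fin (n + 1) → Wiener μ) :
    iterProd (fun a b => star a b) n (fun i => c i • x i) =
      (∏ i, c i) • iterProd (fun a b => star a b) n x := by
  induction n with
  | zero => simp [iterProd]
  | succ n ih =>
    rw [iterProd, iterProd, ih (fun i => c i.succ) fun i => x i.succ, Fin.prod_univ_succ c, map_smul,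
      map_smul, _root_.smul_apply, smul_smul, mul_comm]

theorem conjRefl_smul (c : ℂ) (x : Wiener μ) : conjRefl (c • x) = starRingEnd ℂ c • conjRefl x :=
  ext fun ξ => by simp

theorem monomial_smul {p q : ℕ} (hp : 1 ≤ p) (hq : q ≤ p) (c : ℂ) (x : Wiener μ) :
    monomial p q (c • x) = (c ^ q * starRingEnd ℂ c ^ (p - q)) • monomial p q x := by
  have h : factors conjRefl q (p - 1) (c • x) = fun i =>
      factors (starRingEnd ℂ) q (p - 1) c i • factors conjRefl q (p - 1) x i := by
    funext i
    unfold factors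
    split_ifs
    exacts [rfl, conjRefl_smul c x]
  rw [monomial, h, iterProd_smul, prod_factors _ (by rw [Nat.sub_add_cancel hp]; exact hq),
    Nat.sub_add_cancel hp, monomial]

theorem continuous_monomial (p q : ℕ) {x : ℝ → Wiener μ} (hx : Continuous x) :
    Continuous fun t => monomial p q (x t) := by
  have hc : Continuous (conjRefl (μ := μ)) := by
    refine LipschitzWith.continuous (K := 1) (LipschitzWith.of_dist_le_mul fun x y => ?_)
    rw [dist_eq_norm, dist_eq_norm, ← conjRefl_sub, NNReal.coe_one, one_mul]
    exact norm_conjRefl_le _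
  refine continuous_iterProd star _ _ fun i => ?_
  unfold factors
  split_ifs
  exacts [hx, hc.comp hx]

theorem norm_exp_ofReal_mul_I_sub_one_le (r : ℝ) : ‖Complex.exp ((r : ℂ) * Complex.I) - 1‖ ≤ |r| := by
  rw [mul_comm]
  exact Real.norm_exp_I_mul_ofReal_sub_one_le

/-- The common phase e^{-itl} is factored out; what remains differs from 1 by at most |t(|ξ|² - l)|
on the support of x. -/
theorem norm_evolution_sub_le {t l ε : ℝ} (hε : 0 ≤ ε) {x : Wiener μ}
    (h : ∀ ξ, x ξ ≠ 0 → |t * (normSq ξ - l)| ≤ ε) :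
    ‖evolution t x - Complex.exp (-(t * l : ℝ) * Complex.I) • x‖ ≤ ε * ‖x‖ := by
  have h1 : ∀ ξ, ‖(evolution t x - Complex.exp (-(t * l : ℝ) * Complex.I) • x) ξ‖ ≤ ε * ‖x ξ‖ := by
    intro ξ
    by_cases hx : x ξ = 0
    · rw [sub_apply, smul_apply, evolution_apply, hx]; simp
    · have e : (evolution t x - Complex.exp (-(t * l : ℝ) * Complex.I) • x) ξ =
          Complex.exp (-(t * l : ℝ) * Complex.I) *
            (Complex.exp (((-(t * (normSq ξ - l)) : ℝ) : ℂ) * Complex.I) - 1) * x ξ := by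
        rw [sub_apply, smul_apply, evolution_apply, mul_sub, ← Complex.exp_add, mul_one, sub_mul]
        congr 3
        push_cast; ring
      rw [e, norm_mul, norm_mul, norm_exp_neg_ofReal_mul_I, one_mul]
      gcongr
      refine (norm_exp_ofReal_mul_I_sub_one_le _).trans ?_
      rw [abs_neg]
      exact h ξ hx
  refine norm_le (by positivity) (fun ξ => (h1 ξ).trans ?_) ?_
  · gcongr
    exact x.norm_apply_le ξ
  · refine (integral_mono (Wiener.integrable _).norm (x.integrable.norm.const_mul ε) h1).trans ?_
    rw [integral_const_mul]
    gcongr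
    exact x.integral_norm_le

/-- If the dispersion relation is nearly constant on the support of `x`, the evolution of a monomial of
`z • x` nearly amounts to multiplication by a phase. -/
theorem norm_monomial_evolution_sub_le {p q : ℕ} (hp : 1 ≤ p) (hq : q ≤ p) {t l ε R : ℝ} (hε : 0 ≤ ε)
    {z : ℂ} (hz : ‖z‖ = 1) {x : Wiener μ} (hx : ‖x‖ ≤ R)
    (h : ∀ ξ, x ξ ≠ 0 → |t * (normSq ξ - l)| ≤ ε) {ξ : Freq d₁ d₂} (hξ : |t * normSq ξ| ≤ ε) :
    ‖Complex.exp ((t * normSq ξ : ℝ) * Complex.I) * monomial p q (evolution t (z • x)) ξ -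
      (z * Complex.exp (-(t * l : ℝ) * Complex.I)) ^ q *
        starRingEnd ℂ (z * Complex.exp (-(t * l : ℝ) * Complex.I)) ^ (p - q) * monomial p q x ξ‖ ≤
      (p + 1) * ε * R ^ p := by
  set c := z * Complex.exp (-(t * l : ℝ) * Complex.I) with hc
  have hR : 0 ≤ R := (norm_nonneg x).trans hx
  have hcn : ‖c‖ = 1 := by rw [hc, norm_mul, hz, norm_exp_neg_ofReal_mul_I, one_mul]
  have h1 : ‖evolution t (z • x)‖ ≤ R := by
    refine (norm_evolution_le _ _).trans ?_
    rw [norm_smul, hz, one_mul]; exact hx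
  have h2 : ‖c • x‖ ≤ R := by rw [norm_smul, hcn, one_mul]; exact hx
  have h3 : ‖evolution t (z • x) - c • x‖ ≤ ε * R := by
    rw [map_smul, hc, mul_smul, ← smul_sub, norm_smul, hz, one_mul]
    exact (norm_evolution_sub_le hε h).trans (by gcongr)
  -- Each of the p input phases costs ε R^p here, and the output phase at ξ costs one more, hence
  -- the constant p + 1.
  have h4 := norm_monomial_sub_le hp q h1 h2 h3
  rw [monomial_smul hp hq] at h4
  have h5 := (norm_apply_le _ ξ).trans h4
  rw [sub_apply, smul_apply] at h5
  have h6 := (norm_apply_le _ ξ).trans (norm_monomial_le hp q h1)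
  calc _ = ‖(Complex.exp ((t * normSq ξ : ℝ) * Complex.I) - 1) * monomial p q (evolution t (z • x)) ξ +
        (monomial p q (evolution t (z • x)) ξ - c ^ q * starRingEnd ℂ c ^ (p - q) * monomial p q x ξ)‖ := by
        congr 1; ring
    _ ≤ ε * R ^ p + p * ε * R ^ p := by
        refine (norm_add_le _ _).trans (add_le_add ?_ h5)
        rw [norm_mul]
        gcongr
        exact (norm_exp_ofReal_mul_I_sub_one_le _).trans hξ
    _ = _ := by ring

end Wiener

section Duhamel

variable {d₁ d₂ : ℕ} {m : ℝ} [(scaledMeasure d₁ d₂ m).IsAddHaarMeasure]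

/-- For compactly supported g the algebra with a = 0 is available, which gives norm bounds and
continuity in time without any weight. -/
theorem monomialHat_freeEvolution {g : Freq d₁ d₂ → ℂ} (hg : Continuous g) (hgs : HasCompactSupport g)
    (p q : ℕ) (t : ℝ) :
    monomialHat m p q (freeEvolution t g) = Wiener.monomial (μ := scaledMeasure d₁ d₂ m) p q
      (Wiener.evolution t (Wiener.ofCompact g hg hgs)) := by
  set x : Wiener (scaledMeasure d₁ d₂ m) := Wiener.ofCompact g hg hgs
  refine Eq.symm ?_
  refine (map_iterProd (Φ := fun y : Wiener (scaledMeasure d₁ d₂ m) => (y : Freq d₁ d₂ → ℂ))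
    Wiener.coe_star _ _).trans ?_
  refine congrArg _ (funext fun i => ?_)
  exact map_factors (Φ := fun y : Wiener (scaledMeasure d₁ d₂ m) => (y : Freq d₁ d₂ → ℂ))
    (c' := reflConj) (fun y => rfl) _ _ _ i

theorem continuous_duhamelIntegrand {g : Freq d₁ d₂ → ℂ} (hg : Continuous g) (hgs : HasCompactSupport g)
    (B : ℝ) {n : ℕ} (p q : Fin n → ℕ) (ν : Fin n → ℂ) (ξ : Freq d₁ d₂) :
    Continuous (duhamelIntegrand m B p q ν g ξ) := by
  unfold duhamelIntegrand
  simp only [monomialHat_freeEvolution hg hgs]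
  refine continuous_finsetSum _ fun j _ => continuous_const.mul (Continuous.mul (by fun_prop) ?_)
  exact (Wiener.evalCLM ξ).continuous.comp
    (Wiener.continuous_monomial _ _ (Wiener.continuous_evolution _))

theorem norm_integral_duhamel_sub_le {g : Freq d₁ d₂ → ℂ} (hg : Continuous g) (hgs : HasCompactSupport g)
    {B T : ℝ} (hT : 0 ≤ T) (hM : 0 ≤ B * m) {n : ℕ} (p q : Fin n → ℕ) (ν : Fin n → ℂ) (ξ : Freq d₁ d₂)
    (L : Fin n → ℂ) (E : Fin n → ℝ)
    (h : ∀ t ∈ Set.Icc 0 T, ∀ j, ‖Complex.exp ((t * normSq ξ : ℝ) * Complex.I) *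
      Wiener.monomial (μ := scaledMeasure d₁ d₂ m) (p j) (q j)
        (Wiener.evolution t (Wiener.ofCompact g hg hgs)) ξ - L j‖ ≤ E j) :
    ‖(∫ t in (0 : ℝ)..T, duhamelIntegrand m B p q ν g ξ t) -
      T * ∑ j, -Complex.I * ν j * ((B * m : ℝ) : ℂ) ^ (p j - 1) * L j‖ ≤
      T * ∑ j, ‖ν j‖ * (B * m) ^ (p j - 1) * E j := by
  have h1 : (T : ℂ) * ∑ j, -Complex.I * ν j * ((B * m : ℝ) : ℂ) ^ (p j - 1) * L j =
      ∫ _t in (0 : ℝ)..T, ∑ j, -Complex.I * ν j * ((B * m : ℝ) : ℂ) ^ (p j - 1) * L j := by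
    rw [intervalIntegral.integral_const, sub_zero, Complex.real_smul]
  rw [h1, ← intervalIntegral.integral_sub
    ((continuous_duhamelIntegrand hg hgs B p q ν ξ).intervalIntegrable _ _)
    (continuous_const.intervalIntegrable _ _)]
  refine (intervalIntegral.norm_integral_le_of_norm_le_const
    (C := ∑ j, ‖ν j‖ * (B * m) ^ (p j - 1) * E j) fun t ht => ?_).trans ?_
  · rw [Set.uIoc_of_le hT] at ht
    rw [duhamelIntegrand, ← Finset.sum_sub_distrib]
    refine (norm_sum_le _ _).trans (Finset.sum_le_sum fun j _ => ?_)
    rw [← mul_sub, norm_mul, norm_mul, norm_mul, norm_neg, Complex.norm_I, one_mul, norm_pow,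
      Complex.norm_real, Real.norm_of_nonneg hM, monomialHat_freeEvolution hg hgs]
    gcongr
    exact h t ⟨ht.1.le, ht.2⟩ j
  · rw [sub_zero, abs_of_nonneg hT, mul_comm]

end Duhamel

/-! ### Lower bounds for convolutions of bumps -/

section Positivity

variable {d₁ d₂ : ℕ} {α : Fin d₁ → ℝ} {β : Fin d₂ → ℕ}

/-- The function `f` is real and nonnegative, and at least one on the translate by `η` of a box. -/
def BoxLower (α : Fin d₁ → ℝ) (β : Fin d₂ → ℕ) (f : Freq d₁ d₂ → ℂ) (η : Freq d₁ d₂) : Prop :=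
  ∃ r : Freq d₁ d₂ → ℝ, (∀ ξ, f ξ = r ξ) ∧ (∀ ξ, 0 ≤ r ξ) ∧ ∀ ζ ∈ box α β, 1 ≤ r (η + ζ)

/-- At η + η' + ζ the convolution integrates a product at least one over those s for which s and ζ -
s both lie in the box. By `le_freqMeasure_box_inter` this set has measure at least one for the
scaled measure. Since no constant is lost, the bound iterates to any number of factors. -/
theorem BoxLower.star (hα : ∀ i, 0 < α i) [(scaledMeasure d₁ d₂ (boxVol α β)).IsAddHaarMeasure]
    {x y : Wiener (scaledMeasure d₁ d₂ (boxVol α β))} {η η' : Freq d₁ d₂} (hx : BoxLower α β x η)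
    (hy : BoxLower α β y η') : BoxLower α β (Wiener.star x y) (η + η') := by
  obtain ⟨r, hr, hr0, hr1⟩ := hx
  obtain ⟨r', hr', hr0', hr1'⟩ := hy
  refine ⟨fun ξ => ∫ t, r t * r' (ξ - t) ∂scaledMeasure d₁ d₂ (boxVol α β), fun ξ => ?_, fun ξ =>
    integral_nonneg fun t => mul_nonneg (hr0 _) (hr0' _), fun ζ hζ => ?_⟩
  · rw [Wiener.coe_star, conv_apply, ← integral_complex_ofReal]
    refine integral_congr_ae (ae_of_all _ fun t => ?_)
    simp only [hr, hr', Complex.ofReal_mul]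
  · have hm := boxVol_pos hα β
    have hE : MeasurableSet {s : Freq d₁ d₂ | s ∈ box α β ∧ ζ - s ∈ box α β} :=
      (measurableSet_box α β).inter ((measurable_const.sub measurable_id) (measurableSet_box α β))
    have h1 : 1 ≤ scaledMeasure d₁ d₂ (boxVol α β) {s : Freq d₁ d₂ | s ∈ box α β ∧ ζ - s ∈ box α β} := by
      have := le_freqMeasure_box_inter hα β hζ
      change 1 ≤ ENNReal.ofReal (boxVol α β)⁻¹ * freqMeasure d₁ d₂ _
      calc (1 : ENNReal) = ENNReal.ofReal (boxVol α β)⁻¹ * ENNReal.ofReal (boxVol α β) := by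
            rw [← ENNReal.ofReal_mul (by positivity), inv_mul_cancel₀ hm.ne', ENNReal.ofReal_one]
        _ ≤ _ := by gcongr
    have h2 : scaledMeasure d₁ d₂ (boxVol α β) {s : Freq d₁ d₂ | s ∈ box α β ∧ ζ - s ∈ box α β} ≠ ⊤ :=
      ((measure_mono fun s hs => hs.1).trans_lt (isCompact_box α β).measure_lt_top).ne
    have h3 : (1 : ℝ) ≤ (scaledMeasure d₁ d₂ (boxVol α β)).real {s : Freq d₁ d₂ | s ∈ box α β ∧ ζ - s ∈ box α β} := by
      rw [measureReal_def, ← ENNReal.toReal_one]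
      exact ENNReal.toReal_mono h2 h1
    have hint : Integrable (fun t => r (η + t) * r' (η' + ζ - t)) (scaledMeasure d₁ d₂ (boxVol α β)) := by
      have hx1 : Integrable (fun t => r t) (scaledMeasure d₁ d₂ (boxVol α β)) := by
        refine x.integrable.norm.congr (ae_of_all _ fun t => ?_)
        simp only [hr, Complex.norm_real, Real.norm_of_nonneg (hr0 t)]
      have hcy : Continuous r' := by
        have h : r' = fun t => ‖y t‖ := funext fun t => by
          rw [hr', Complex.norm_real, Real.norm_of_nonneg (hr0' t)]
        rw [h]; exact y.continuous.norm
      refine (hx1.comp_add_left η).mul_bdd (c := ‖y‖) (by fun_prop : Continuous _).aestronglyMeasurable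
        (ae_of_all _ fun t => ?_)
      have := y.norm_apply_le (η' + ζ - t)
      rwa [hr', Complex.norm_real] at this
    have h4 : ∫ t, r t * r' (η + η' + ζ - t) ∂scaledMeasure d₁ d₂ (boxVol α β) = ∫ t, r (η + t) * r' (η' + ζ - t) ∂scaledMeasure d₁ d₂ (boxVol α β) := by
      rw [← integral_add_left_eq_self _ η]
      refine integral_congr_ae (ae_of_all _ fun t => ?_)
      dsimp only
      congr 2
      abel
    dsimp only
    rw [h4]
    refine h3.trans ?_
    rw [← integral_indicator_one hE]
    refine integral_mono ((integrable_indicator_iff hE).2 (integrableOn_const h2)) hint fun t => ?_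
    by_cases ht : t ∈ {s : Freq d₁ d₂ | s ∈ box α β ∧ ζ - s ∈ box α β}
    · rw [Set.indicator_of_mem ht, Pi.one_apply]
      have e : η' + ζ - t = η' + (ζ - t) := by abel
      dsimp only
      rw [e]
      exact one_le_mul_of_one_le_of_one_le (hr1 t ht.1) (hr1' _ ht.2)
    · rw [Set.indicator_of_notMem ht]
      exact mul_nonneg (hr0 _) (hr0' _)

theorem BoxLower.iterProd (hα : ∀ i, 0 < α i) [(scaledMeasure d₁ d₂ (boxVol α β)).IsAddHaarMeasure]
    (n : ℕ) (x : Fin (n + 1) → Wiener (scaledMeasure d₁ d₂ (boxVol α β))) (η : Fin (n + 1) → Freq d₁ d₂)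
    (h : ∀ i, BoxLower α β (x i) (η i)) :
    BoxLower α β (NLS.iterProd (fun a b => Wiener.star a b) n x :
      Wiener (scaledMeasure d₁ d₂ (boxVol α β))) (∑ i, η i) := by
  induction n with
  | zero => simpa [NLS.iterProd] using h 0
  | succ n ih =>
    rw [NLS.iterProd, Fin.sum_univ_succ]
    exact (h 0).star hα (ih _ _ fun i => h _)

/-- A sum of translated bumps. -/
def bumpSum (α : Fin d₁ → ℝ) (β : Fin d₂ → ℕ) (S : Finset (Freq d₁ d₂)) (ξ : Freq d₁ d₂) : ℝ :=
  ∑ η ∈ S, bump α β (ξ - η)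

theorem continuous_bumpSum (S : Finset (Freq d₁ d₂)) : Continuous (bumpSum α β S) := by
  unfold bumpSum
  exact continuous_finsetSum _ fun η _ => continuous_bump.comp (continuous_id.sub continuous_const)

theorem bumpSum_nonneg (S : Finset (Freq d₁ d₂)) (ξ : Freq d₁ d₂) : 0 ≤ bumpSum α β S ξ :=
  Finset.sum_nonneg fun _ _ => bump_nonneg _

theorem exists_of_bumpSum_ne_zero (hα : ∀ i, 0 < α i) {S : Finset (Freq d₁ d₂)} {ξ : Freq d₁ d₂}
    (h : bumpSum α β S ξ ≠ 0) : ∃ η ∈ S, ξ - η ∈ box (2 • α) β := by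
  by_contra! h1
  exact h (Finset.sum_eq_zero fun η hη => bump_eq_zero hα (h1 η hη))

theorem hasCompactSupport_bumpSum (hα : ∀ i, 0 < α i) (S : Finset (Freq d₁ d₂)) :
    HasCompactSupport (bumpSum α β S) := by
  refine HasCompactSupport.intro (K := ⋃ η ∈ S, (fun ζ => ζ + η) '' box (2 • α) β)
    (S.finite_toSet.isCompact_biUnion fun η _ => (isCompact_box _ _).image (by fun_prop)) fun ξ hξ => ?_
  by_contra h
  obtain ⟨η, hη, h1⟩ := exists_of_bumpSum_ne_zero hα h
  exact hξ (Set.mem_biUnion (Finset.mem_coe.2 hη) ⟨ξ - η, h1, sub_add_cancel _ _⟩)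

theorem bumpSum_le (S : Finset (Freq d₁ d₂)) (ξ : Freq d₁ d₂) : bumpSum α β S ξ ≤ S.card := by
  unfold bumpSum
  refine (Finset.sum_le_sum fun η _ => bump_le_one _).trans ?_
  simp

theorem one_le_bumpSum (hα : ∀ i, 0 < α i) {S : Finset (Freq d₁ d₂)} {η ζ : Freq d₁ d₂} (hη : η ∈ S)
    (hζ : ζ ∈ box α β) : 1 ≤ bumpSum α β S (η + ζ) := by
  have h := Finset.single_le_sum (f := fun η' => bump α β (η + ζ - η')) (fun _ _ => bump_nonneg _) hη
  have e : η + ζ - η = ζ := by abel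
  rw [e, bump_eq_one hα hζ] at h
  exact h

theorem integral_bumpSum_le (hα : ∀ i, 0 < α i) (S : Finset (Freq d₁ d₂)) :
    ∫ ξ, bumpSum α β S ξ ∂scaledMeasure d₁ d₂ (boxVol α β) ≤ S.card * 4 ^ (d₁ + d₂) := by
  have hm := boxVol_pos hα β
  have := isAddHaarMeasure_scaledMeasure (d₁ := d₁) (d₂ := d₂) hm
  set μ := scaledMeasure d₁ d₂ (boxVol α β)
  have hcs : HasCompactSupport (bump (d₁ := d₁) (d₂ := d₂) α β) :=
    HasCompactSupport.intro (isCompact_box (2 • α) β) fun ξ hξ => bump_eq_zero hα hξ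
  have hi : Integrable (bump (d₁ := d₁) (d₂ := d₂) α β) μ :=
    continuous_bump.integrable_of_hasCompactSupport hcs
  have h1 : ∫ ξ, bump α β ξ ∂μ ≤ 4 ^ (d₁ + d₂) := by
    have hb := measurableSet_box (d₁ := d₁) (d₂ := d₂) (2 • α) β
    have hfin : μ (box (2 • α) β) ≠ ⊤ := (isCompact_box (2 • α) β).measure_lt_top.ne
    calc ∫ ξ, bump α β ξ ∂μ ≤ ∫ ξ, (box (2 • α) β).indicator 1 ξ ∂μ := by
          refine integral_mono hi ((integrable_indicator_iff hb).2 (integrableOn_const hfin)) fun ξ => ?_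
          by_cases h : ξ ∈ box (2 • α) β
          · rw [Set.indicator_of_mem h]; exact bump_le_one ξ
          · rw [Set.indicator_of_notMem h, bump_eq_zero hα h]
      _ = μ.real (box (2 • α) β) := integral_indicator_one hb
      _ ≤ 4 ^ (d₁ + d₂) := by
          rw [measureReal_def]
          refine ENNReal.toReal_le_of_le_ofReal (by positivity) ?_
          change ENNReal.ofReal (boxVol α β)⁻¹ * freqMeasure d₁ d₂ _ ≤ _
          calc _ ≤ ENNReal.ofReal (boxVol α β)⁻¹ * ENNReal.ofReal (4 ^ (d₁ + d₂) * boxVol α β) := by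
                gcongr
                exact freqMeasure_box_le hα β
            _ = ENNReal.ofReal (4 ^ (d₁ + d₂)) := by
                rw [← ENNReal.ofReal_mul (by positivity)]
                congr 1
                field_simp
  unfold bumpSum
  rw [integral_finsetSum _ fun η _ => hi.comp_sub_right η]
  simp only [integral_sub_right_eq_self (fun ξ => bump α β ξ)]
  rw [Finset.sum_const, nsmul_eq_mul]
  gcongr

end Positivity

/-! ### Sobolev norms of data and output -/

section Norms

variable {d₁ d₂ : ℕ}

/-- The `L²` norm of `⟨ξ⟩^s` over the set `E`. -/
def bracketNorm (s : ℝ) (E : Set (Freq d₁ d₂)) : ℝ :=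
  Real.sqrt (∫ ξ in E, bracket ξ ^ (2 * s) ∂freqMeasure d₁ d₂)

theorem norm_weighted_sq (s : ℝ) (f : Freq d₁ d₂ → ℂ) (ξ : Freq d₁ d₂) :
    ‖weighted s f ξ‖ ^ 2 = bracket ξ ^ (2 * s) * ‖f ξ‖ ^ 2 := by
  have h := (bracket_pos ξ).le
  rw [weighted, norm_mul, Complex.norm_real, Real.norm_of_nonneg (Real.rpow_nonneg h s), mul_pow,
    ← Real.rpow_natCast, ← Real.rpow_mul h, mul_comm s]
  norm_num

theorem sobolevNorm_eq (s : ℝ) (f : HInfty d₁ d₂) :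
    f.sobolevNorm s = Real.sqrt (∫ ξ, bracket ξ ^ (2 * s) * ‖f.hat ξ‖ ^ 2 ∂freqMeasure d₁ d₂) := by
  rw [HInfty.sobolevNorm, freqNorm, toReal_eLpNorm_two (f.memLp_weighted s)]
  simp only [norm_weighted_sq]

theorem integrable_weighted_sq (s : ℝ) (f : HInfty d₁ d₂) :
    Integrable (fun ξ => bracket ξ ^ (2 * s) * ‖f.hat ξ‖ ^ 2) (freqMeasure d₁ d₂) := by
  have h := (f.memLp_weighted s).integrable_norm_pow (by norm_num)
  refine h.congr (ae_of_all _ fun ξ => ?_)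
  exact norm_weighted_sq s f.hat ξ

theorem continuous_bracket_rpow (s : ℝ) : Continuous fun ξ : Freq d₁ d₂ => bracket ξ ^ s :=
  continuous_bracket.rpow_const fun ξ => Or.inl (bracket_pos ξ).ne'

theorem mul_bracketNorm_le_sobolevNorm (s : ℝ) (f : HInfty d₁ d₂) {L : ℝ} (hL : 0 ≤ L)
    {E : Set (Freq d₁ d₂)} (hE : IsCompact E) (h : ∀ ξ ∈ E, L ≤ ‖f.hat ξ‖) :
    L * bracketNorm s E ≤ f.sobolevNorm s := by
  rw [sobolevNorm_eq, bracketNorm, ← Real.sqrt_sq hL, ← Real.sqrt_mul (sq_nonneg L),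
    ← integral_const_mul]
  refine Real.sqrt_le_sqrt ?_
  have hi := integrable_weighted_sq s f
  refine le_trans ?_ (setIntegral_le_integral (s := E) hi (ae_of_all _ fun ξ =>
    mul_nonneg (Real.rpow_nonneg (bracket_pos ξ).le _) (sq_nonneg _)))
  refine setIntegral_mono_on ?_ hi.integrableOn hE.measurableSet fun ξ hξ => ?_
  · exact (((continuous_bracket_rpow _).continuousOn).integrableOn_compact hE).const_mul _
  · rw [mul_comm]
    have := h ξ hξ
    have := Real.rpow_nonneg (bracket_pos ξ).le (2 * s)
    gcongr

/-- Since s ≤ 0, the weight is at most b^s on the support of g, and the `L²` norm is interpolated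
between the supremum bound R and the `L¹` bound mR. -/
theorem sobolevNorm_le {s : ℝ} (hs : s ≤ 0) (f : HInfty d₁ d₂) {B b R m : ℝ} (hB : 0 ≤ B) (hb : 0 < b)
    (hR : 0 ≤ R) (hm : 0 < m) {g : Freq d₁ d₂ → ℂ} (hf : f.hat = fun ξ => (B : ℂ) * g ξ)
    (hg : Continuous g) (hgs : HasCompactSupport g) (hgR : ∀ ξ, ‖g ξ‖ ≤ R)
    (hgi : ∫ ξ, ‖g ξ‖ ∂scaledMeasure d₁ d₂ m ≤ R) (hgb : ∀ ξ, g ξ ≠ 0 → b ≤ bracket ξ) :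
    f.sobolevNorm s ≤ B * b ^ s * R * Real.sqrt m := by
  have hi : Integrable g (freqMeasure d₁ d₂) := hg.integrable_of_hasCompactSupport hgs
  have h1 : ∫ ξ, ‖g ξ‖ ∂freqMeasure d₁ d₂ ≤ m * R := by
    rw [freqMeasure_eq_smul_scaledMeasure hm, integral_smul_measure, ENNReal.toReal_ofReal hm.le,
      smul_eq_mul]
    gcongr
  have h2 : ∫ ξ, bracket ξ ^ (2 * s) * ‖f.hat ξ‖ ^ 2 ∂freqMeasure d₁ d₂ ≤
      (B * b ^ s * R) ^ 2 * m := by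
    calc _ ≤ ∫ ξ, (B * b ^ s) ^ 2 * R * ‖g ξ‖ ∂freqMeasure d₁ d₂ := by
          refine integral_mono (integrable_weighted_sq s f) (hi.norm.const_mul _) fun ξ => ?_
          by_cases h : g ξ = 0
          · simp [hf, h]
          · have h3 : bracket ξ ^ (2 * s) ≤ (b ^ s) ^ 2 := by
              rw [← Real.rpow_natCast, ← Real.rpow_mul hb.le, mul_comm s]
              exact Real.rpow_le_rpow_of_nonpos hb (hgb ξ h) (by linarith)
            simp only [hf, norm_mul, Complex.norm_real, Real.norm_of_nonneg hB]
            calc _ ≤ (b ^ s) ^ 2 * (B * ‖g ξ‖) ^ 2 := by gcongr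
              _ = (B * b ^ s) ^ 2 * ‖g ξ‖ * ‖g ξ‖ := by ring
              _ ≤ _ := by
                gcongr
                exact hgR ξ
      _ ≤ (B * b ^ s) ^ 2 * R * (m * R) := by
          rw [integral_const_mul]
          gcongr
      _ = _ := by ring
  rw [sobolevNorm_eq]
  refine (Real.sqrt_le_sqrt h2).trans (le_of_eq ?_)
  rw [Real.sqrt_mul (sq_nonneg _), Real.sqrt_sq (by positivity)]

variable {α : Fin d₁ → ℝ} {β : Fin d₂ → ℕ}

theorem bracket_le_of_mem_box {r : ℝ} (hr : 1 ≤ r) (hα : ∀ i, α i ≤ r) (hβ : ∀ j, (β j : ℝ) ≤ r)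
    {ξ : Freq d₁ d₂} (h : ξ ∈ box α β) : bracket ξ ≤ ((d₁ + d₂ : ℕ) + 1) * r := by
  have h1 := normSq_le_of_coord_le (coord_le_of_mem_box hα hβ h)
  unfold bracket
  refine Real.sqrt_le_iff.2 ⟨by positivity, ?_⟩
  have h2 : (0 : ℝ) ≤ (d₁ + d₂ : ℕ) := by positivity
  nlinarith [mul_nonneg h2 (sq_nonneg r), mul_nonneg (mul_nonneg h2 h2) (sq_nonneg r)]

theorem boxVol_le_freqMeasure_real (hα : ∀ i, 0 < α i) :
    boxVol α β ≤ (freqMeasure d₁ d₂).real (box α β) := by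
  have h0 : (0 : Freq d₁ d₂) ∈ box α β := mem_box.2 ⟨fun i => by simpa using (hα i).le, by simp⟩
  have h1 := (le_freqMeasure_box_inter hα β h0).trans (measure_mono fun η hη => hη.1)
  exact (ENNReal.ofReal_le_iff_le_toReal (isCompact_box α β).measure_lt_top.ne).1 h1

theorem le_bracketNorm_box {s : ℝ} (hs : s ≤ 0) {r : ℝ} (hr : 1 ≤ r) (hα : ∀ i, 0 < α i)
    (hα' : ∀ i, α i ≤ r) (hβ : ∀ j, (β j : ℝ) ≤ r) :
    (((d₁ + d₂ : ℕ) + 1) * r) ^ s * Real.sqrt (boxVol α β) ≤ bracketNorm s (box α β) := by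
  have hc := isCompact_box α β
  have h0 : (0 : ℝ) < ((d₁ + d₂ : ℕ) + 1) * r := by positivity
  have h1 := Real.rpow_nonneg h0.le s
  rw [bracketNorm, ← Real.sqrt_sq h1, ← Real.sqrt_mul (sq_nonneg _)]
  refine Real.sqrt_le_sqrt ?_
  calc _ ≤ ((((d₁ + d₂ : ℕ) + 1) * r) ^ s) ^ 2 * (freqMeasure d₁ d₂).real (box α β) := by
        gcongr
        exact boxVol_le_freqMeasure_real hα
    _ = ∫ _ξ in box α β, ((((d₁ + d₂ : ℕ) + 1) * r) ^ s) ^ 2 ∂freqMeasure d₁ d₂ := by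
        rw [setIntegral_const, smul_eq_mul, mul_comm]
    _ ≤ _ := by
        refine setIntegral_mono_on (integrableOn_const hc.measure_lt_top.ne)
          ((continuous_bracket_rpow _).continuousOn.integrableOn_compact hc) hc.measurableSet fun ξ hξ => ?_
        rw [← Real.rpow_natCast, ← Real.rpow_mul h0.le, mul_comm s]
        exact Real.rpow_le_rpow_of_nonpos (bracket_pos ξ) (bracket_le_of_mem_box hr hα' hβ hξ)
          (by norm_num; linarith)

end Norms

section Cubes

variable (d₁ d₂ : ℕ)

/-- The cube of half side `A`. -/
def cube (A : ℕ) : Set (Freq d₁ d₂) := box (fun _ => (A : ℝ)) fun _ => A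

/-- The volume of a cube, up to a constant factor. -/
def cubeVol (A : ℕ) : ℝ := boxVol (fun _ : Fin d₁ => (A : ℝ)) fun _ : Fin d₂ => A

variable {d₁ d₂}

theorem cubeVol_eq (A : ℕ) : cubeVol d₁ d₂ A = (A : ℝ) ^ d₁ * ((A : ℝ) + 1) ^ d₂ := by
  simp [cubeVol, boxVol]

theorem pow_le_cubeVol (A : ℕ) : (A : ℝ) ^ (d₁ + d₂) ≤ cubeVol d₁ d₂ A := by
  rw [cubeVol_eq, pow_add]
  gcongr
  linarith

theorem cubeVol_le {A : ℕ} (hA : 1 ≤ A) : cubeVol d₁ d₂ A ≤ 2 ^ (d₁ + d₂) * (A : ℝ) ^ (d₁ + d₂) := by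
  have h : (1 : ℝ) ≤ A := by exact_mod_cast hA
  rw [cubeVol_eq, ← mul_pow, pow_add]
  gcongr <;> linarith

theorem cubeVol_pos {A : ℕ} (hA : 1 ≤ A) : 0 < cubeVol d₁ d₂ A :=
  boxVol_pos (fun _ => by exact_mod_cast hA) _

theorem mem_cube {A : ℕ} {ξ : Freq d₁ d₂} : ξ ∈ cube d₁ d₂ A ↔ ∀ c, |coord c ξ| ≤ A := by
  rw [cube, mem_box, Sum.forall]
  refine and_congr Iff.rfl (forall_congr' fun j => ?_)
  simp only [coord]
  exact_mod_cast Iff.rfl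

theorem isCompact_cube (A : ℕ) : IsCompact (cube d₁ d₂ A) := isCompact_box _ _

/-- The translate of the cube by 3A in one direction lies in the cube of half side 4A and is
disjoint from the original one. On it ⟨ξ⟩^{-d} is at least of order A^{-d} and its volume is at
least A^d, so every enlargement by 4 adds a fixed amount of mass. -/
theorem integral_cube_add_le (c : Fin d₁ ⊕ Fin d₂) {A : ℕ} (hA : 1 ≤ A) :
    (∫ ξ in cube d₁ d₂ A, bracket ξ ^ (-((d₁ + d₂ : ℕ) : ℝ)) ∂freqMeasure d₁ d₂) +
        (4 * (((d₁ + d₂ : ℕ) : ℝ) + 1)) ^ (-((d₁ + d₂ : ℕ) : ℝ)) ≤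
      ∫ ξ in cube d₁ d₂ (4 * A), bracket ξ ^ (-((d₁ + d₂ : ℕ) : ℝ)) ∂freqMeasure d₁ d₂ := by
  set D : ℝ := ((d₁ + d₂ : ℕ) : ℝ) with hD
  have hA' : (1 : ℝ) ≤ A := by exact_mod_cast hA
  set η : Freq d₁ d₂ := ((3 * A : ℕ) : ℤ) • basisFreq c with hη
  set E : Set (Freq d₁ d₂) := (fun ξ => ξ - η) ⁻¹' cube d₁ d₂ A with hE
  have hηc : ∀ c', coord c' η = if c' = c then 3 * (A : ℝ) else 0 := fun c' => by
    rw [hη, coord_zsmul_basisFreq]; push_cast; rfl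
  have hEm : MeasurableSet E := (isCompact_cube A).measurableSet.preimage (by fun_prop)
  have hEμ : freqMeasure d₁ d₂ E = freqMeasure d₁ d₂ (cube d₁ d₂ A) := by
    rw [hE]
    simp only [sub_eq_add_neg]
    exact measure_preimage_add_right _ _ _
  have hsub : E ⊆ cube d₁ d₂ (4 * A) := fun ξ hξ => mem_cube.2 fun c' => by
    have h1 := mem_cube.1 hξ c'
    dsimp only at h1
    rw [coord_sub, hηc] at h1
    rw [abs_le] at h1 ⊢
    push_cast
    split_ifs at h1 <;> constructor <;> linarith
  have hdisj : Disjoint (cube d₁ d₂ A) E := Set.disjoint_left.2 fun ξ h1 h2 => by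
    have h1 := abs_le.1 (mem_cube.1 h1 c)
    have h2 := abs_le.1 (mem_cube.1 h2 c)
    dsimp only at h2
    rw [coord_sub, hηc, if_pos rfl] at h2
    linarith
  have hcont := (continuous_bracket_rpow (d₁ := d₁) (d₂ := d₂) (-D)).continuousOn
    (s := cube d₁ d₂ (4 * A))
  have hint := hcont.integrableOn_compact (μ := freqMeasure d₁ d₂) (isCompact_cube (4 * A))
  have hsub' : cube d₁ d₂ A ⊆ cube d₁ d₂ (4 * A) := fun ξ hξ => mem_cube.2 fun c' => by
    refine (mem_cube.1 hξ c').trans ?_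
    push_cast; linarith
  have h2 : (4 * (D + 1)) ^ (-D) ≤ ∫ ξ in E, bracket ξ ^ (-D) ∂freqMeasure d₁ d₂ := by
    have hvol : (A : ℝ) ^ D ≤ (freqMeasure d₁ d₂).real E := by
      rw [measureReal_def, hEμ, ← measureReal_def, hD, Real.rpow_natCast]
      exact (pow_le_cubeVol A).trans (boxVol_le_freqMeasure_real fun _ => by positivity)
    have hfin : freqMeasure d₁ d₂ E ≠ ⊤ := by rw [hEμ]; exact (isCompact_cube A).measure_lt_top.ne
    calc (4 * (D + 1)) ^ (-D) = ((D + 1) * (4 * A : ℕ)) ^ (-D) * (A : ℝ) ^ D := by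
          have e : (D + 1) * ((4 * A : ℕ) : ℝ) = 4 * (D + 1) * A := by push_cast; ring
          have hA0 : (A : ℝ) ^ D ≠ 0 := by positivity
          rw [e, Real.mul_rpow (by positivity) (Nat.cast_nonneg A), Real.rpow_neg (Nat.cast_nonneg A) D,
            mul_assoc, inv_mul_cancel₀ hA0, mul_one]
      _ ≤ ((D + 1) * (4 * A : ℕ)) ^ (-D) * (freqMeasure d₁ d₂).real E := by gcongr
      _ = ∫ _ξ in E, ((D + 1) * (4 * A : ℕ)) ^ (-D) ∂freqMeasure d₁ d₂ := by
          rw [setIntegral_const, smul_eq_mul, mul_comm]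
      _ ≤ _ := by
          refine setIntegral_mono_on (integrableOn_const hfin) (hint.mono_set hsub) hEm fun ξ hξ => ?_
          refine Real.rpow_le_rpow_of_nonpos (bracket_pos ξ) ?_ (by rw [hD, Left.neg_nonpos_iff]; positivity)
          exact bracket_le_of_mem_box (by push_cast; linarith) (fun _ => le_rfl) (fun _ => le_rfl) (hsub hξ)
  calc _ ≤ (∫ ξ in cube d₁ d₂ A, bracket ξ ^ (-D) ∂freqMeasure d₁ d₂) +
        ∫ ξ in E, bracket ξ ^ (-D) ∂freqMeasure d₁ d₂ := by gcongr
    _ = ∫ ξ in cube d₁ d₂ A ∪ E, bracket ξ ^ (-D) ∂freqMeasure d₁ d₂ :=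
        (setIntegral_union hdisj hEm (hint.mono_set hsub') (hint.mono_set hsub)).symm
    _ ≤ _ := setIntegral_mono_set hint (ae_of_all _ fun ξ => Real.rpow_nonneg (bracket_pos ξ).le _)
        (LE.le.eventuallyLE (Set.union_subset hsub' hsub))

/-- At the critical exponent `-d/2` the norm of `⟨ξ⟩^s` over cubes diverges. -/
theorem tendsto_bracketNorm_cube (hd : 1 ≤ d₁ + d₂) :
    Tendsto (fun k : ℕ => bracketNorm (-((d₁ + d₂ : ℕ) : ℝ) / 2) (cube d₁ d₂ (4 ^ k))) atTop atTop := by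
  obtain ⟨c⟩ : Nonempty (Fin d₁ ⊕ Fin d₂) := by
    rw [← Fintype.card_pos_iff]
    rw [Fintype.card_sum, Fintype.card_fin, Fintype.card_fin]
    exact hd
  set κ : ℝ := (4 * (((d₁ + d₂ : ℕ) : ℝ) + 1)) ^ (-((d₁ + d₂ : ℕ) : ℝ))
  have hκ : 0 < κ := by positivity
  refine Real.tendsto_sqrt_atTop.comp ?_
  refine tendsto_atTop_mono (f := fun k : ℕ => (k : ℝ) * κ) (fun k => ?_)
    (tendsto_natCast_atTop_atTop.atTop_mul_const hκ)
  have e : 2 * (-((d₁ + d₂ : ℕ) : ℝ) / 2) = -((d₁ + d₂ : ℕ) : ℝ) := by ring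
  rw [e]
  induction k with
  | zero =>
    simp only [Nat.cast_zero, zero_mul]
    exact integral_nonneg fun ξ => Real.rpow_nonneg (bracket_pos ξ).le _
  | succ k ih =>
    have h := integral_cube_add_le (d₁ := d₁) (d₂ := d₂) c (A := 4 ^ k) (Nat.one_le_pow _ _ (by norm_num))
    rw [pow_succ']
    have e2 : ((k + 1 : ℕ) : ℝ) * κ = k * κ + κ := by push_cast; ring
    rw [e2]
    exact (by gcongr : _ ≤ _ + κ).trans h

end Cubes

/-! ### From a large second iterate to a large solution -/

section Inflating

variable {d₁ d₂ : ℕ}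

/-- If the second Picard iterate is large on a set disjoint from the support of the data, then so is the
solution. -/
theorem exists_solution_of_duhamel_lower {n : ℕ} (p q : Fin n → ℕ) (ν : Fin n → ℂ) (hp : ∀ j, 1 ≤ p j)
    (hq : ∀ j, q j ≤ p j) {R ω : ℝ} (hR : 0 ≤ R) (hω : 0 < ω) :
    ∃ ε : ℝ, 0 < ε ∧ ∀ {B m T Θ b s : ℝ} (g : Freq d₁ d₂ → ℂ) (E : Set (Freq d₁ d₂)),
      0 < B → 0 < m → 0 ≤ T → 0 < b → s ≤ 0 → 0 ≤ Θ → (∀ j, (B * m) ^ (p j - 1) ≤ Θ) → T * Θ ≤ ε →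
      Continuous g → HasCompactSupport g → (∀ ξ, ‖g ξ‖ ≤ R) →
      ∫ ξ, ‖g ξ‖ ∂scaledMeasure d₁ d₂ m ≤ R → (∀ ξ, g ξ ≠ 0 → b ≤ bracket ξ) → IsCompact E →
      (∀ ξ ∈ E, g ξ = 0) →
      (∀ ξ ∈ E, ω * (T * Θ) ≤ ‖∫ t in (0 : ℝ)..T, duhamelIntegrand m B p q ν g ξ t‖) →
      ∃ (φ : HInfty d₁ d₂) (u : ℝ → HInfty d₁ d₂), IsSmoothSolution (nonlinearity p q ν) φ T u ∧
        φ.sobolevNorm s ≤ B * b ^ s * R * Real.sqrt m ∧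
        B * (ω / 2 * (T * Θ)) * bracketNorm s E ≤ (u T).sobolevNorm s := by
  obtain ⟨P, hP⟩ : ∃ P, ∀ j, p j ≤ P := by
    obtain ⟨P, hP⟩ := (Set.finite_range p).bddAbove
    exact ⟨P, fun j => hP ⟨j, rfl⟩⟩
  set V : ℝ := ∑ j, ‖ν j‖ with hV
  have hV0 : 0 ≤ V := Finset.sum_nonneg fun _ _ => norm_nonneg _
  set X : ℝ := ((2 * R + 1) ^ (P + 1))⁻¹ with hX
  have hX0 : 0 < X := by positivity
  set Y : ℝ := (P + 1) * (2 * R + 1) ^ (2 * P + 1) with hY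
  have hY0 : 0 < Y := by positivity
  -- The first bound guarantees existence up to time T; the second makes the quadratic error Y(TΘV)²
  -- at most half of the main term ωTΘ.
  refine ⟨min (X / (V + 1)) (ω / (2 * (Y * (V + 1) ^ 2))), lt_min (by positivity) (by positivity), ?_⟩
  intro B m T Θ b s g E hB hm hT hb hs hΘ hMΘ hTΘ hg hgs hgR hgi hgb hE hgE hlow
  have hsize : interactionSize m B T p ν ≤ T * Θ * V := by
    rw [interactionSize, hV, mul_assoc]
    refine mul_le_mul_of_nonneg_left ?_ hT
    rw [Finset.mul_sum]
    refine Finset.sum_le_sum fun j _ => ?_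
    rw [mul_comm]
    exact mul_le_mul_of_nonneg_right (hMΘ j) (norm_nonneg _)
  have hsize0 : 0 ≤ interactionSize m B T p ν :=
    mul_nonneg hT (Finset.sum_nonneg fun j _ => by positivity)
  have h1 : T * Θ * (V + 1) ≤ X := by
    rw [← le_div_iff₀ (by positivity)]
    exact hTΘ.trans (min_le_left _ _)
  have h2 : T * Θ * (2 * (Y * (V + 1) ^ 2)) ≤ ω := by
    rw [← le_div_iff₀ (by positivity)]
    exact hTΘ.trans (min_le_right _ _)
  have hTΘ0 : 0 ≤ T * Θ := mul_nonneg hT hΘ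
  obtain ⟨φ, u, hφ, hu, herr⟩ := exists_smoothSolution p q ν hp hq hP hR hB hm hT hg hgs hgR hgi
    (hsize.trans (le_trans (by nlinarith) h1))
  refine ⟨φ, u, hu, sobolevNorm_le hs φ hB.le hb hR hm hφ hg hgs hgR hgi hgb,
    mul_bracketNorm_le_sobolevNorm s (u T) (by positivity) hE fun ξ hξ => ?_⟩
  have h3 := herr ξ
  have h4 := hlow ξ hξ
  -- On E the linear evolution vanishes, so the integral of the Duhamel term is all that is left
  -- besides the error.
  rw [hgE ξ hξ, zero_add] at h3
  set I := ∫ t in (0 : ℝ)..T, duhamelIntegrand m B p q ν g ξ t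
  have h5 : ‖(B : ℂ) * Complex.exp (-(T * normSq ξ : ℝ) * Complex.I) * I‖ = B * ‖I‖ := by
    rw [norm_mul, norm_mul, norm_exp_neg_ofReal_mul_I, Complex.norm_real, Real.norm_of_nonneg hB.le, mul_one]
  have h6 := norm_sub_norm_le ((B : ℂ) * Complex.exp (-(T * normSq ξ : ℝ) * Complex.I) * I)
    ((B : ℂ) * Complex.exp (-(T * normSq ξ : ℝ) * Complex.I) * I - (u T).hat ξ)
  rw [sub_sub_cancel, h5, norm_sub_rev (_ * I)] at h6
  have h7 : Y * interactionSize m B T p ν ^ 2 ≤ ω / 2 * (T * Θ) := by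
    calc _ ≤ Y * (T * Θ * V) ^ 2 := by gcongr
      _ ≤ Y * (T * Θ * (V + 1)) ^ 2 := by gcongr; linarith
      _ = (T * Θ * (2 * (Y * (V + 1) ^ 2))) * (T * Θ / 2) := by ring
      _ ≤ ω * (T * Θ / 2) := by gcongr
      _ = _ := by ring
  have h8 : B * (Y * interactionSize m B T p ν ^ 2) ≤ B * (ω / 2 * (T * Θ)) := by gcongr
  have h9 : B * (ω * (T * Θ)) ≤ B * ‖I‖ := by gcongr
  linarith

end Inflating

/-- A nonzero trigonometric polynomial does not vanish identically on the unit circle. -/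
theorem exists_phase {n P : ℕ} {q : Fin n → ℕ} {J : Finset (Fin n)} (hq : ∀ j ∈ J, q j ≤ P)
    (hinj : ∀ i ∈ J, ∀ j ∈ J, q i = q j → i = j) (a : Fin n → ℂ) {j₀ : Fin n} (hj₀ : j₀ ∈ J)
    (ha : a j₀ ≠ 0) :
    ∃ z : ℂ, ‖z‖ = 1 ∧ ∑ j ∈ J, a j * (z ^ q j * starRingEnd ℂ z ^ (P - q j)) ≠ 0 := by
  by_contra! h
  -- On the unit circle, multiplication by z^P turns z^q z̄^{P-q} into z^{2q}. Distinct q give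
  -- distinct powers, so vanishing on the infinite circle would force every coefficient to be zero.
  set f : Polynomial ℂ := ∑ j ∈ J, Polynomial.monomial (2 * q j) (a j) with hf
  have hroot : ∀ z : Circle, f.IsRoot z := by
    intro z
    have hz : (z : ℂ) * starRingEnd ℂ (z : ℂ) = 1 := by
      rw [Complex.mul_conj, Circle.normSq_coe, Complex.ofReal_one]
    have h1 := congrArg (fun w => (z : ℂ) ^ P * w) (h z (Circle.norm_coe z))
    simp only [mul_zero] at h1
    rw [Polynomial.IsRoot.def, hf, Polynomial.eval_finsetSum, ← h1, Finset.mul_sum]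
    refine Finset.sum_congr rfl fun j hj => ?_
    rw [Polynomial.eval_monomial]
    have h2 : (z : ℂ) ^ P = (z : ℂ) ^ q j * (z : ℂ) ^ (P - q j) := by
      rw [← pow_add, Nat.add_sub_cancel' (hq j hj)]
    calc a j * (z : ℂ) ^ (2 * q j) = a j * (z : ℂ) ^ q j * (z : ℂ) ^ q j *
          ((z : ℂ) * starRingEnd ℂ (z : ℂ)) ^ (P - q j) := by rw [hz, one_pow]; ring
      _ = _ := by rw [mul_pow, h2]; ring
  have hinf : Set.Infinite {z : ℂ | f.IsRoot z} := by
    have : Infinite Circle := by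
      rw [Circle.argEquiv.infinite_iff]
      exact (Set.Ioc_infinite (by linarith [Real.pi_pos])).to_subtype
    have hr := Set.infinite_range_of_injective (f := fun z : Circle => (z : ℂ)) Circle.coe_injective
    exact hr.mono (Set.range_subset_iff.2 hroot)
  have h0 := Polynomial.eq_zero_of_infinite_isRoot f hinf
  have h1 : f.coeff (2 * q j₀) = a j₀ := by
    rw [hf, Polynomial.finsetSum_coeff, Finset.sum_eq_single j₀]
    · simp
    · intro j hj hne
      rw [Polynomial.coeff_monomial, if_neg]
      intro h2
      exact hne (hinj j hj j₀ hj₀ (by omega))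
    · exact fun h2 => absurd hj₀ h2
  rw [h0, Polynomial.coeff_zero] at h1
  exact ha h1.symm

section Duhamel

variable {d₁ d₂ : ℕ}

/-- The terms in J have the full size Θ, and their phases are frozen: |η|² is close to l on the
support of the datum and the output frequency is low. By `hL` the frozen contribution is constant in
time, so it integrates to T times itself. The phase errors in J and all terms outside J contribute
at most half of it, by the smallness of ε. -/
theorem le_norm_integral_duhamel {m : ℝ} [(scaledMeasure d₁ d₂ m).IsAddHaarMeasure] {n : ℕ}
    {p q : Fin n → ℕ} (ν : Fin n → ℂ) (hp : ∀ j, 1 ≤ p j) (hq : ∀ j, q j ≤ p j) {B T Θ ε R ω l : ℝ}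
    (hT : 0 ≤ T) (hM : 0 ≤ B * m) (hε : 0 ≤ ε) (hΘ : 0 ≤ Θ) {h : Freq d₁ d₂ → ℂ} (hh : Continuous h)
    (hhs : HasCompactSupport h)
    (hR : ‖Wiener.ofCompact (μ := scaledMeasure d₁ d₂ m) h hh hhs‖ ≤ R) {z : ℂ} (hz : ‖z‖ = 1)
    (hphase : ∀ η, h η ≠ 0 → T * |normSq η - l| ≤ ε) {ξ : Freq d₁ d₂} (hξ : T * normSq ξ ≤ ε)
    (J : Finset (Fin n)) (hJ : ∀ j ∈ J, (B * m) ^ (p j - 1) = Θ)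
    (hJ' : ∀ j ∉ J, (B * m) ^ (p j - 1) ≤ ε * Θ) (L : Fin n → ℂ)
    (hL : ∀ t : ℝ, ∀ j ∈ J, (z * Complex.exp (-(t * l : ℝ) * Complex.I)) ^ q j *
      starRingEnd ℂ (z * Complex.exp (-(t * l : ℝ) * Complex.I)) ^ (p j - q j) *
        Wiener.monomial (p j) (q j) (Wiener.ofCompact (μ := scaledMeasure d₁ d₂ m) h hh hhs) ξ = L j)
    (hmain : 2 * ω ≤ ‖∑ j ∈ J, ν j * L j‖) (hω : ε * ∑ j, ‖ν j‖ * ((p j + 2) * R ^ p j) ≤ ω) :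
    ω * (T * Θ) ≤ ‖∫ t in (0 : ℝ)..T, duhamelIntegrand m B p q ν (fun η => z * h η) ξ t‖ := by
  classical
  have hR0 : 0 ≤ R := (norm_nonneg _).trans hR
  have hg : Continuous fun η => z * h η := continuous_const.mul hh
  have hgs : HasCompactSupport fun η => z * h η := hhs.mul_left
  have hgx : Wiener.ofCompact (μ := scaledMeasure d₁ d₂ m) _ hg hgs =
      z • Wiener.ofCompact (μ := scaledMeasure d₁ d₂ m) h hh hhs := Wiener.ext fun η => rfl
  have hbound : ∀ t ∈ Set.Icc 0 T, ∀ r : ℝ, T * |r| ≤ ε → |t * r| ≤ ε := fun t ht r h => by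
    rw [abs_mul, abs_of_nonneg ht.1]
    exact (by gcongr; exact ht.2 : t * |r| ≤ T * |r|).trans h
  have hmainterm := norm_integral_duhamel_sub_le hg hgs hT hM p q ν ξ
    (fun j => if j ∈ J then L j else 0)
    (fun j => if j ∈ J then (p j + 1) * ε * R ^ p j else R ^ p j) (fun t ht j => by
      rw [hgx]
      split_ifs with hj
      · rw [← hL t j hj]
        refine Wiener.norm_monomial_evolution_sub_le (hp j) (hq j) hε hz hR
          (fun η hη => hbound t ht _ (hphase η hη)) (hbound t ht _ ?_)
        rwa [abs_of_nonneg (normSq_nonneg ξ)]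
      · rw [sub_zero, norm_mul, Complex.norm_exp_ofReal_mul_I, one_mul]
        refine (Wiener.norm_apply_le _ ξ).trans (Wiener.norm_monomial_le (hp j) _ ?_)
        refine (Wiener.norm_evolution_le _ _).trans ?_
        rwa [norm_smul, hz, one_mul])
  have hsum : ∑ j, -Complex.I * ν j * ((B * m : ℝ) : ℂ) ^ (p j - 1) * (if j ∈ J then L j else 0) =
      -Complex.I * Θ * ∑ j ∈ J, ν j * L j := by
    rw [Finset.mul_sum, ← Finset.sum_subset (Finset.subset_univ J) fun j _ hj => by simp [hj]]
    refine Finset.sum_congr rfl fun j hj => ?_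
    rw [if_pos hj, ← Complex.ofReal_pow, hJ j hj]
    ring
  have herr : ∑ j, ‖ν j‖ * (B * m) ^ (p j - 1) *
      (if j ∈ J then (p j + 1) * ε * R ^ p j else R ^ p j) ≤ Θ * ω := by
    calc _ ≤ ∑ j, Θ * (ε * (‖ν j‖ * ((p j + 2) * R ^ p j))) := by
          refine Finset.sum_le_sum fun j _ => ?_
          have h1 : 0 ≤ ‖ν j‖ * ε * Θ * R ^ p j := by positivity
          have h2 : 0 ≤ ‖ν j‖ * ε * Θ * R ^ p j * p j := by positivity
          split_ifs with hj
          · rw [hJ j hj]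
            nlinarith
          · calc _ ≤ ‖ν j‖ * (ε * Θ) * R ^ p j := by gcongr; exact hJ' j hj
              _ ≤ _ := by nlinarith
      _ = Θ * (ε * ∑ j, ‖ν j‖ * ((p j + 2) * R ^ p j)) := by rw [← Finset.mul_sum, ← Finset.mul_sum]
      _ ≤ _ := by gcongr
  rw [hsum] at hmainterm
  have h1 : ‖(T : ℂ) * (-Complex.I * Θ * ∑ j ∈ J, ν j * L j)‖ = T * (Θ * ‖∑ j ∈ J, ν j * L j‖) := by
    rw [norm_mul, norm_mul, norm_mul, norm_neg, Complex.norm_I, one_mul, Complex.norm_real,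
      Complex.norm_real, Real.norm_of_nonneg hT, Real.norm_of_nonneg hΘ]
  have h2 := norm_sub_norm_le ((T : ℂ) * (-Complex.I * Θ * ∑ j ∈ J, ν j * L j))
    (∫ t in (0 : ℝ)..T, duhamelIntegrand m B p q ν (fun η => z * h η) ξ t)
  rw [norm_sub_rev, h1] at h2
  have h3 : T * (Θ * (2 * ω)) ≤ T * (Θ * ‖∑ j ∈ J, ν j * L j‖) := by gcongr
  have h4 : T * ∑ j, ‖ν j‖ * (B * m) ^ (p j - 1) *
      (if j ∈ J then (p j + 1) * ε * R ^ p j else R ^ p j) ≤ T * (Θ * ω) := by gcongr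
  nlinarith

end Duhamel

section Bumps

variable {d₁ d₂ : ℕ} {α : Fin d₁ → ℝ} {β : Fin d₂ → ℕ}

/-- The sum of bumps as a complex-valued function. -/
def bumpSumC (α : Fin d₁ → ℝ) (β : Fin d₂ → ℕ) (S : Finset (Freq d₁ d₂)) (ξ : Freq d₁ d₂) : ℂ :=
  (bumpSum α β S ξ : ℂ)

theorem continuous_bumpSumC (S : Finset (Freq d₁ d₂)) : Continuous (bumpSumC α β S) :=
  Complex.continuous_ofReal.comp (continuous_bumpSum S)

theorem hasCompactSupport_bumpSumC (hα : ∀ i, 0 < α i) (S : Finset (Freq d₁ d₂)) :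
    HasCompactSupport (bumpSumC α β S) :=
  (hasCompactSupport_bumpSum hα S).comp_left Complex.ofReal_zero

theorem norm_bumpSumC (S : Finset (Freq d₁ d₂)) (ξ : Freq d₁ d₂) :
    ‖bumpSumC α β S ξ‖ = bumpSum α β S ξ := by
  rw [bumpSumC, Complex.norm_real, Real.norm_of_nonneg (bumpSum_nonneg S ξ)]

theorem norm_bumpSumC_le (S : Finset (Freq d₁ d₂)) (ξ : Freq d₁ d₂) :
    ‖bumpSumC α β S ξ‖ ≤ S.card * 4 ^ (d₁ + d₂) := by
  rw [norm_bumpSumC]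
  refine (bumpSum_le S ξ).trans (le_mul_of_one_le_right (Nat.cast_nonneg _) ?_)
  exact one_le_pow₀ (by norm_num)

theorem integral_norm_bumpSumC_le (hα : ∀ i, 0 < α i) (S : Finset (Freq d₁ d₂)) :
    ∫ ξ, ‖bumpSumC α β S ξ‖ ∂scaledMeasure d₁ d₂ (boxVol α β) ≤ S.card * 4 ^ (d₁ + d₂) := by
  simp only [norm_bumpSumC]
  exact integral_bumpSum_le hα S

/-- A sum of bumps as an element of the Wiener space. -/
def bumpWiener (hα : ∀ i, 0 < α i) (β : Fin d₂ → ℕ)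
    [(scaledMeasure d₁ d₂ (boxVol α β)).IsAddHaarMeasure] (S : Finset (Freq d₁ d₂)) :
    Wiener (scaledMeasure d₁ d₂ (boxVol α β)) :=
  Wiener.ofCompact (bumpSumC α β S) (continuous_bumpSumC S) (hasCompactSupport_bumpSumC hα S)

theorem norm_bumpWiener_le (hα : ∀ i, 0 < α i) [(scaledMeasure d₁ d₂ (boxVol α β)).IsAddHaarMeasure]
    (S : Finset (Freq d₁ d₂)) : ‖bumpWiener hα β S‖ ≤ S.card * 4 ^ (d₁ + d₂) :=
  Wiener.norm_le (by positivity) (norm_bumpSumC_le S) (integral_norm_bumpSumC_le hα S)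

theorem boxLower_bumpWiener (hα : ∀ i, 0 < α i) [(scaledMeasure d₁ d₂ (boxVol α β)).IsAddHaarMeasure]
    {S : Finset (Freq d₁ d₂)} {η : Freq d₁ d₂} (hη : η ∈ S) :
    BoxLower α β (bumpWiener hα β S) η :=
  ⟨bumpSum α β S, fun _ => rfl, bumpSum_nonneg S, fun _ hζ => one_le_bumpSum hα hη hζ⟩

theorem BoxLower.conjRefl [(scaledMeasure d₁ d₂ (boxVol α β)).IsAddHaarMeasure]
    {x : Wiener (scaledMeasure d₁ d₂ (boxVol α β))} {η : Freq d₁ d₂} (hx : BoxLower α β x η) :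
    BoxLower α β (Wiener.conjRefl x) (-η) := by
  obtain ⟨r, hr, hr0, hr1⟩ := hx
  refine ⟨fun ξ => r (-ξ), fun ξ => ?_, fun ξ => hr0 _, fun ζ hζ => ?_⟩
  · rw [Wiener.conjRefl_apply, hr, Complex.conj_ofReal]
  · have e : -(-η + ζ) = η + -ζ := by abel
    dsimp only
    rw [e]
    exact hr1 _ (neg_mem_box.2 hζ)

theorem bumpSum_neg {S : Finset (Freq d₁ d₂)} (hS : ∀ η ∈ S, -η ∈ S) (ξ : Freq d₁ d₂) :
    bumpSum α β S (-ξ) = bumpSum α β S ξ := by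
  unfold bumpSum
  refine Finset.sum_nbij' (fun η => -η) (fun η => -η) hS hS (by simp) (by simp) fun η _ => ?_
  rw [← bump_neg]
  congr 1
  abel

/-- Symmetric centres make the corresponding function on `Z` real. Complex conjugation then acts
trivially, and all monomials of one degree have the same Fourier transform. -/
theorem conjRefl_bumpWiener (hα : ∀ i, 0 < α i) [(scaledMeasure d₁ d₂ (boxVol α β)).IsAddHaarMeasure]
    {S : Finset (Freq d₁ d₂)} (hS : ∀ η ∈ S, -η ∈ S) :
    Wiener.conjRefl (bumpWiener hα β S) = bumpWiener hα β S := by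
  refine Wiener.ext fun ξ => ?_
  rw [Wiener.conjRefl_apply]
  change starRingEnd ℂ (bumpSum α β S (-ξ) : ℂ) = (bumpSum α β S ξ : ℂ)
  rw [Complex.conj_ofReal, bumpSum_neg hS]

end Bumps

/-- Pairs 1, -1 settle an even number of factors, and one triple 1, 1, -2 corrects the parity. The
triple is the reason for including the centres ±2N. -/
theorem exists_sum_eq_zero (n : ℕ) (hn : 1 ≤ n) :
    ∃ k : Fin (n + 1) → ℤ, (∀ i, k i = 1 ∨ k i = -1 ∨ k i = 2 ∨ k i = -2) ∧ ∑ i, k i = 0 := by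
  induction n using Nat.strong_induction_on with
  | _ n ih =>
    match n, hn with
    | 1, _ => exact ⟨![1, -1], by decide, by decide⟩
    | 2, _ => exact ⟨![1, 1, -2], by decide, by decide⟩
    | n + 3, _ =>
      obtain ⟨k, hk, hk0⟩ := ih (n + 1) (by omega) (by omega)
      refine ⟨Fin.cons 1 (Fin.cons (-1) k), fun i => ?_, ?_⟩
      · refine Fin.cases (by simp) (fun i => ?_) i
        refine Fin.cases (by simp) (fun i => ?_) i
        simpa using hk i
      · rw [Fin.sum_univ_succ, Fin.sum_univ_succ]
        simp only [Fin.cons_zero, Fin.cons_succ, hk0]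
        norm_num

/-! ### High-to-low interactions of the terms of top degree -/

section HighToLow

variable {d₁ d₂ : ℕ}

/-- The centres `±N e_c`, `±2N e_c`. -/
def symmetricCenters (c : Fin d₁ ⊕ Fin d₂) (N : ℕ) : Finset (Freq d₁ d₂) :=
  ({1, -1, 2, -2} : Finset ℤ).image fun k : ℤ => (k * (N : ℤ)) • basisFreq c

theorem mem_symmetricCenters {c : Fin d₁ ⊕ Fin d₂} {N : ℕ} {η : Freq d₁ d₂} :
    η ∈ symmetricCenters c N ↔ ∃ k : ℤ, (k = 1 ∨ k = -1 ∨ k = 2 ∨ k = -2) ∧ (k * (N : ℤ)) • basisFreq c = η := by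
  simp only [symmetricCenters, Finset.mem_image, Finset.mem_insert, Finset.mem_singleton]

theorem card_symmetricCenters_le (c : Fin d₁ ⊕ Fin d₂) (N : ℕ) : (symmetricCenters c N).card ≤ 4 :=
  Finset.card_image_le.trans (by decide)

theorem neg_mem_symmetricCenters {c : Fin d₁ ⊕ Fin d₂} {N : ℕ} {η : Freq d₁ d₂}
    (h : η ∈ symmetricCenters c N) : -η ∈ symmetricCenters c N := by
  obtain ⟨k, hk, rfl⟩ := mem_symmetricCenters.1 h
  refine mem_symmetricCenters.2 ⟨-k, by omega, ?_⟩
  rw [neg_mul, neg_smul]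

theorem le_abs_coord_of_mem_symmetricCenters {c : Fin d₁ ⊕ Fin d₂} {N : ℕ} {η : Freq d₁ d₂}
    (h : η ∈ symmetricCenters c N) :
    (N : ℝ) ≤ |coord c η| ∧ ∀ c', |coord c' η| ≤ 2 * N := by
  obtain ⟨k, hk, rfl⟩ := mem_symmetricCenters.1 h
  have hN : (0 : ℝ) ≤ N := Nat.cast_nonneg N
  simp only [coord_zsmul_basisFreq]
  push_cast
  constructor
  · rcases hk with rfl | rfl | rfl | rfl <;> simp [abs_mul] <;> linarith
  · intro c'
    split_ifs
    · rcases hk with rfl | rfl | rfl | rfl <;> simp [abs_mul] <;> linarith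
    · simp

/-- Each smallness condition has one purpose: `T * N ^ 2 ≤ ε` removes all oscillation, `1 ≤ ε * (B *
cubeVol d₁ d₂ A)` makes the degrees below P negligible, and the bound on T(Bm)^{P-1} keeps the
Picard expansion valid. The condition `16 * A ≤ N` separates the data from the output cube. -/
theorem exists_solution_high_to_low {n : ℕ} (p q : Fin n → ℕ) (ν : Fin n → ℂ)
    (hdistinct : Function.Injective fun j => (p j, q j)) (hp : ∀ j, 2 ≤ p j) (hq : ∀ j, q j ≤ p j)
    (hν : ∀ j, ν j ≠ 0) {P : ℕ} (hP : ∀ j, p j ≤ P) (hPj : ∃ j, p j = P) (c : Fin d₁ ⊕ Fin d₂) :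
    ∃ ε κ C : ℝ, 0 < ε ∧ 0 < κ ∧ 0 < C ∧ ∀ {A N : ℕ} {T B s : ℝ}, 1 ≤ A → 16 * A ≤ N → 0 < T → 0 < B →
      s ≤ 0 → T * N ^ 2 ≤ ε → 1 ≤ ε * (B * cubeVol d₁ d₂ A) → T * (B * cubeVol d₁ d₂ A) ^ (P - 1) ≤ ε →
      ∃ (φ : HInfty d₁ d₂) (u : ℝ → HInfty d₁ d₂), IsSmoothSolution (nonlinearity p q ν) φ T u ∧
        φ.sobolevNorm s ≤ C * (B * Real.sqrt (cubeVol d₁ d₂ A) * ((N : ℝ) / 2) ^ s) ∧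
        κ * (T * (B * cubeVol d₁ d₂ A) ^ (P - 1) * B * bracketNorm s (cube d₁ d₂ A)) ≤
          (u T).sobolevNorm s := by
  classical
  obtain ⟨j₀, hj₀⟩ := hPj
  have hp1 : ∀ j, 1 ≤ p j := fun j => one_le_two.trans (hp j)
  have hP2 : 2 ≤ P := hj₀ ▸ hp j₀
  set J : Finset (Fin n) := Finset.univ.filter fun j => p j = P with hJ
  have hJm : ∀ j, j ∈ J ↔ p j = P := fun j => by simp [hJ]
  obtain ⟨z, hz, hsum⟩ := exists_phase (P := P) (q := q) (J := J)
    (fun j hj => ((hJm j).1 hj) ▸ hq j) (fun i hi j hj h => hdistinct (by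
      simp only [(hJm i).1 hi, (hJm j).1 hj, h])) ν ((hJm j₀).2 hj₀) (hν j₀)
  set σ := ∑ j ∈ J, ν j * (z ^ q j * starRingEnd ℂ z ^ (P - q j)) with hσ
  set ω : ℝ := ‖σ‖ / 2 with hω
  have hω0 : 0 < ω := half_pos (norm_pos_iff.2 hsum)
  set R : ℝ := 4 * 4 ^ (d₁ + d₂) with hR
  have hR0 : 0 < R := by positivity
  obtain ⟨ε₁, hε₁, hsol⟩ := exists_solution_of_duhamel_lower (d₁ := d₁) (d₂ := d₂) p q ν hp1 hq hR0.le hω0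
  set V : ℝ := ∑ j, ‖ν j‖ * ((p j + 2) * R ^ p j) with hV
  have hV0 : 0 ≤ V := Finset.sum_nonneg fun j _ => by positivity
  set ε₂ : ℝ := ω / (V + 1) with hε₂
  have hε₂0 : 0 < ε₂ := by positivity
  set D : ℝ := ((d₁ + d₂ : ℕ) : ℝ) with hD
  have hD0 : 0 ≤ D := Nat.cast_nonneg _
  refine ⟨min (min ε₁ 1) (ε₂ / (9 * D + 1)), ω / 2, R, by positivity, by positivity, hR0, ?_⟩
  intro A N T B s hA hAN hT hB hs hTN hM hTM
  set m := cubeVol d₁ d₂ A with hm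
  have hm0 : 0 < m := cubeVol_pos hA
  set M := B * m with hMdef
  have hM0 : 0 < M := by positivity
  have hA' : (1 : ℝ) ≤ A := by exact_mod_cast hA
  have hAN' : 16 * (A : ℝ) ≤ N := by exact_mod_cast hAN
  have he1 : min (min ε₁ 1) (ε₂ / (9 * D + 1)) ≤ ε₁ := (min_le_left _ _).trans (min_le_left _ _)
  have he2 : min (min ε₁ 1) (ε₂ / (9 * D + 1)) ≤ 1 := (min_le_left _ _).trans (min_le_right _ _)
  have he3 : min (min ε₁ 1) (ε₂ / (9 * D + 1)) ≤ ε₂ / (9 * D + 1) := min_le_right _ _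
  set ε := min (min ε₁ 1) (ε₂ / (9 * D + 1))
  have he4 : ε * (9 * D + 1) ≤ ε₂ := by rwa [← le_div_iff₀ (by positivity)]
  -- Positivity can be read off from `hM`: a nonpositive ε could not satisfy 1 ≤ εM.
  have he0 : 0 < ε := by
    by_contra! h
    have := mul_nonneg (neg_nonneg.2 h) hM0.le
    linarith
  have he5 : ε ≤ ε₂ := le_trans (by nlinarith) he4
  have hM1 : 1 ≤ M := hM.trans (mul_le_of_le_one_left hM0.le he2)
  have hα : ∀ _i : Fin d₁, (0 : ℝ) < A := fun _ => by linarith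
  have hHaar : (scaledMeasure d₁ d₂ (boxVol (fun _ : Fin d₁ => (A : ℝ)) fun _ : Fin d₂ => A)).IsAddHaarMeasure :=
    isAddHaarMeasure_scaledMeasure hm0
  have hHaar' : (scaledMeasure d₁ d₂ m).IsAddHaarMeasure := hHaar
  set S := symmetricCenters c N with hS
  have hcard : (S.card : ℝ) * 4 ^ (d₁ + d₂) ≤ R := by
    rw [hR]
    gcongr
    exact_mod_cast card_symmetricCenters_le c N
  set h := bumpSumC (fun _ : Fin d₁ => (A : ℝ)) (fun _ : Fin d₂ => A) S with hh
  have hsupp : ∀ ξ, h ξ ≠ 0 → ∃ η ∈ S, ∀ c', |coord c' (ξ - η)| ≤ 2 * A := fun ξ hξ => by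
    have h1 : bumpSum (fun _ : Fin d₁ => (A : ℝ)) (fun _ : Fin d₂ => A) S ξ ≠ 0 := by
      rintro h0
      exact hξ (by rw [hh, bumpSumC, h0, Complex.ofReal_zero])
    obtain ⟨η, hη, h2⟩ := exists_of_bumpSum_ne_zero hα h1
    refine ⟨η, hη, coord_le_of_mem_box (fun i => ?_) (fun j => ?_) h2⟩
    · simp
    · linarith
  have hnormSq : ∀ ξ, h ξ ≠ 0 → normSq ξ ≤ 9 * D * N ^ 2 := fun ξ hξ => by
    obtain ⟨η, hη, h1⟩ := hsupp ξ hξ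
    have h2 : ∀ c', |coord c' ξ| ≤ 3 * N := fun c' => by
      have e : coord c' ξ = coord c' (ξ - η) + coord c' η := by rw [← coord_add, sub_add_cancel]
      rw [e]
      have := abs_add_le (coord c' (ξ - η)) (coord c' η)
      have := (le_abs_coord_of_mem_symmetricCenters hη).2 c'
      have := h1 c'
      linarith
    calc _ ≤ D * (3 * N) ^ 2 := normSq_le_of_coord_le h2
      _ = _ := by ring
  have hfar : ∀ ξ, h ξ ≠ 0 → (N : ℝ) / 2 ≤ |coord c ξ| := fun ξ hξ => by
    obtain ⟨η, hη, h1⟩ := hsupp ξ hξ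
    have h2 := (le_abs_coord_of_mem_symmetricCenters hη).1
    have h3 := h1 c
    have h4 := abs_sub_abs_le_abs_sub (coord c η) (coord c ξ)
    rw [abs_sub_comm, ← coord_sub] at h4
    linarith
  have hTN' : T * (9 * D * N ^ 2) ≤ ε₂ := by
    calc T * (9 * D * N ^ 2) = T * N ^ 2 * (9 * D) := by ring
      _ ≤ ε * (9 * D) := by gcongr
      _ ≤ ε₂ := le_trans (by linarith) he4
  set W := iterProd (fun a b => Wiener.star a b) (P - 1) fun _ : Fin (P - 1 + 1) => bumpWiener hα (fun _ => A) S
    with hW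
  have hmon : ∀ j, p j = P → Wiener.monomial (p j) (q j) (bumpWiener hα (fun _ => A) S) = W := by
    intro j hj
    rw [Wiener.monomial, hj, hW]
    congr 1
    funext i
    unfold factors
    rw [conjRefl_bumpWiener hα fun η hη => neg_mem_symmetricCenters hη, ite_self]
  -- One choice of P centres with sum zero suffices: all other contributions to the convolution are
  -- nonnegative.
  obtain ⟨k, hk, hk0⟩ := exists_sum_eq_zero (P - 1) (by omega)
  have hlower : BoxLower (fun _ => (A : ℝ)) (fun _ => A) W (∑ i, (k i * (N : ℤ)) • basisFreq c) :=
    BoxLower.iterProd hα (P - 1) _ _ fun i => boxLower_bumpWiener hα (mem_symmetricCenters.2 ⟨k i, hk i, rfl⟩)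
  rw [← Finset.sum_smul, ← Finset.sum_mul, hk0, zero_mul, zero_smul] at hlower
  obtain ⟨r, hr, -, hr1⟩ := hlower
  have hMΘ : ∀ j, M ^ (p j - 1) ≤ M ^ (P - 1) := fun j =>
    pow_le_pow_right₀ hM1 (Nat.sub_le_sub_right (hP j) 1)
  -- A lower degree loses at least one factor M ≥ 1/ε.
  have hMΘ' : ∀ j ∉ J, M ^ (p j - 1) ≤ ε * M ^ (P - 1) := fun j hj => by
    have h1 : p j ≠ P := fun h1 => hj ((hJm j).2 h1)
    have h2 := hP j
    calc M ^ (p j - 1) ≤ M ^ (P - 2) := pow_le_pow_right₀ hM1 (by omega)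
      _ ≤ ε * M * M ^ (P - 2) := le_mul_of_one_le_left (by positivity) hM
      _ = ε * M ^ (P - 1) := by
        rw [mul_assoc, ← pow_succ']
        congr 2
        omega
  obtain ⟨φ, u, hu, hφ, hout⟩ := hsol (B := B) (m := m) (T := T) (Θ := M ^ (P - 1)) (b := (N : ℝ) / 2) (s := s)
    (fun ξ => z * h ξ) (cube d₁ d₂ A) hB hm0 hT.le (by linarith) hs (by positivity) hMΘ (hTM.trans he1)
    (continuous_const.mul (continuous_bumpSumC S)) (hasCompactSupport_bumpSumC hα S).mul_left
    (fun ξ => by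
      rw [norm_mul, hz, one_mul]
      exact (norm_bumpSumC_le S ξ).trans hcard)
    (by
      simp only [norm_mul, hz, one_mul]
      exact (integral_norm_bumpSumC_le hα S).trans hcard)
    (fun ξ hξ => by
      have h1 := hfar ξ (right_ne_zero_of_mul hξ)
      refine h1.trans (Real.le_sqrt_of_sq_le ?_)
      have := coord_sq_le_normSq c ξ
      rw [sq_abs]
      linarith)
    (isCompact_cube A)
    (fun ξ hξ => by
      by_contra h1
      have h2 := hfar ξ (right_ne_zero_of_mul h1)
      have h3 := mem_cube.1 hξ c
      linarith)
    (fun ξ hξ => by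
      -- The choice l = 0 is admissible because T|η|² itself is small on the whole support.
      refine le_norm_integral_duhamel (ε := ε₂) (R := R) (l := 0) ν hp1 hq hT.le hM0.le hε₂0.le (by positivity)
        (continuous_bumpSumC S) (hasCompactSupport_bumpSumC hα S) ((norm_bumpWiener_le hα S).trans hcard) hz
        (fun η hη => ?_) ?_ J (fun j hj => by rw [(hJm j).1 hj])
        (fun j hj => (hMΘ' j hj).trans (by gcongr))
        (fun j => z ^ q j * starRingEnd ℂ z ^ (P - q j) * W ξ) (fun t j hj => ?_) ?_ ?_
      · rw [sub_zero, abs_of_nonneg (normSq_nonneg η)]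
        exact (by gcongr; exact hnormSq η hη : _ ≤ T * (9 * D * N ^ 2)).trans hTN'
      · refine le_trans ?_ hTN'
        gcongr
        have h1 := normSq_le_of_coord_le (mem_cube.1 hξ)
        have h2 : D * (A : ℝ) ^ 2 ≤ D * (N : ℝ) ^ 2 := by gcongr; linarith
        nlinarith [mul_nonneg hD0 (sq_nonneg (N : ℝ))]
      · have hj' := (hJm j).1 hj
        have e : z * Complex.exp (-((t * 0 : ℝ) : ℂ) * Complex.I) = z := by simp
        rw [e, ← hmon j hj', hj']
        rfl
      · have e : ∑ j ∈ J, ν j * (z ^ q j * starRingEnd ℂ z ^ (P - q j) * W ξ) = σ * W ξ := by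
          rw [hσ, Finset.sum_mul]
          exact Finset.sum_congr rfl fun j _ => by ring
        have h1 := hr1 ξ hξ
        rw [zero_add] at h1
        rw [e, norm_mul, hr, Complex.norm_real, hω]
        have h2 : (1 : ℝ) ≤ ‖r ξ‖ := h1.trans (le_abs_self _)
        nlinarith [norm_nonneg σ]
      · calc ε₂ * V ≤ ε₂ * (V + 1) := by gcongr; linarith
          _ = ω := by rw [hε₂]; field_simp)
  refine ⟨φ, u, hu, hφ.trans (le_of_eq (by ring)), le_trans (le_of_eq (by ring)) hout⟩

end HighToLow

/-! ### The self-interaction of one cluster through u ū -/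

section Resonant

variable {d₁ d₂ : ℕ}

theorem conv_eq_zero_of_coord {μ : Measure (Freq d₁ d₂)} {f g : Freq d₁ d₂ → ℂ} (c : Fin d₁ ⊕ Fin d₂)
    {a b r r' : ℝ} (hf : ∀ ξ, f ξ ≠ 0 → |coord c ξ - a| ≤ r) (hg : ∀ ξ, g ξ ≠ 0 → |coord c ξ - b| ≤ r')
    {ξ : Freq d₁ d₂} (hξ : r + r' < |coord c ξ - (a + b)|) : conv μ f g ξ = 0 := by
  rw [conv_apply]
  refine integral_eq_zero_of_ae (ae_of_all _ fun t => ?_)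
  by_contra h
  have h1 := hf t (left_ne_zero_of_mul h)
  have h2 := hg _ (right_ne_zero_of_mul h)
  rw [coord_sub] at h2
  have h3 := abs_add_le (coord c t - a) (coord c ξ - coord c t - b)
  have e : coord c t - a + (coord c ξ - coord c t - b) = coord c ξ - (a + b) := by ring
  rw [e] at h3
  linarith

/-- The high-to-low interaction of a single frequency cluster with itself through a term `u ū`. -/
theorem exists_solution_resonant {n : ℕ} (p q : Fin n → ℕ) (ν : Fin n → ℂ)
    (hdistinct : Function.Injective fun j => (p j, q j)) (hp : ∀ j, 2 ≤ p j) (hq : ∀ j, q j ≤ p j)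
    (hν : ∀ j, ν j ≠ 0) {j₀ : Fin n} (hpj : p j₀ = 2) (hqj : q j₀ = 1) (c : Fin d₁ ⊕ Fin d₂) :
    ∃ ε κ C : ℝ, 0 < ε ∧ 0 < κ ∧ 0 < C ∧ ∀ {α : Fin d₁ → ℝ} {A : ℝ} {N : ℕ} {T B s : ℝ},
      (∀ i, 0 < α i) → (∀ i, α i ≤ 1) → 0 ≤ A →
      (∀ ζ ∈ box (2 • α) (fun _ : Fin d₂ => 0), |coord c ζ| ≤ 2 * A) → 8 ≤ N → 0 < T → 0 < B →
      s ≤ 0 → T * (N * A + 1) ≤ ε → T * (B * boxVol α fun _ : Fin d₂ => 0) ≤ ε →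
      ((∀ j, p j ≤ 2) ∨ B * boxVol α (fun _ : Fin d₂ => 0) ≤ ε) →
      ∃ (φ : HInfty d₁ d₂) (u : ℝ → HInfty d₁ d₂), IsSmoothSolution (nonlinearity p q ν) φ T u ∧
        φ.sobolevNorm s ≤ C * (B * Real.sqrt (boxVol α fun _ : Fin d₂ => 0) * ((N : ℝ) / 2) ^ s) ∧
        κ * (T * (B * boxVol α fun _ : Fin d₂ => 0) * B * bracketNorm s (box α fun _ : Fin d₂ => 0)) ≤
          (u T).sobolevNorm s := by
  classical
  have hp1 : ∀ j, 1 ≤ p j := fun j => one_le_two.trans (hp j)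
  set J : Finset (Fin n) := Finset.univ.filter fun j => p j = 2 with hJ
  have hJm : ∀ j, j ∈ J ↔ p j = 2 := fun j => by simp [hJ]
  set ω : ℝ := ‖ν j₀‖ / 2 with hω
  have hω0 : 0 < ω := half_pos (norm_pos_iff.2 (hν j₀))
  set R : ℝ := 4 ^ (d₁ + d₂) with hR
  have hR0 : 0 < R := by positivity
  obtain ⟨ε₁, hε₁, hsol⟩ := exists_solution_of_duhamel_lower (d₁ := d₁) (d₂ := d₂) p q ν hp1 hq hR0.le hω0
  set V : ℝ := ∑ j, ‖ν j‖ * ((p j + 2) * R ^ p j) with hV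
  have hV0 : 0 ≤ V := Finset.sum_nonneg fun j _ => by positivity
  set ε₂ : ℝ := ω / (V + 1) with hε₂
  have hε₂0 : 0 < ε₂ := by positivity
  set D : ℝ := ((d₁ + d₂ : ℕ) : ℝ) with hD
  have hD0 : 0 ≤ D := Nat.cast_nonneg _
  refine ⟨min (min ε₁ 1) (ε₂ / (4 * D + 4)), ω / 2, R, by positivity, by positivity, hR0, ?_⟩
  intro α A N T B s hα hα1 hA0 hA hN hT hB hs hTN hTM hM
  set m := boxVol α fun _ : Fin d₂ => 0 with hm
  have hm0 : 0 < m := boxVol_pos hα _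
  set M := B * m with hMdef
  have hM0 : 0 < M := by positivity
  have hN' : (8 : ℝ) ≤ N := by exact_mod_cast hN
  have he1 : min (min ε₁ 1) (ε₂ / (4 * D + 4)) ≤ ε₁ := (min_le_left _ _).trans (min_le_left _ _)
  have he2 : min (min ε₁ 1) (ε₂ / (4 * D + 4)) ≤ 1 := (min_le_left _ _).trans (min_le_right _ _)
  have he3 : min (min ε₁ 1) (ε₂ / (4 * D + 4)) ≤ ε₂ / (4 * D + 4) := min_le_right _ _
  set ε := min (min ε₁ 1) (ε₂ / (4 * D + 4))
  have he4 : ε * (4 * D + 4) ≤ ε₂ := by rwa [← le_div_iff₀ (by positivity)]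
  have he0 : 0 < ε := lt_of_lt_of_le (by positivity) hTN
  have he5 : ε ≤ ε₂ := le_trans (by nlinarith) he4
  have hHaar : (scaledMeasure d₁ d₂ (boxVol α fun _ : Fin d₂ => 0)).IsAddHaarMeasure :=
    isAddHaarMeasure_scaledMeasure hm0
  have hHaar' : (scaledMeasure d₁ d₂ m).IsAddHaarMeasure := hHaar
  set S : Finset (Freq d₁ d₂) := {(N : ℤ) • basisFreq c} with hS
  have hcard : (S.card : ℝ) * 4 ^ (d₁ + d₂) ≤ R := by simp [hS, hR]
  set h := bumpSumC α (fun _ : Fin d₂ => 0) S with hh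
  have hsupp : ∀ ξ, h ξ ≠ 0 → ∃ ζ ∈ box (2 • α) (fun _ : Fin d₂ => 0), (N : ℤ) • basisFreq c + ζ = ξ :=
    fun ξ hξ => by
      have h1 : bumpSum α (fun _ : Fin d₂ => 0) S ξ ≠ 0 := by
        rintro h0
        exact hξ (by rw [hh, bumpSumC, h0, Complex.ofReal_zero])
      obtain ⟨η, hη, h2⟩ := exists_of_bumpSum_ne_zero hα h1
      rw [hS, Finset.mem_singleton] at hη
      exact ⟨ξ - η, h2, by rw [← hη, add_sub_cancel]⟩
  have hbox2 : ∀ ζ ∈ box (2 • α) (fun _ : Fin d₂ => 0), ∀ c', |coord c' ζ| ≤ 2 := fun ζ hζ =>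
    coord_le_of_mem_box (fun i => by simpa using hα1 i) (fun j => by simp) hζ
  have hbox1 : ∀ ζ ∈ box α (fun _ : Fin d₂ => 0), ∀ c', |coord c' ζ| ≤ 1 := fun ζ hζ =>
    coord_le_of_mem_box hα1 (fun j => by simp) hζ
  have hcoord : ∀ ξ, h ξ ≠ 0 → |coord c ξ - N| ≤ 2 := fun ξ hξ => by
    obtain ⟨ζ, hζ, rfl⟩ := hsupp ξ hξ
    rw [coord_add, coord_zsmul_basisFreq, if_pos rfl, Int.cast_natCast, add_sub_cancel_left]
    exact hbox2 ζ hζ c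
  have hfar : ∀ ξ, h ξ ≠ 0 → (N : ℝ) / 2 ≤ coord c ξ := fun ξ hξ => by
    have := abs_le.1 (hcoord ξ hξ)
    linarith
  set x := bumpWiener hα (fun _ : Fin d₂ => 0) S with hx
  have hcoord' : ∀ ξ, Wiener.conjRefl x ξ ≠ 0 → |coord c ξ - -N| ≤ 2 := fun ξ hξ => by
    have h1 : h (-ξ) ≠ 0 := fun h0 => hξ (by
      rw [Wiener.conjRefl_apply]
      change starRingEnd ℂ (h (-ξ)) = 0
      rw [h0, map_zero])
    have h2 := hcoord _ h1
    rw [coord_neg] at h2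
    rw [← abs_neg]
    refine le_trans (le_of_eq ?_) h2
    congr 1; ring
  -- The centre N of the cluster and the centre -N of its conjugate cancel, so the output sits
  -- around the origin.
  have hlower : BoxLower α (fun _ => 0) (Wiener.star x (Wiener.conjRefl x)) 0 := by
    have h1 : BoxLower α (fun _ => 0) x ((N : ℤ) • basisFreq c) :=
      boxLower_bumpWiener hα (Finset.mem_singleton_self _)
    have h2 := h1.star hα h1.conjRefl
    rwa [add_neg_cancel] at h2
  obtain ⟨r, hr, -, hr1⟩ := hlower
  -- Higher degrees are harmless either because there are none or because M is small.
  have hMΘ : ∀ j, M ^ (p j - 1) ≤ M := fun j => by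
    have h2 := hp j
    rcases hM with hM | hM
    · have h1 := hM j
      rw [show p j - 1 = 1 by omega, pow_one]
    · exact pow_le_of_le_one hM0.le (hM.trans he2) (by omega)
  have hMΘ' : ∀ j ∉ J, M ^ (p j - 1) ≤ ε * M := fun j hj => by
    have h1 : p j ≠ 2 := fun h1 => hj ((hJm j).2 h1)
    have h2 := hp j
    rcases hM with hM | hM
    · have h3 := hM j
      omega
    · calc M ^ (p j - 1) = M ^ (p j - 2) * M := by rw [← pow_succ]; congr 1; omega
        _ ≤ M * M := by
          gcongr
          exact pow_le_of_le_one hM0.le (hM.trans he2) (by omega)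
        _ ≤ ε * M := by gcongr
  obtain ⟨φ, u, hu, hφ, hout⟩ := hsol (B := B) (m := m) (T := T) (Θ := M) (b := (N : ℝ) / 2) (s := s)
    (fun ξ => 1 * h ξ) (box α fun _ => 0) hB hm0 hT.le (by linarith) hs (by positivity) hMΘ (hTM.trans he1)
    (continuous_const.mul (continuous_bumpSumC S)) (hasCompactSupport_bumpSumC hα S).mul_left
    (fun ξ => by
      rw [one_mul]
      exact (norm_bumpSumC_le S ξ).trans hcard)
    (by
      simp only [one_mul]
      exact (integral_norm_bumpSumC_le hα S).trans hcard)
    (fun ξ hξ => by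
      have h1 := hfar ξ (right_ne_zero_of_mul hξ)
      refine h1.trans (Real.le_sqrt_of_sq_le ?_)
      have := coord_sq_le_normSq c ξ
      linarith)
    (isCompact_box _ _)
    (fun ξ hξ => by
      by_contra h1
      have h2 := hfar ξ (right_ne_zero_of_mul h1)
      have h3 := abs_le.1 (hbox1 ξ hξ c)
      linarith)
    (fun ξ hξ => by
      have hξc := abs_le.1 (hbox1 ξ hξ c)
      -- Here TN² may be large. The common phase e^{-itN²} has modulus one and cancels in u ū, so
      -- only the deviation 2Nζ_c + |ζ|² of |ξ|² from N² has to be small against 1/T.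
      refine le_norm_integral_duhamel (ε := ε₂) (R := R) (l := (N : ℝ) ^ 2) ν hp1 hq hT.le hM0.le hε₂0.le hM0.le
        (continuous_bumpSumC S) (hasCompactSupport_bumpSumC hα S) ((norm_bumpWiener_le hα S).trans hcard)
        norm_one (fun η hη => ?_) ?_ J (fun j hj => by rw [(hJm j).1 hj, Nat.add_one_sub_one, pow_one])
        (fun j hj => (hMΘ' j hj).trans (by gcongr))
        (fun j => if q j = 1 then (r ξ : ℂ) else 0) (fun t j hj => ?_) ?_ ?_
      · obtain ⟨ζ, hζ, rfl⟩ := hsupp η hη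
        have h1 := normSq_le_of_coord_le (hbox2 ζ hζ)
        have h2 := normSq_nonneg ζ
        have h3 : |2 * (N : ℝ) * coord c ζ| ≤ 4 * (N * A) := by
          rw [abs_mul, abs_of_nonneg (by positivity)]
          have := mul_le_mul_of_nonneg_left (hA ζ hζ) (by positivity : (0 : ℝ) ≤ 2 * N)
          linarith
        calc T * |normSq ((N : ℤ) • basisFreq c + ζ) - N ^ 2| ≤ T * (4 * (N * A) + D * 2 ^ 2) := by
              gcongr
              rw [normSq_zsmul_add, Int.cast_natCast, add_assoc, add_sub_cancel_left]
              refine (abs_add_le _ _).trans (add_le_add h3 ?_)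
              rwa [abs_of_nonneg h2]
          _ ≤ T * (N * A + 1) * (4 * D + 4) := by
              rw [mul_assoc]
              gcongr
              have : 0 ≤ (N : ℝ) * A := by positivity
              nlinarith
          _ ≤ ε * (4 * D + 4) := by gcongr
          _ ≤ ε₂ := he4
      · have h1 := normSq_le_of_coord_le (hbox1 ξ hξ)
        have h2 : T ≤ ε := le_trans (le_mul_of_one_le_right hT.le (by
          have : 0 ≤ (N : ℝ) * A := by positivity
          linarith)) hTN
        have h3 := normSq_nonneg ξ
        calc T * normSq ξ ≤ ε * (D * 1 ^ 2) := by gcongr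
          _ ≤ ε * (4 * D + 4) := by gcongr; linarith
          _ ≤ ε₂ := he4
      · have hj2 := (hJm j).1 hj
        have hqj2 := hq j
        rw [hj2] at hqj2
        rw [hj2]
        -- The products ū² and u² live near -2N and 2N and vanish on the low box; only u ū
        -- contributes there.
        interval_cases hqv : q j
        · have h0 : Wiener.monomial 2 0 x ξ = 0 := by
            change Wiener.star (Wiener.conjRefl x) (Wiener.conjRefl x) ξ = 0
            rw [Wiener.coe_star]
            refine conv_eq_zero_of_coord c hcoord' hcoord' (lt_of_lt_of_le ?_ (le_abs_self _))
            linarith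
          exact (congrArg _ h0).trans (by simp)
        · have h1 : Wiener.monomial 2 1 x ξ = r ξ := hr ξ
          refine (congrArg _ h1).trans ?_
          rw [if_pos rfl, one_mul, pow_one, pow_one, Complex.mul_conj, Complex.normSq_eq_norm_sq,
            norm_exp_neg_ofReal_mul_I]
          simp
        · have h0 : Wiener.monomial 2 2 x ξ = 0 := by
            change Wiener.star x x ξ = 0
            rw [Wiener.coe_star]
            refine conv_eq_zero_of_coord c hcoord hcoord (lt_of_lt_of_le ?_ (neg_le_abs _))
            linarith
          exact (congrArg _ h0).trans (by simp)
      · have e : ∑ j ∈ J, ν j * (if q j = 1 then (r ξ : ℂ) else 0) = ν j₀ * r ξ := by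
          rw [Finset.sum_eq_single j₀, if_pos hqj]
          · intro j hj hne
            rw [if_neg, mul_zero]
            exact fun h1 => hne (hdistinct (by simp only [(hJm j).1 hj, h1, hpj, hqj]))
          · exact fun h1 => absurd ((hJm j₀).2 hpj) h1
        have h1 := hr1 ξ hξ
        rw [zero_add] at h1
        rw [e, norm_mul, Complex.norm_real, hω]
        have h2 : (1 : ℝ) ≤ ‖r ξ‖ := h1.trans (le_abs_self _)
        nlinarith [norm_nonneg (ν j₀)]
      · calc ε₂ * V ≤ ε₂ * (V + 1) := by gcongr; linarith
          _ = ω := by rw [hε₂]; field_simp)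
  refine ⟨φ, u, hu, hφ.trans (le_of_eq (by ring)), le_trans (le_of_eq (by ring)) hout⟩

end Resonant

/-! ### Trigonometric polynomials and quartic resonances on the circle -/

section Trigonometric

variable {ι : Type*} [Fintype ι]

/-- The Fourier transform of a trigonometric polynomial on the circle. -/
def trigHat (a : ι → ℂ) (k : ι → Freq 0 1) (ξ : Freq 0 1) : ℂ := ∑ i, if ξ = k i then a i else 0

theorem freqMeasure_singleton (k : Freq 0 1) : freqMeasure 0 1 {k} = 1 := by
  have h : ({k} : Set (Freq 0 1)) = Set.univ ×ˢ {k.2} := by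
    ext ξ
    simp only [Set.mem_singleton_iff, Set.mem_prod, Set.mem_univ, true_and]
    exact ⟨fun h => h ▸ rfl, fun h => Prod.ext (Subsingleton.elim _ _) h⟩
  rw [h, freqMeasure, Measure.prod_prod, Measure.count_singleton, mul_one,
    Measure.volume_pi_eq_dirac (x := default)]
  simp

theorem integral_ite_eq_mul (k : Freq 0 1) (c : ℂ) (f : Freq 0 1 → ℂ) :
    Integrable (fun t => (if t = k then c else 0) * f t) (freqMeasure 0 1) ∧
      ∫ t, (if t = k then c else 0) * f t ∂freqMeasure 0 1 = c * f k := by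
  have h : (fun t => (if t = k then c else 0) * f t) = ({k} : Set (Freq 0 1)).indicator fun _ => c * f k := by
    funext t
    by_cases ht : t = k
    · simp [ht]
    · simp [ht]
  rw [h]
  constructor
  · rw [integrable_indicator_iff (measurableSet_singleton k)]
    exact integrableOn_const (by rw [freqMeasure_singleton]; exact ENNReal.one_ne_top)
  · rw [integral_indicator_const _ (measurableSet_singleton k), measureReal_def, freqMeasure_singleton]
    simp

theorem conv_trigHat (a : ι → ℂ) (k : ι → Freq 0 1) (f : Freq 0 1 → ℂ) (ξ : Freq 0 1) :
    conv (freqMeasure 0 1) (trigHat a k) f ξ = ∑ i, a i * f (ξ - k i) := by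
  rw [conv_apply]
  simp only [trigHat, Finset.sum_mul]
  rw [integral_finsetSum _ fun i _ => (integral_ite_eq_mul (k i) (a i) fun t => f (ξ - t)).1]
  exact Finset.sum_congr rfl fun i _ => (integral_ite_eq_mul (k i) (a i) fun t => f (ξ - t)).2

theorem iterProd_trigHat (n : ℕ) (a : Fin (n + 1) → ι → ℂ) (k : Fin (n + 1) → ι → Freq 0 1)
    (ξ : Freq 0 1) :
    iterProd (conv (freqMeasure 0 1)) n (fun l => trigHat (a l) (k l)) ξ =
      ∑ τ : Fin (n + 1) → ι, if ξ = ∑ l, k l (τ l) then ∏ l, a l (τ l) else 0 := by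
  induction n generalizing ξ with
  | zero =>
    rw [iterProd, trigHat]
    exact (Fintype.sum_equiv (Equiv.funUnique (Fin 1) ι) _ _ fun τ => by simp).symm
  | succ n ih =>
    rw [iterProd, conv_trigHat, ← (Fin.consEquiv fun _ => ι).sum_comp, Fintype.sum_prod_type]
    refine Finset.sum_congr rfl fun i _ => ?_
    rw [ih, Finset.mul_sum]
    refine Finset.sum_congr rfl fun τ _ => ?_
    simp only [Fin.consEquiv_apply, Fin.sum_univ_succ (n := n + 1), Fin.prod_univ_succ (n := n + 1),
      Fin.cons_zero, Fin.cons_succ, sub_eq_iff_eq_add', mul_ite, mul_zero]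

theorem freeEvolution_trigHat (t : ℝ) (a : ι → ℂ) (k : ι → Freq 0 1) :
    freeEvolution t (trigHat a k) =
      trigHat (fun i => Complex.exp (-(t * normSq (k i) : ℝ) * Complex.I) * a i) k := by
  funext ξ
  rw [freeEvolution, trigHat, trigHat, Finset.mul_sum]
  refine Finset.sum_congr rfl fun i _ => ?_
  split_ifs with h
  · rw [h]
  · rw [mul_zero]

theorem reflConj_trigHat (a : ι → ℂ) (k : ι → Freq 0 1) :
    reflConj (trigHat a k) = trigHat (fun i => starRingEnd ℂ (a i)) fun i => -k i := by
  funext ξ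
  rw [reflConj, trigHat, trigHat, map_sum]
  refine Finset.sum_congr rfl fun i _ => ?_
  rw [apply_ite (starRingEnd ℂ), map_zero]
  simp only [neg_eq_iff_eq_neg]

theorem continuous_trigHat (a : ι → ℂ) (k : ι → Freq 0 1) : Continuous (trigHat a k) :=
  continuous_of_discreteTopology

theorem exists_of_trigHat_ne_zero {a : ι → ℂ} {k : ι → Freq 0 1} {ξ : Freq 0 1} (h : trigHat a k ξ ≠ 0) :
    ∃ i, ξ = k i := by
  by_contra! h1
  exact h (Finset.sum_eq_zero fun i _ => if_neg (h1 i))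

theorem hasCompactSupport_trigHat (a : ι → ℂ) (k : ι → Freq 0 1) : HasCompactSupport (trigHat a k) := by
  refine HasCompactSupport.intro (K := Set.range k) (Set.finite_range k).isCompact fun ξ hξ => ?_
  by_contra h
  obtain ⟨i, hi⟩ := exists_of_trigHat_ne_zero h
  exact hξ ⟨i, hi.symm⟩

theorem norm_trigHat_le {a : ι → ℂ} (ha : ∀ i, ‖a i‖ ≤ 1) (k : ι → Freq 0 1) (ξ : Freq 0 1) :
    ‖trigHat a k ξ‖ ≤ Fintype.card ι := by
  refine (norm_sum_le _ _).trans ?_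
  calc _ ≤ ∑ _i : ι, (1 : ℝ) := by
        refine Finset.sum_le_sum fun i _ => ?_
        split_ifs
        exacts [ha i, by simp]
    _ = _ := by simp

theorem integral_norm_trigHat_le {a : ι → ℂ} (ha : ∀ i, ‖a i‖ ≤ 1) (k : ι → Freq 0 1) :
    ∫ ξ, ‖trigHat a k ξ‖ ∂freqMeasure 0 1 ≤ Fintype.card ι := by
  have h1 : ∀ i, Integrable (fun ξ => if ξ = k i then a i else 0) (freqMeasure 0 1) := fun i => by
    simpa using (integral_ite_eq_mul (k i) (a i) fun _ => 1).1
  have h2 : ∀ i, ∫ ξ, ‖if ξ = k i then a i else 0‖ ∂freqMeasure 0 1 ≤ 1 := fun i => by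
    have h3 : (fun ξ => ‖if ξ = k i then a i else 0‖) =
        ({k i} : Set (Freq 0 1)).indicator fun _ => ‖a i‖ := by
      funext ξ
      by_cases h : ξ = k i <;> simp [h]
    rw [h3, integral_indicator_const _ (measurableSet_singleton _), measureReal_def,
      freqMeasure_singleton]
    simpa using ha i
  calc _ ≤ ∫ ξ, ∑ i, ‖if ξ = k i then a i else 0‖ ∂freqMeasure 0 1 :=
        integral_mono (integrable_finsetSum _ fun i _ => h1 i).norm
          (integrable_finsetSum _ fun i _ => (h1 i).norm) fun ξ => norm_sum_le _ _
    _ ≤ ∑ _i : ι, (1 : ℝ) := by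
        rw [integral_finsetSum _ fun i _ => (h1 i).norm]
        exact Finset.sum_le_sum fun i _ => h2 i
    _ = _ := by simp

end Trigonometric

section Resonances

/-- The profile of the three frequencies. -/
def profile : Fin 3 → ℤ := ![2, -1, 3]

/-- The sign of a factor of `u^q ū^(4-q)`. -/
def factorSign (q : ℕ) (l : Fin 4) : ℤ := if (l : ℕ) < q then 1 else -1

/-- The number of resonant interactions of four of the three frequencies. -/
def resonanceCount (q : ℕ) : ℕ :=
  (Finset.univ.filter fun τ : Fin 4 → Fin 3 => ∑ l, factorSign q l * profile (τ l) = 0 ∧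
    ∑ l, factorSign q l * profile (τ l) ^ 2 = 0).card

/-- The relations 2 + 2 - 1 = 3 and 4 + 4 + 1 = 9 give a resonance for q = 3, and their mirror image
one for q = 1. For q = 2 four equal frequencies are resonant. -/
theorem resonanceCount_pos {q : ℕ} (hq : q = 1 ∨ q = 2 ∨ q = 3) : 0 < resonanceCount q := by
  rw [resonanceCount, Finset.card_pos]
  rcases hq with rfl | rfl | rfl
  · exact ⟨![2, 0, 0, 1], by decide⟩
  · exact ⟨![0, 0, 0, 0], by decide⟩
  · exact ⟨![0, 0, 1, 2], by decide⟩

/-- The interval [0,T] contains a whole number of periods of every nonresonant phase, because r is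
an integer and TN² is a multiple of 2π. -/
theorem integral_exp_eq {T N : ℝ} {l : ℕ} (hN : N ≠ 0) (hT : T * N ^ 2 = 2 * Real.pi * l) (r : ℤ) :
    ∫ t in (0 : ℝ)..T, Complex.exp (-(t * (N ^ 2 * r) : ℝ) * Complex.I) =
      if r = 0 then (T : ℂ) else 0 := by
  split_ifs with hr
  · simp [hr]
  · have hc : (-(N ^ 2 * r : ℝ) * Complex.I : ℂ) ≠ 0 := by
      refine mul_ne_zero (neg_ne_zero.2 (Complex.ofReal_ne_zero.2 ?_)) Complex.I_ne_zero
      exact mul_ne_zero (pow_ne_zero _ hN) (Int.cast_ne_zero.2 hr)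
    have e : ∀ t : ℝ, Complex.exp (-(t * (N ^ 2 * r) : ℝ) * Complex.I) =
        Complex.exp ((-(N ^ 2 * r : ℝ) * Complex.I) * t) := fun t => by
      congr 1; push_cast; ring
    simp only [e]
    rw [integral_exp_mul_complex hc]
    have e2 : (-(N ^ 2 * r : ℝ) * Complex.I : ℂ) * T = ((-(l * r) : ℤ) : ℂ) * (2 * Real.pi * Complex.I) := by
      have h1 : (T : ℂ) * (N : ℂ) ^ 2 = 2 * Real.pi * l := by exact_mod_cast congrArg (fun x : ℝ => (x : ℂ)) hT
      push_cast
      linear_combination (-(r : ℂ) * Complex.I) * h1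
    rw [e2, Complex.exp_int_mul_two_pi_mul_I]
    simp

/-- The frequencies `2N`, `-N`, `3N`. -/
def torusCenters (N : ℕ) (i : Fin 3) : Freq 0 1 := (profile i * (N : ℤ)) • basisFreq (.inr 0)

theorem normSq_torusCenters (N : ℕ) (i : Fin 3) :
    normSq (torusCenters N i) = (N : ℝ) ^ 2 * ((profile i : ℝ) ^ 2) := by
  have h := normSq_zsmul_add (.inr 0 : Fin 0 ⊕ Fin 1) (profile i * (N : ℤ)) 0
  rw [add_zero] at h
  rw [torusCenters, h]
  simp [normSq, coord]
  ring

theorem factors_torus (q : ℕ) (t : ℝ) (z : ℂ) (N : ℕ) (l : Fin 4) :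
    factors reflConj q 3 (freeEvolution t (trigHat (fun _ => z) (torusCenters N))) l =
      trigHat (fun i => (if (l : ℕ) < q then z else starRingEnd ℂ z) *
        Complex.exp (((factorSign q l * profile i ^ 2 : ℤ) : ℂ) * (-(t * N ^ 2 : ℝ) * Complex.I)))
        fun i => (factorSign q l * profile i * (N : ℤ)) • basisFreq (.inr 0) := by
  have h1 : ∀ i, Complex.exp (-(t * normSq (torusCenters N i) : ℝ) * Complex.I) =
      Complex.exp (((profile i ^ 2 : ℤ) : ℂ) * (-(t * N ^ 2 : ℝ) * Complex.I)) := fun i => by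
    rw [normSq_torusCenters]
    congr 1
    push_cast; ring
  unfold factors factorSign
  rw [freeEvolution_trigHat]
  simp only [h1]
  split_ifs with h
  · simp only [one_mul, mul_comm z]
    rfl
  · rw [reflConj_trigHat]
    congr 1
    · funext i
      rw [map_mul, ← Complex.exp_conj, mul_comm]
      congr 2
      simp only [map_mul, map_neg, Complex.conj_ofReal, Complex.conj_I, map_intCast]
      push_cast
      ring
    · funext i
      rw [torusCenters, ← neg_smul]
      congr 1
      ring

theorem monomialHat_torus {q : ℕ} (hq : q ≤ 4) (t : ℝ) (z : ℂ) {N : ℕ} (hN : 1 ≤ N) :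
    monomialHat 1 4 q (freeEvolution t (trigHat (fun _ => z) (torusCenters N))) 0 =
      ∑ τ : Fin 4 → Fin 3, if ∑ l, factorSign q l * profile (τ l) = 0 then
        z ^ q * starRingEnd ℂ z ^ (4 - q) *
          Complex.exp (-(t * (N ^ 2 * (∑ l, factorSign q l * profile (τ l) ^ 2 : ℤ)) : ℝ) * Complex.I)
        else 0 := by
  have hμ : scaledMeasure 0 1 1 = freqMeasure 0 1 := by simp [scaledMeasure]
  rw [monomialHat, hμ]
  have h1 : factors reflConj q (4 - 1) (freeEvolution t (trigHat (fun _ => z) (torusCenters N))) =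
      fun l => _ := funext fun l => factors_torus q t z N l
  rw [h1]
  refine (iterProd_trigHat 3 _ _ 0).trans (Finset.sum_congr rfl fun τ _ => ?_)
  have h2 : (0 : Freq 0 1) = ∑ l, (factorSign q l * profile (τ l) * (N : ℤ)) • basisFreq (.inr 0) ↔
      ∑ l, factorSign q l * profile (τ l) = 0 := by
    rw [← Finset.sum_smul, ← Finset.sum_mul]
    constructor
    · intro h
      have h3 := congrArg (coord (.inr 0)) h
      rw [coord_zsmul_basisFreq, if_pos rfl] at h3
      have h4 : coord (.inr 0 : Fin 0 ⊕ Fin 1) 0 = 0 := by simp [coord]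
      rw [h4] at h3
      have h5 := Int.cast_eq_zero.1 h3.symm
      exact (mul_eq_zero.1 h5).resolve_right (by omega)
    · intro h
      rw [h, zero_mul, zero_smul]
  simp only [h2]
  refine if_congr Iff.rfl ?_ rfl
  rw [Finset.prod_mul_distrib]
  congr 1
  · exact prod_factors (starRingEnd ℂ) (n := 3) hq z
  · rw [← Complex.exp_sum, ← Finset.sum_mul]
    congr 1
    push_cast
    ring

theorem integral_monomialHat_torus {q : ℕ} (hq : q ≤ 4) (z : ℂ) {N l : ℕ} (hN : 1 ≤ N) {T : ℝ}
    (hT : T * (N : ℝ) ^ 2 = 2 * Real.pi * l) :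
    ∫ t in (0 : ℝ)..T, monomialHat 1 4 q (freeEvolution t (trigHat (fun _ => z) (torusCenters N))) 0 =
      T * (resonanceCount q * (z ^ q * starRingEnd ℂ z ^ (4 - q))) := by
  simp only [monomialHat_torus hq _ z hN]
  rw [intervalIntegral.integral_finsetSum]
  · rw [resonanceCount, Finset.card_filter, Nat.cast_sum, Finset.sum_mul, Finset.mul_sum]
    refine Finset.sum_congr rfl fun τ _ => ?_
    by_cases h : ∑ l, factorSign q l * profile (τ l) = 0
    · simp only [h, true_and, if_true]
      rw [intervalIntegral.integral_const_mul, integral_exp_eq (by positivity) hT]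
      split_ifs <;> simp
      ring
    · simp [h]
  · intro τ _
    split_ifs
    · exact Continuous.intervalIntegrable (by fun_prop) _ _
    · exact intervalIntegrable_const

end Resonances

theorem bracketNorm_singleton_zero (s : ℝ) : bracketNorm s {(0 : Freq 0 1)} = 1 := by
  have h : bracket (0 : Freq 0 1) = 1 := by simp [bracket, normSq]
  rw [bracketNorm, integral_singleton, measureReal_def, freqMeasure_singleton, h]
  simp

/-- Resonant quartic interactions of three frequencies on the circle. -/
theorem exists_solution_torus {n : ℕ} (p q : Fin n → ℕ) (ν : Fin n → ℂ)
    (hdistinct : Function.Injective fun j => (p j, q j)) (hp : ∀ j, 2 ≤ p j) (hq : ∀ j, q j ≤ p j)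
    (hν : ∀ j, ν j ≠ 0) (hP : ∀ j, p j ≤ 4) {j₀ : Fin n} (hpj : p j₀ = 4)
    (hqj : q j₀ = 1 ∨ q j₀ = 2 ∨ q j₀ = 3) :
    ∃ ε κ C : ℝ, 0 < ε ∧ 0 < κ ∧ 0 < C ∧ ∀ {N l : ℕ} {T B s : ℝ}, 1 ≤ N → 0 < T →
      T * (N : ℝ) ^ 2 = 2 * Real.pi * l → 0 < B → s ≤ 0 → 1 ≤ ε * B → T * B ^ 3 ≤ ε →
      ∃ (φ : HInfty 0 1) (u : ℝ → HInfty 0 1), IsSmoothSolution (nonlinearity p q ν) φ T u ∧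
        φ.sobolevNorm s ≤ C * (B * (N : ℝ) ^ s) ∧ κ * (T * B ^ 4) ≤ (u T).sobolevNorm s := by
  classical
  have hp1 : ∀ j, 1 ≤ p j := fun j => one_le_two.trans (hp j)
  set J : Finset (Fin n) := Finset.univ.filter fun j => p j = 4 with hJ
  have hJm : ∀ j, j ∈ J ↔ p j = 4 := fun j => by simp [hJ]
  -- The quartic coefficients are weighted by the numbers of resonances. A term with q = 0 or q = 4
  -- may have weight zero; the term j₀ has positive weight, which is all that is needed.
  obtain ⟨z, hz, hsum⟩ := exists_phase (P := 4) (q := q) (J := J)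
    (fun j hj => ((hJm j).1 hj) ▸ hq j) (fun i hi j hj h => hdistinct (by
      simp only [(hJm i).1 hi, (hJm j).1 hj, h])) (fun j => ν j * resonanceCount (q j)) ((hJm j₀).2 hpj)
    (mul_ne_zero (hν j₀) (Nat.cast_ne_zero.2 (resonanceCount_pos hqj).ne'))
  set σ := ∑ j ∈ J, ν j * resonanceCount (q j) * (z ^ q j * starRingEnd ℂ z ^ (4 - q j)) with hσ
  set ω : ℝ := ‖σ‖ / 2 with hω
  have hω0 : 0 < ω := half_pos (norm_pos_iff.2 hsum)
  obtain ⟨ε₁, hε₁, hsol⟩ := exists_solution_of_duhamel_lower (d₁ := 0) (d₂ := 1) p q ν hp1 hq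
    (R := 3) (by norm_num) hω0
  set V : ℝ := ∑ j, ‖ν j‖ * 3 ^ p j with hV
  have hV0 : 0 ≤ V := Finset.sum_nonneg fun j _ => by positivity
  refine ⟨min (min ε₁ 1) (ω / (V + 1)), ω / 2, 3, by positivity, by positivity, by norm_num, ?_⟩
  intro N l T B s hN hT hTl hB hs hεB hTB
  have he1 : min (min ε₁ 1) (ω / (V + 1)) ≤ ε₁ := (min_le_left _ _).trans (min_le_left _ _)
  have he2 : min (min ε₁ 1) (ω / (V + 1)) ≤ 1 := (min_le_left _ _).trans (min_le_right _ _)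
  have he3 : min (min ε₁ 1) (ω / (V + 1)) ≤ ω / (V + 1) := min_le_right _ _
  set ε := min (min ε₁ 1) (ω / (V + 1))
  have he4 : ε * (V + 1) ≤ ω := by rwa [← le_div_iff₀ (by positivity)]
  have he0 : 0 < ε := by
    by_contra! h
    have := mul_nonneg (neg_nonneg.2 h) hB.le
    linarith
  have hB1 : 1 ≤ B := hεB.trans (mul_le_of_le_one_left hB.le he2)
  have hN1 : (1 : ℝ) ≤ N := by exact_mod_cast hN
  have hμ : scaledMeasure 0 1 1 = freqMeasure 0 1 := by simp [scaledMeasure]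
  have hHaar : (scaledMeasure 0 1 1).IsAddHaarMeasure := isAddHaarMeasure_scaledMeasure one_pos
  set g := trigHat (fun _ => z) (torusCenters N) with hgdef
  have hg : Continuous g := continuous_trigHat _ _
  have hgs : HasCompactSupport g := hasCompactSupport_trigHat _ _
  have hgR : ∀ ξ, ‖g ξ‖ ≤ 3 := fun ξ => by
    simpa using norm_trigHat_le (fun _ : Fin 3 => hz.le) (torusCenters N) ξ
  have hgi : ∫ ξ, ‖g ξ‖ ∂scaledMeasure 0 1 1 ≤ 3 := by
    rw [hμ]
    simpa using integral_norm_trigHat_le (fun _ : Fin 3 => hz.le) (torusCenters N)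
  have hfar : ∀ ξ, g ξ ≠ 0 → (N : ℝ) ^ 2 ≤ normSq ξ := fun ξ hξ => by
    obtain ⟨i, rfl⟩ := exists_of_trigHat_ne_zero hξ
    rw [normSq_torusCenters]
    refine le_mul_of_one_le_right (by positivity) ?_
    fin_cases i <;> norm_num [profile]
  have hx : ‖Wiener.ofCompact (μ := scaledMeasure 0 1 1) g hg hgs‖ ≤ 3 :=
    Wiener.norm_le (by norm_num) hgR hgi
  set κ : Fin n → ℂ := fun j => -Complex.I * ν j * ((B * 1 : ℝ) : ℂ) ^ (p j - 1) with hκ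
  have hκn : ∀ j, ‖κ j‖ = ‖ν j‖ * B ^ (p j - 1) := fun j => by
    rw [hκ]
    simp only [norm_mul, norm_neg, Complex.norm_I, one_mul, norm_pow, Complex.norm_real, mul_one,
      Real.norm_of_nonneg hB.le]
  have hcont : ∀ j, Continuous fun t : ℝ => monomialHat 1 (p j) (q j) (freeEvolution t g) 0 := fun j => by
    simp only [monomialHat_freeEvolution hg hgs]
    exact (Wiener.evalCLM (0 : Freq 0 1)).continuous.comp
      (Wiener.continuous_monomial _ _ (Wiener.continuous_evolution _))
  have hbound : ∀ j, ‖∫ t in (0 : ℝ)..T, monomialHat 1 (p j) (q j) (freeEvolution t g) 0‖ ≤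
      3 ^ p j * T := fun j => by
    refine (intervalIntegral.norm_integral_le_of_norm_le_const (C := 3 ^ p j) fun t _ => ?_).trans
      (by rw [sub_zero, abs_of_pos hT])
    rw [monomialHat_freeEvolution hg hgs]
    exact (Wiener.norm_apply_le _ _).trans
      (Wiener.norm_monomial_le (hp1 j) _ ((Wiener.norm_evolution_le _ _).trans hx))
  have hduh : ∫ t in (0 : ℝ)..T, duhamelIntegrand 1 B p q ν g 0 t =
      ∑ j, κ j * ∫ t in (0 : ℝ)..T, monomialHat 1 (p j) (q j) (freeEvolution t g) 0 := by
    have h0 : normSq (0 : Freq 0 1) = 0 := by simp [normSq]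
    simp only [duhamelIntegrand, h0, mul_zero, Complex.ofReal_zero, zero_mul, Complex.exp_zero, one_mul]
    rw [intervalIntegral.integral_finsetSum]
    · exact Finset.sum_congr rfl fun j _ => intervalIntegral.integral_const_mul _ _
    · exact fun j _ => Continuous.intervalIntegrable (continuous_const.mul (hcont j)) _ _
  have hmain : ∑ j ∈ J, κ j * ∫ t in (0 : ℝ)..T, monomialHat 1 (p j) (q j) (freeEvolution t g) 0 =
      -Complex.I * (B : ℂ) ^ 3 * T * σ := by
    rw [hσ, Finset.mul_sum]
    refine Finset.sum_congr rfl fun j hj => ?_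
    have h4 := (hJm j).1 hj
    have hq4 : q j ≤ 4 := h4 ▸ hq j
    rw [hκ]
    simp only [h4]
    rw [hgdef, integral_monomialHat_torus hq4 z hN hTl]
    push_cast
    ring
  -- Terms of degree at most 3 carry at most B² ≤ εB³, so crude bounds without any oscillation
  -- suffice for them.
  have herr : ‖∑ j ∈ Jᶜ, κ j * ∫ t in (0 : ℝ)..T, monomialHat 1 (p j) (q j) (freeEvolution t g) 0‖ ≤
      ω * (T * B ^ 3) := by
    calc _ ≤ ∑ j ∈ Jᶜ, ε * (T * B ^ 3) * (‖ν j‖ * 3 ^ p j) := by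
          refine (norm_sum_le _ _).trans (Finset.sum_le_sum fun j hj => ?_)
          have h4 : p j ≠ 4 := fun h => Finset.mem_compl.1 hj ((hJm j).2 h)
          have h5 := hP j
          have h6 : B ^ (p j - 1) ≤ ε * B ^ 3 :=
            calc B ^ (p j - 1) ≤ B ^ 2 := pow_le_pow_right₀ hB1 (by omega)
              _ ≤ ε * B * B ^ 2 := le_mul_of_one_le_left (by positivity) hεB
              _ = _ := by ring
          rw [norm_mul, hκn]
          calc _ ≤ ‖ν j‖ * (ε * B ^ 3) * (3 ^ p j * T) := by
                gcongr
                exact hbound j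
            _ = _ := by ring
      _ ≤ ∑ j, ε * (T * B ^ 3) * (‖ν j‖ * 3 ^ p j) :=
          Finset.sum_le_sum_of_subset_of_nonneg (Finset.subset_univ _) fun j _ _ => by positivity
      _ = ε * V * (T * B ^ 3) := by rw [← Finset.mul_sum, hV]; ring
      _ ≤ ω * (T * B ^ 3) := by
          gcongr
          linarith
  obtain ⟨φ, u, hu, hφ, hout⟩ := hsol (B := B) (m := 1) (T := T) (Θ := B ^ 3) (b := (N : ℝ)) (s := s)
    -- The output set is the single frequency 0, where the bracket is one and the output phase is
    -- trivial.
    g {0} hB one_pos hT.le (by linarith) hs (by positivity)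
    (fun j => by
      rw [mul_one]
      have := hP j
      exact pow_le_pow_right₀ hB1 (by omega))
    (hTB.trans he1) hg hgs hgR hgi
    (fun ξ hξ => Real.le_sqrt_of_sq_le (by linarith [hfar ξ hξ]))
    isCompact_singleton
    (fun ξ hξ => by
      by_contra h1
      have h2 := hfar ξ h1
      rw [Set.mem_singleton_iff.1 hξ] at h2
      have h0 : normSq (0 : Freq 0 1) = 0 := by simp [normSq]
      rw [h0] at h2
      nlinarith)
    (fun ξ hξ => by
      rw [Set.mem_singleton_iff.1 hξ, hduh, ← Finset.sum_add_sum_compl J, hmain]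
      have h1 : ‖-Complex.I * (B : ℂ) ^ 3 * T * σ‖ = 2 * (ω * (T * B ^ 3)) := by
        rw [norm_mul, norm_mul, norm_mul, norm_neg, Complex.norm_I, norm_pow, Complex.norm_real,
          Complex.norm_real, Real.norm_of_nonneg hB.le, Real.norm_of_nonneg hT.le, hω]
        ring
      have h2 := norm_sub_le_norm_add (-Complex.I * (B : ℂ) ^ 3 * T * σ)
        (∑ j ∈ Jᶜ, κ j * ∫ t in (0 : ℝ)..T, monomialHat 1 (p j) (q j) (freeEvolution t g) 0)
      rw [h1] at h2
      linarith)
  rw [bracketNorm_singleton_zero] at hout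
  rw [Real.sqrt_one] at hφ
  exact ⟨φ, u, hu, hφ.trans (le_of_eq (by ring)), le_trans (le_of_eq (by ring)) hout⟩

/-! ### Choice of parameters as powers of a large number -/

theorem tendsto_mul_natCast_rpow_zero (c : ℝ) {e : ℝ} (he : e < 0) :
    Tendsto (fun K : ℕ => c * (K : ℝ) ^ e) atTop (𝓝 0) := by
  have h := (tendsto_rpow_neg_atTop (neg_pos.2 he)).comp tendsto_natCast_atTop_atTop
  simpa using h.const_mul c

theorem tendsto_mul_natCast_rpow_atTop {c e : ℝ} (hc : 0 < c) (he : 0 < e) :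
    Tendsto (fun K : ℕ => c * (K : ℝ) ^ e) atTop atTop :=
  ((tendsto_rpow_atTop he).comp tendsto_natCast_atTop_atTop).const_mul_atTop hc

theorem eventually_mul_natCast_rpow_le (c : ℝ) {e ε : ℝ} (he : e < 0) (hε : 0 < ε) :
    ∀ᶠ K : ℕ in atTop, c * (K : ℝ) ^ e ≤ ε :=
  (tendsto_mul_natCast_rpow_zero c he).eventually_le_const hε

section Criterion

variable {d₁ d₂ : ℕ} {F : ℂ → ℂ} {s : ℝ}

theorem normInflation_of_tendsto {T a b : ℕ → ℝ} (hT : Tendsto T atTop (𝓝 0))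
    (ha : Tendsto a atTop (𝓝 0)) (hb : Tendsto b atTop atTop)
    (h : ∀ᶠ K in atTop, 0 < T K ∧ ∃ (φ : HInfty d₁ d₂) (u : ℝ → HInfty d₁ d₂),
      IsSmoothSolution F φ (T K) u ∧ φ.sobolevNorm s ≤ a K ∧ b K ≤ (u (T K)).sobolevNorm s) :
    NormInflation d₁ d₂ F s := by
  intro δ hδ
  obtain ⟨K, ⟨hK0, φ, u, hu, h1, h2⟩, h3, h4, h5⟩ := (h.and ((hT.eventually_lt_const hδ).and
    ((ha.eventually_lt_const hδ).and (hb.eventually_gt_atTop δ⁻¹)))).exists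
  exact ⟨φ, T K, u, h1.trans_lt h4, hK0, h3, hu, h5.trans_le h2⟩

end Criterion

section Supercritical

variable {d₁ d₂ : ℕ} {n : ℕ} {p q : Fin n → ℕ} {ν : Fin n → ℂ}

theorem sqrt_cubeVol_le {A : ℕ} (hA : 1 ≤ A) :
    Real.sqrt (cubeVol d₁ d₂ A) ≤ 2 ^ (d₁ + d₂) * (A : ℝ) ^ (((d₁ + d₂ : ℕ) : ℝ) / 2) := by
  have h0 : (1 : ℝ) ≤ 2 ^ (d₁ + d₂) := one_le_pow₀ (by norm_num)
  refine Real.sqrt_le_iff.2 ⟨by positivity, (cubeVol_le hA).trans ?_⟩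
  rw [mul_pow, ← Real.rpow_natCast (_ ^ (_ / 2)), ← Real.rpow_mul (Nat.cast_nonneg A)]
  have e : ((d₁ + d₂ : ℕ) : ℝ) / 2 * (2 : ℕ) = ((d₁ + d₂ : ℕ) : ℝ) := by push_cast; ring
  rw [e, Real.rpow_natCast]
  gcongr
  nlinarith

theorem le_sqrt_cubeVol (A : ℕ) :
    (A : ℝ) ^ (((d₁ + d₂ : ℕ) : ℝ) / 2) ≤ Real.sqrt (cubeVol d₁ d₂ A) := by
  refine Real.le_sqrt_of_sq_le ((le_of_eq ?_).trans (pow_le_cubeVol A))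
  rw [← Real.rpow_natCast (_ ^ (_ / 2)), ← Real.rpow_mul (Nat.cast_nonneg A)]
  have e : ((d₁ + d₂ : ℕ) : ℝ) / 2 * (2 : ℕ) = ((d₁ + d₂ : ℕ) : ℝ) := by push_cast; ring
  rw [e, Real.rpow_natCast]

theorem nonempty_coordinate (hd : 1 ≤ d₁ + d₂) : Nonempty (Fin d₁ ⊕ Fin d₂) := by
  rw [← Fintype.card_pos_iff, Fintype.card_sum, Fintype.card_fin, Fintype.card_fin]
  exact hd

/-- Norm inflation from high-to-low interactions with parameters that are powers of a large number. -/
theorem normInflation_of_exponents (hd : 1 ≤ d₁ + d₂)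
    (hdistinct : Function.Injective fun j => (p j, q j)) (hp : ∀ j, 2 ≤ p j) (hq : ∀ j, q j ≤ p j)
    (hν : ∀ j, ν j ≠ 0) {P : ℕ} (hP : ∀ j, p j ≤ P) (hPj : ∃ j, p j = P) {s : ℝ} (hs : s ≤ 0)
    {a b : ℕ} (hab : a < b) {β τ : ℝ}
    (h1 : β + a * (d₁ + d₂ : ℕ) / 2 + b * s < 0) (h2 : 2 * b < τ) (h3 : 0 < β + a * (d₁ + d₂ : ℕ))
    (h4 : ((P - 1 : ℕ) : ℝ) * (β + a * (d₁ + d₂ : ℕ)) < τ)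
    (h5 : τ < ((P - 1 : ℕ) : ℝ) * (β + a * (d₁ + d₂ : ℕ)) + β + a * s + a * (d₁ + d₂ : ℕ) / 2) :
    NormInflation d₁ d₂ (nonlinearity p q ν) s := by
  obtain ⟨c⟩ := nonempty_coordinate hd
  obtain ⟨ε, κ, C, hε, hκ, hC, hsol⟩ := exists_solution_high_to_low p q ν hdistinct hp hq hν hP hPj c
  set d := d₁ + d₂ with hdd
  set Q := P - 1 with hQ
  have hb1 : 1 ≤ b := by omega
  -- The parameters are A = K^a, N = K^b, B = K^β, T = K^{-τ}. Condition `h1` makes the data small,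
  -- `h2` removes oscillation, `h3` makes Bm large, `h4` makes the nonlinear interaction
  -- perturbative, and `h5` makes the output large.
  refine normInflation_of_tendsto (T := fun K => (K : ℝ) ^ (-τ))
    (a := fun K => C * 2 ^ d * 2 ^ (-s) * (K : ℝ) ^ (β + a * d / 2 + b * s))
    (b := fun K => κ * ((d : ℝ) + 1) ^ s * (K : ℝ) ^ (-τ + Q * (β + a * d) + β + a * s + a * d / 2))
    ?_ (tendsto_mul_natCast_rpow_zero _ h1)
    (tendsto_mul_natCast_rpow_atTop (by positivity) (by linarith)) ?_
  · have hb1' : (1 : ℝ) ≤ b := by exact_mod_cast hb1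
    simpa using tendsto_mul_natCast_rpow_zero 1 (e := -τ) (by linarith)
  filter_upwards [eventually_ge_atTop 16, eventually_mul_natCast_rpow_le 1 (e := 2 * b - τ) (by linarith) hε,
    eventually_mul_natCast_rpow_le ((2 ^ d) ^ Q) (e := Q * (β + a * d) - τ) (by linarith) hε,
    (tendsto_mul_natCast_rpow_atTop hε h3).eventually_ge_atTop 1] with K hK e1 e2 e3
  have hK' : (16 : ℝ) ≤ K := by exact_mod_cast hK
  have hK0 : (0 : ℝ) < K := by linarith
  have hA : 1 ≤ K ^ a := Nat.one_le_pow _ _ (by omega)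
  have hpow : ∀ (x : ℝ) (k : ℕ), ((K ^ k : ℕ) : ℝ) ^ x = (K : ℝ) ^ (k * x) := fun x k => by
    rw [Nat.cast_pow, ← Real.rpow_natCast, ← Real.rpow_mul hK0.le]
  have hm1 : (K : ℝ) ^ ((a : ℝ) * d) ≤ cubeVol d₁ d₂ (K ^ a) := by
    rw [← hpow, Real.rpow_natCast]
    exact pow_le_cubeVol _
  have hm2 : cubeVol d₁ d₂ (K ^ a) ≤ 2 ^ d * (K : ℝ) ^ ((a : ℝ) * d) := by
    rw [← hpow, Real.rpow_natCast]
    exact cubeVol_le hA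
  have hm3 : Real.sqrt (cubeVol d₁ d₂ (K ^ a)) ≤ 2 ^ d * (K : ℝ) ^ ((a : ℝ) * d / 2) := by
    rw [mul_div_assoc, ← hpow]
    exact sqrt_cubeVol_le hA
  have hm4 : (K : ℝ) ^ ((a : ℝ) * d / 2) ≤ Real.sqrt (cubeVol d₁ d₂ (K ^ a)) := by
    rw [mul_div_assoc, ← hpow]
    exact le_sqrt_cubeVol _
  have hbn : ((d : ℝ) + 1) ^ s * (K : ℝ) ^ (a * s) * (K : ℝ) ^ ((a : ℝ) * d / 2) ≤
      bracketNorm s (cube d₁ d₂ (K ^ a)) := by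
    refine le_trans ?_ (le_bracketNorm_box hs (r := ((K ^ a : ℕ) : ℝ)) (by exact_mod_cast hA)
      (fun i => by positivity) (fun i => le_rfl) (fun j => le_rfl))
    rw [Real.mul_rpow (by positivity) (by positivity), hpow]
    gcongr
    exact hm4
  have hKβ : (0 : ℝ) < (K : ℝ) ^ β := by positivity
  have hMlow : (K : ℝ) ^ (β + a * d) ≤ (K : ℝ) ^ β * cubeVol d₁ d₂ (K ^ a) := by
    rw [Real.rpow_add hK0]
    gcongr
  have hMup : (K : ℝ) ^ β * cubeVol d₁ d₂ (K ^ a) ≤ 2 ^ d * (K : ℝ) ^ (β + a * d) := by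
    calc _ ≤ (K : ℝ) ^ β * (2 ^ d * (K : ℝ) ^ ((a : ℝ) * d)) := by gcongr
      _ = _ := by rw [Real.rpow_add hK0]; ring
  have hm0 := cubeVol_pos (d₁ := d₁) (d₂ := d₂) hA
  have hQpow : ((K : ℝ) ^ (β + a * d)) ^ Q = (K : ℝ) ^ (Q * (β + a * d)) := by
    rw [← Real.rpow_natCast, ← Real.rpow_mul hK0.le, mul_comm]
  refine ⟨by positivity, ?_⟩
  obtain ⟨φ, u, hu, hφ, hout⟩ := hsol (A := K ^ a) (N := K ^ b) (T := (K : ℝ) ^ (-τ)) (B := (K : ℝ) ^ β)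
    (s := s) hA
    (by
      calc 16 * K ^ a ≤ K * K ^ a := Nat.mul_le_mul_right _ hK
        _ = K ^ (a + 1) := (pow_succ' _ _).symm
        _ ≤ K ^ b := Nat.pow_le_pow_right (by omega) hab)
    (by positivity) hKβ hs
    (by
      refine le_trans (le_of_eq ?_) e1
      have := hpow 2 b
      rw [Real.rpow_two] at this
      rw [this, ← Real.rpow_add hK0, one_mul]
      congr 1; ring)
    (e3.trans (by gcongr))
    (by
      calc (K : ℝ) ^ (-τ) * ((K : ℝ) ^ β * cubeVol d₁ d₂ (K ^ a)) ^ Q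
          ≤ (K : ℝ) ^ (-τ) * (2 ^ d * (K : ℝ) ^ (β + a * d)) ^ Q := by gcongr
        _ = (2 ^ d) ^ Q * (K : ℝ) ^ (Q * (β + a * d) - τ) := by
          rw [mul_pow, hQpow, sub_eq_neg_add, Real.rpow_add hK0]; ring
        _ ≤ ε := e2)
  refine ⟨φ, u, hu, hφ.trans ?_, le_trans ?_ hout⟩
  · rw [Real.div_rpow (by positivity) (by norm_num), hpow, div_eq_mul_inv, ← Real.rpow_neg (by norm_num)]
    calc C * ((K : ℝ) ^ β * Real.sqrt (cubeVol d₁ d₂ (K ^ a)) * ((K : ℝ) ^ (b * s) * 2 ^ (-s)))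
        ≤ C * ((K : ℝ) ^ β * (2 ^ d * (K : ℝ) ^ ((a : ℝ) * d / 2)) * ((K : ℝ) ^ (b * s) * 2 ^ (-s))) := by
          gcongr
      _ = _ := by
        rw [Real.rpow_add hK0, Real.rpow_add hK0]; ring
  · calc κ * ((d : ℝ) + 1) ^ s * (K : ℝ) ^ (-τ + Q * (β + a * d) + β + a * s + a * d / 2)
        = κ * ((K : ℝ) ^ (-τ) * ((K : ℝ) ^ (β + a * d)) ^ Q * (K : ℝ) ^ β *
          (((d : ℝ) + 1) ^ s * (K : ℝ) ^ (a * s) * (K : ℝ) ^ ((a : ℝ) * d / 2))) := by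
          rw [hQpow, Real.rpow_add hK0, Real.rpow_add hK0, Real.rpow_add hK0, Real.rpow_add hK0]; ring
      _ ≤ _ := by gcongr

/-- With A only slightly below N and data barely small, the constraints leave room for τ exactly
when 2 < (P - 1)(d/2 - s), that is s < s_c. The margin is multiplied by b, so a large b outweighs
the loss from a = b - 1. -/
theorem normInflation_of_supercritical (hd : 1 ≤ d₁ + d₂)
    (hdistinct : Function.Injective fun j => (p j, q j)) (hp : ∀ j, 2 ≤ p j) (hq : ∀ j, q j ≤ p j)
    (hν : ∀ j, ν j ≠ 0) {P : ℕ} (hP : ∀ j, p j ≤ P) (hPj : ∃ j, p j = P) {s : ℝ} (hs : s < 0)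
    (hs' : s < criticalIndex (d₁ + d₂) P) : NormInflation d₁ d₂ (nonlinearity p q ν) s := by
  have hP2 : 2 ≤ P := by
    obtain ⟨j, rfl⟩ := hPj
    exact hp j
  set D : ℝ := ((d₁ + d₂ : ℕ) : ℝ) with hD
  have hD1 : 1 ≤ D := by
    rw [hD]
    exact_mod_cast hd
  set Q : ℝ := ((P - 1 : ℕ) : ℝ) with hQ
  have hQP : Q = (P : ℝ) - 1 := by rw [hQ, Nat.cast_sub (by omega), Nat.cast_one]
  have hQ1 : 1 ≤ Q := by
    rw [hQ]
    exact_mod_cast (by omega : 1 ≤ P - 1)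
  have hΔ : 0 < Q * (D / 2 - s) - 2 := by
    rw [criticalIndex, ← hQP, ← hD] at hs'
    have h1 : 2 / Q < D / 2 - s := by linarith
    rw [div_lt_iff₀ (by linarith)] at h1
    linarith
  -- This threshold for b is the inequality `2 * (a + 1) < hi` solved for b = a + 1.
  obtain ⟨b, hb⟩ := exists_nat_gt (max 1 ((Q * (D / 2 - s / 2) + s / 2) / (Q * (D / 2 - s) - 2)))
  obtain ⟨hb1, hb2⟩ := max_lt_iff.1 hb
  rw [div_lt_iff₀ hΔ] at hb2
  obtain ⟨a, rfl⟩ : ∃ a, b = a + 1 := ⟨b - 1, by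
    have : 1 < b := by exact_mod_cast hb1
    omega⟩
  push_cast at hb1 hb2
  -- The exponent of the data becomes exactly s/2 < 0, and `hi` exceeds Q(β + aD) by exactly -s/2 >
  -- 0.
  set β : ℝ := -(a + 1) * s - a * D / 2 + s / 2 with hβ
  set lo : ℝ := max (2 * (a + 1)) (Q * (β + a * D)) with hlo
  set hi : ℝ := Q * (β + a * D) + β + a * s + a * D / 2 with hhi
  have hpos : 0 < β + a * D := by
    have ha : 0 ≤ a * D := by positivity
    have ha' : 0 ≤ (a : ℝ) * (-s) := mul_nonneg (Nat.cast_nonneg a) (by linarith)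
    rw [hβ]
    nlinarith
  have hlohi : lo < hi := by
    rw [hlo, max_lt_iff, hhi, hβ]
    constructor <;> nlinarith
  refine normInflation_of_exponents hd hdistinct hp hq hν hP hPj hs.le (a := a) (b := a + 1)
    (Nat.lt_succ_self a) (β := β) (τ := (lo + hi) / 2) ?_ ?_ hpos ?_ ?_
  · push_cast
    rw [hβ]
    rw [hD]
    push_cast
    nlinarith
  · push_cast
    have := le_max_left (2 * ((a : ℝ) + 1)) (Q * (β + a * D))
    linarith
  · have := le_max_right (2 * ((a : ℝ) + 1)) (Q * (β + a * D))
    linarith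
  · linarith

/-- Here A = 1 and N = B^{2/(1-s)}. The data have exponent (1 + s)/2 < 0, and τ must lie strictly
between max(2, β) and 2β; such τ exist because s < -1 gives β > 1. -/
theorem normInflation_of_quadratic_one_dim (hd : d₁ + d₂ = 1)
    (hdistinct : Function.Injective fun j => (p j, q j)) (hp : ∀ j, 2 ≤ p j) (hq : ∀ j, q j ≤ p j)
    (hν : ∀ j, ν j ≠ 0) (hP : ∀ j, p j ≤ 2) (hPj : ∃ j, p j = 2) {s : ℝ} (hs : s < -1) :
    NormInflation d₁ d₂ (nonlinearity p q ν) s := by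
  set β : ℝ := (1 - s) / 2 with hβ
  have h1 : max 2 β < 2 * β := max_lt (by linarith) (by linarith)
  have h2 := le_max_left 2 β
  have h3 := le_max_right 2 β
  refine normInflation_of_exponents hd.ge hdistinct hp hq hν hP hPj (by linarith) (a := 0) (b := 1)
    zero_lt_one (β := β) (τ := (max 2 β + 2 * β) / 2) ?_ ?_ ?_ ?_ ?_ <;> norm_num <;> linarith

end Supercritical

/-! ### The critical exponent, the terms u ū and the quartic terms -/

section Cases

variable {d₁ d₂ : ℕ} {n : ℕ} {p q : Fin n → ℕ} {ν : Fin n → ℂ}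

/-- Norm inflation at the scaling-critical exponent `-d/2`. -/
theorem normInflation_of_critical (hd : 1 ≤ d₁ + d₂)
    (hdistinct : Function.Injective fun j => (p j, q j)) (hp : ∀ j, 2 ≤ p j) (hq : ∀ j, q j ≤ p j)
    (hν : ∀ j, ν j ≠ 0) {P : ℕ} (hP : ∀ j, p j ≤ P) (hPj : ∃ j, p j = P)
    (hdP : (d₁ + d₂) * (P - 1) = 2) :
    NormInflation d₁ d₂ (nonlinearity p q ν) (-((d₁ + d₂ : ℕ) : ℝ) / 2) := by
  obtain ⟨c⟩ := nonempty_coordinate hd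
  obtain ⟨ε, κ, C, hε, hκ, hC, hsol⟩ := exists_solution_high_to_low p q ν hdistinct hp hq hν hP hPj c
  set s : ℝ := -((d₁ + d₂ : ℕ) : ℝ) / 2 with hs
  set Q := P - 1 with hQ
  have hs0 : s ≤ 0 := by
    have : (0 : ℝ) ≤ ((d₁ + d₂ : ℕ) : ℝ) := Nat.cast_nonneg _
    linarith
  intro δ hδ
  set G : ℝ := C * 2 ^ (d₁ + d₂) * 8 ^ s with hG
  have hG0 : 0 < G := by positivity
  -- At s = -d/2 the factor A^{d/2} N^s is bounded when N is comparable to A, so B stays fixed and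
  -- the data have norm at most δ/2.
  set B : ℝ := δ / (2 * G) with hB
  have hB0 : 0 < B := by positivity
  set W : ℝ := (B * 2 ^ (d₁ + d₂)) ^ Q with hW
  have hW0 : 0 < W := by positivity
  -- With T = η/A² and N = 16A, the quantity TN² equals 256η, and T(Bm)^{P-1} is at most ηW because
  -- d(P - 1) = 2. Growth then comes only from the divergent bracket norm over the cubes.
  set η : ℝ := ε / (256 * (1 + W)) with hη
  have hη0 : 0 < η := by positivity
  have hη1 : 256 * η ≤ ε := by
    rw [hη, mul_div_assoc', div_le_iff₀ (by positivity)]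
    nlinarith [mul_pos hε hW0]
  have hη2 : η * W ≤ ε := by
    rw [hη, div_mul_eq_mul_div, div_le_iff₀ (by positivity)]
    nlinarith [mul_pos hε hW0]
  have h4 : Tendsto (fun k : ℕ => ((4 ^ k : ℕ) : ℝ)) atTop atTop :=
    tendsto_natCast_atTop_atTop.comp (tendsto_pow_atTop_atTop_of_one_lt (by norm_num : 1 < 4))
  have hT : Tendsto (fun k : ℕ => η / ((4 ^ k : ℕ) : ℝ) ^ 2) atTop (𝓝 0) :=
    Tendsto.div_atTop tendsto_const_nhds ((tendsto_pow_atTop two_ne_zero).comp h4)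
  have hM : Tendsto (fun k : ℕ => ε * B * ((4 ^ k : ℕ) : ℝ)) atTop atTop :=
    h4.const_mul_atTop (by positivity)
  have hO : Tendsto (fun k : ℕ => κ * (η * B ^ Q * B) * bracketNorm s (cube d₁ d₂ (4 ^ k))) atTop atTop :=
    (tendsto_bracketNorm_cube hd).const_mul_atTop (by positivity)
  obtain ⟨k, hk1, hk2, hk3⟩ := ((hT.eventually_lt_const hδ).and ((hM.eventually_ge_atTop 1).and
    (hO.eventually_gt_atTop δ⁻¹))).exists
  set A : ℕ := 4 ^ k with hA
  have hA1 : 1 ≤ A := Nat.one_le_pow _ _ (by norm_num)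
  have hA' : (1 : ℝ) ≤ A := by exact_mod_cast hA1
  have hm0 := cubeVol_pos (d₁ := d₁) (d₂ := d₂) hA1
  have hAd : ((A : ℝ) ^ (d₁ + d₂)) ^ Q = (A : ℝ) ^ 2 := by rw [← pow_mul, hdP]
  have hlow := pow_le_cubeVol (d₁ := d₁) (d₂ := d₂) A
  have hup := cubeVol_le (d₁ := d₁) (d₂ := d₂) hA1
  obtain ⟨φ, u, hu, hφ, hout⟩ := hsol (A := A) (N := 16 * A) (T := η / (A : ℝ) ^ 2) (B := B) (s := s) hA1
    le_rfl (by positivity) hB0 hs0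
    (by
      push_cast
      refine le_trans (le_of_eq ?_) hη1
      field_simp
      norm_num)
    (by
      refine hk2.trans ?_
      rw [mul_assoc]
      gcongr
      exact (le_self_pow₀ hA' (by omega)).trans hlow)
    (by
      calc η / (A : ℝ) ^ 2 * (B * cubeVol d₁ d₂ A) ^ Q
          ≤ η / (A : ℝ) ^ 2 * (B * (2 ^ (d₁ + d₂) * (A : ℝ) ^ (d₁ + d₂))) ^ Q := by gcongr
        _ = η * W := by
          rw [← mul_assoc, mul_pow _ ((A : ℝ) ^ (d₁ + d₂)), hAd, ← hW]
          field_simp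
        _ ≤ ε := hη2)
  refine ⟨φ, η / (A : ℝ) ^ 2, u, hφ.trans_lt ?_, by positivity, hk1, hu, hk3.trans_le (le_trans ?_ hout)⟩
  · have e : (((16 * A : ℕ) : ℝ) / 2) ^ s = 8 ^ s * (A : ℝ) ^ s := by
      rw [← Real.mul_rpow (by norm_num) (by positivity)]
      congr 1
      push_cast; ring
    have e2 : (A : ℝ) ^ (((d₁ + d₂ : ℕ) : ℝ) / 2) * (A : ℝ) ^ s = 1 := by
      rw [← Real.rpow_add (by positivity), hs]
      have : ((d₁ + d₂ : ℕ) : ℝ) / 2 + -((d₁ + d₂ : ℕ) : ℝ) / 2 = 0 := by ring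
      rw [this, Real.rpow_zero]
    rw [e]
    calc C * (B * Real.sqrt (cubeVol d₁ d₂ A) * (8 ^ s * (A : ℝ) ^ s))
        ≤ C * (B * (2 ^ (d₁ + d₂) * (A : ℝ) ^ (((d₁ + d₂ : ℕ) : ℝ) / 2)) * (8 ^ s * (A : ℝ) ^ s)) := by
          gcongr
          exact sqrt_cubeVol_le hA1
      _ = B * G * ((A : ℝ) ^ (((d₁ + d₂ : ℕ) : ℝ) / 2) * (A : ℝ) ^ s) := by rw [hG]; ring
      _ = δ / 2 := by
        rw [e2, hB]
        field_simp
      _ < δ := half_lt_self hδ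
  · have hbn : 0 ≤ bracketNorm s (cube d₁ d₂ A) := Real.sqrt_nonneg _
    calc _ = κ * (η / (A : ℝ) ^ 2 * (B * (A : ℝ) ^ (d₁ + d₂)) ^ Q * B * bracketNorm s (cube d₁ d₂ A)) := by
          rw [mul_pow, hAd]
          field_simp
      _ ≤ _ := by gcongr

/-- Norm inflation on `ℝ^d` below `-1/4` for nonlinearities with a term `u ū`. -/
theorem normInflation_of_mul_conj_euclidean (hd₂ : d₂ = 0) (hd₁ : 1 ≤ d₁)
    (hdistinct : Function.Injective fun j => (p j, q j)) (hp : ∀ j, 2 ≤ p j) (hq : ∀ j, q j ≤ p j)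
    (hν : ∀ j, ν j ≠ 0) {j₀ : Fin n} (hpj : p j₀ = 2) (hqj : q j₀ = 1) {s : ℝ} (hs : s < -1 / 4) :
    NormInflation d₁ d₂ (nonlinearity p q ν) s := by
  subst hd₂
  obtain ⟨k, rfl⟩ : ∃ k, d₁ = k + 1 := ⟨d₁ - 1, by omega⟩
  obtain ⟨ε, κ, C, hε, hκ, hC, hsol⟩ :=
    exists_solution_resonant p q ν hdistinct hp hq hν hpj hqj (.inl 0 : Fin (k + 1) ⊕ Fin 0)
  -- Three constraints meet: β < 1/2 - s for small data, β < 1 for Bm → 0, and β > 3/4 for growth,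
  -- since the output has exponent 2β - 3/2 - τ. They are compatible because s < -1/4.
  set β : ℝ := (3 / 4 + min 1 (1 / 2 - s)) / 2 with hβ
  have h1 : 3 / 4 < min 1 (1 / 2 - s) := lt_min (by norm_num) (by linarith)
  have h2 := min_le_left 1 (1 / 2 - s)
  have h3 := min_le_right 1 (1 / 2 - s)
  set τ : ℝ := (2 * β - 3 / 2) / 2 with hτ
  have hτ0 : 0 < τ := by linarith
  refine normInflation_of_tendsto (T := fun K => (K : ℝ) ^ (-τ))
    (a := fun K => C * 2 ^ (-s) * (K : ℝ) ^ (β + -1 / 2 + s))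
    (b := fun K => κ * (((k + 1 + 0 : ℕ) : ℝ) + 1) ^ s * (K : ℝ) ^ (-τ + β + -1 + β + -1 / 2))
    (by simpa using tendsto_mul_natCast_rpow_zero 1 (e := -τ) (by linarith))
    (tendsto_mul_natCast_rpow_zero _ (by linarith))
    (tendsto_mul_natCast_rpow_atTop (by positivity) (by linarith)) ?_
  filter_upwards [eventually_ge_atTop 8, eventually_mul_natCast_rpow_le 2 (e := -τ) (by linarith) hε,
    eventually_mul_natCast_rpow_le 1 (e := -τ + (β + -1)) (by linarith) hε,
    eventually_mul_natCast_rpow_le 1 (e := β + -1) (by linarith) hε] with K hK e1 e2 e3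
  have hK' : (8 : ℝ) ≤ K := by exact_mod_cast hK
  have hK0 : (0 : ℝ) < K := by linarith
  -- The bump is thin only in the direction of N, with NA = 1, so that any T → 0 is short enough to
  -- avoid oscillation.
  set α : Fin (k + 1) → ℝ := Fin.cons ((K : ℝ) ^ (-1 : ℝ)) fun _ => 1 with hα
  have hK1 : (K : ℝ) ^ (-1 : ℝ) ≤ 1 := Real.rpow_le_one_of_one_le_of_nonpos (by linarith) (by norm_num)
  have hα0 : ∀ i, 0 < α i := fun i => by
    refine Fin.cases ?_ (fun i => ?_) i
    · rw [hα, Fin.cons_zero]; positivity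
    · rw [hα, Fin.cons_succ]; norm_num
  have hα1 : ∀ i, α i ≤ 1 := fun i => by
    refine Fin.cases ?_ (fun i => ?_) i
    · rw [hα, Fin.cons_zero]; exact hK1
    · rw [hα, Fin.cons_succ]
  have hm : boxVol α (fun _ : Fin 0 => 0) = (K : ℝ) ^ (-1 : ℝ) := by
    simp [boxVol, Fin.prod_univ_succ, hα]
  have hsqrt : Real.sqrt ((K : ℝ) ^ (-1 : ℝ)) = (K : ℝ) ^ (-1 / 2 : ℝ) := by
    rw [Real.sqrt_eq_rpow, ← Real.rpow_mul hK0.le]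
    norm_num
  refine ⟨by positivity, ?_⟩
  obtain ⟨φ, u, hu, hφ, hout⟩ := hsol (α := α) (A := (K : ℝ) ^ (-1 : ℝ)) (N := K) (T := (K : ℝ) ^ (-τ))
    (B := (K : ℝ) ^ β) (s := s) hα0 hα1 (by positivity)
    (fun ζ hζ => by
      have := (mem_box.1 hζ).1 0
      simpa [hα, coord] using this)
    hK (by positivity) (by positivity) (by linarith)
    (by
      rw [Real.rpow_neg_one, mul_inv_cancel₀ hK0.ne']
      linarith)
    (by
      rw [hm, ← Real.rpow_add hK0, ← Real.rpow_add hK0]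
      linarith)
    (Or.inr (by
      rw [hm, ← Real.rpow_add hK0]
      linarith))
  rw [hm, hsqrt] at hφ
  rw [hm] at hout
  refine ⟨φ, u, hu, hφ.trans (le_of_eq ?_), le_trans ?_ hout⟩
  · rw [Real.div_rpow hK0.le (by norm_num), div_eq_mul_inv ((K : ℝ) ^ s), ← Real.rpow_neg (by norm_num),
      Real.rpow_add hK0, Real.rpow_add hK0]
    ring
  · have hbn := le_bracketNorm_box (d₂ := 0) (β := fun _ => 0) (s := s) (by linarith) le_rfl hα0 hα1
      (fun j => by simp)
    rw [hm, hsqrt, mul_one] at hbn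
    calc _ = κ * ((K : ℝ) ^ (-τ) * ((K : ℝ) ^ β * (K : ℝ) ^ (-1 : ℝ)) * (K : ℝ) ^ β *
          ((((k + 1 + 0 : ℕ) : ℝ) + 1) ^ s * (K : ℝ) ^ (-1 / 2 : ℝ))) := by
          rw [Real.rpow_add hK0, Real.rpow_add hK0, Real.rpow_add hK0, Real.rpow_add hK0]
          ring
      _ ≤ _ := by gcongr

/-- Norm inflation in negative regularity for quadratic nonlinearities with a term `u ū` when there is a
periodic direction. -/
theorem normInflation_of_mul_conj_periodic (hd₂ : 1 ≤ d₂)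
    (hdistinct : Function.Injective fun j => (p j, q j)) (hp : ∀ j, 2 ≤ p j) (hq : ∀ j, q j ≤ p j)
    (hν : ∀ j, ν j ≠ 0) (hP : ∀ j, p j ≤ 2) {j₀ : Fin n} (hpj : p j₀ = 2) (hqj : q j₀ = 1) {s : ℝ}
    (hs : s < 0) : NormInflation d₁ d₂ (nonlinearity p q ν) s := by
  obtain ⟨k, rfl⟩ : ∃ k, d₂ = k + 1 := ⟨d₂ - 1, by omega⟩
  obtain ⟨ε, κ, C, hε, hκ, hC, hsol⟩ :=
    exists_solution_resonant p q ν hdistinct hp hq hν hpj hqj (.inr 0 : Fin d₁ ⊕ Fin (k + 1))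
  -- The data have exponent β + s = s/2, the interaction β - τ = -β/2, and the output 2β - τ = β/2.
  set β : ℝ := -s / 2 with hβ
  set τ : ℝ := 3 * β / 2 with hτ
  have hβ0 : 0 < β := by linarith
  refine normInflation_of_tendsto (T := fun K => (K : ℝ) ^ (-τ))
    (a := fun K => C * 2 ^ (-s) * (K : ℝ) ^ (β + s))
    (b := fun K => κ * (((d₁ + (k + 1) : ℕ) : ℝ) + 1) ^ s * (K : ℝ) ^ (-τ + β + β))
    (by simpa using tendsto_mul_natCast_rpow_zero 1 (e := -τ) (by linarith))
    (tendsto_mul_natCast_rpow_zero _ (by linarith))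
    (tendsto_mul_natCast_rpow_atTop (by positivity) (by linarith)) ?_
  filter_upwards [eventually_ge_atTop 8, eventually_mul_natCast_rpow_le 1 (e := -τ) (by linarith) hε,
    eventually_mul_natCast_rpow_le 1 (e := -τ + β) (by linarith) hε] with K hK e1 e2
  have hK' : (8 : ℝ) ≤ K := by exact_mod_cast hK
  have hK0 : (0 : ℝ) < K := by linarith
  have hm : boxVol (fun _ : Fin d₁ => (1 : ℝ)) (fun _ : Fin (k + 1) => 0) = 1 := by simp [boxVol]
  refine ⟨by positivity, ?_⟩
  -- In the periodic direction the bump is a single integer, so its width A is zero and N imposes no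
  -- restriction on T. Since B is large, terms of degree above two must be absent.
  obtain ⟨φ, u, hu, hφ, hout⟩ := hsol (α := fun _ => 1) (A := 0) (N := K) (T := (K : ℝ) ^ (-τ))
    (B := (K : ℝ) ^ β) (s := s) (fun _ => one_pos) (fun _ => le_rfl) le_rfl
    (fun ζ hζ => by
      have h1 : ζ.2 0 = 0 := by simpa using (mem_box.1 hζ).2 0
      simp [coord, h1])
    hK (by positivity) (by positivity) (by linarith)
    (by
      rw [mul_zero, zero_add, mul_one]
      linarith)
    (by
      rw [hm, mul_one, ← Real.rpow_add hK0]
      linarith)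
    (Or.inl hP)
  rw [hm, Real.sqrt_one, mul_one] at hφ
  rw [hm, mul_one] at hout
  refine ⟨φ, u, hu, hφ.trans (le_of_eq ?_), le_trans ?_ hout⟩
  · rw [Real.div_rpow hK0.le (by norm_num), div_eq_mul_inv, ← Real.rpow_neg (by norm_num),
      Real.rpow_add hK0]
    ring
  · have hbn := le_bracketNorm_box (d₁ := d₁) (d₂ := k + 1) (α := fun _ => 1) (β := fun _ => 0) (s := s) hs.le
      le_rfl (fun _ => one_pos) (fun _ => le_rfl) (fun j => by simp)
    rw [hm, Real.sqrt_one, mul_one, mul_one] at hbn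
    calc _ = κ * ((K : ℝ) ^ (-τ) * (K : ℝ) ^ β * (K : ℝ) ^ β * (((d₁ + (k + 1) : ℕ) : ℝ) + 1) ^ s) := by
          rw [Real.rpow_add hK0, Real.rpow_add hK0]
          ring
      _ ≤ _ := by gcongr

/-- Norm inflation in negative regularity on the circle for quartic nonlinearities with a resonant term. -/
theorem normInflation_of_quartic_circle
    (hdistinct : Function.Injective fun j => (p j, q j)) (hp : ∀ j, 2 ≤ p j) (hq : ∀ j, q j ≤ p j)
    (hν : ∀ j, ν j ≠ 0) (hP : ∀ j, p j ≤ 4) {j₀ : Fin n} (hpj : p j₀ = 4)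
    (hqj : q j₀ = 1 ∨ q j₀ = 2 ∨ q j₀ = 3) {s : ℝ} (hs : s < 0) :
    NormInflation 0 1 (nonlinearity p q ν) s := by
  obtain ⟨ε, κ, C, hε, hκ, hC, hsol⟩ := exists_solution_torus p q ν hdistinct hp hq hν hP hpj hqj
  -- With B = K^{3/5} and T of order K^{-2}, the interaction TB³ has exponent -1/5 and the output
  -- TB⁴ has exponent 2/5. Taking N = K^b with b large makes the data small for any s < 0.
  obtain ⟨b, hb⟩ := exists_nat_gt (max 1 (3 / 5 / -s))
  obtain ⟨hb1, hb2⟩ := max_lt_iff.1 hb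
  rw [div_lt_iff₀ (by linarith)] at hb2
  have hb1' : 1 < b := by exact_mod_cast hb1
  have hπ := Real.pi_pos
  refine normInflation_of_tendsto (T := fun K => 2 * Real.pi * (K : ℝ) ^ (-2 : ℝ))
    (a := fun K => C * (K : ℝ) ^ (3 / 5 + b * s))
    (b := fun K => κ * (2 * Real.pi) * (K : ℝ) ^ (-2 + 3 / 5 * (4 : ℕ) : ℝ))
    (tendsto_mul_natCast_rpow_zero _ (by norm_num))
    (tendsto_mul_natCast_rpow_zero _ (by linarith))
    (tendsto_mul_natCast_rpow_atTop (by positivity) (by norm_num)) ?_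
  filter_upwards [eventually_ge_atTop 1,
    (tendsto_mul_natCast_rpow_atTop hε (e := 3 / 5) (by norm_num)).eventually_ge_atTop 1,
    eventually_mul_natCast_rpow_le (2 * Real.pi) (e := -2 + 3 / 5 * (3 : ℕ)) (by norm_num) hε] with K hK e1 e2
  have hK0 : (0 : ℝ) < K := by exact_mod_cast hK
  have hpow : ∀ k : ℕ, ((K : ℝ) ^ (3 / 5 : ℝ)) ^ k = (K : ℝ) ^ (3 / 5 * (k : ℝ)) := fun k => by
    rw [← Real.rpow_natCast, ← Real.rpow_mul hK0.le]
  refine ⟨by positivity, ?_⟩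
  -- The integer l is chosen so that TN² = 2πl; this requires b ≥ 1 for the exponent 2b - 2 to be a
  -- true difference.
  obtain ⟨φ, u, hu, hφ, hout⟩ := hsol (N := K ^ b) (l := K ^ (2 * b - 2))
    (T := 2 * Real.pi * (K : ℝ) ^ (-2 : ℝ)) (B := (K : ℝ) ^ (3 / 5 : ℝ)) (s := s) (Nat.one_le_pow _ _ hK)
    (by positivity)
    (by
      have e : (K : ℝ) ^ (2 * b) = (K : ℝ) ^ 2 * (K : ℝ) ^ (2 * b - 2) := by
        rw [← pow_add]
        congr 1; omega
      push_cast
      rw [← pow_mul, mul_comm b 2, e, Real.rpow_neg hK0.le, Real.rpow_two]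
      field_simp)
    (by positivity) hs.le e1
    (by
      rw [hpow, mul_assoc, ← Real.rpow_add hK0]
      exact e2)
  refine ⟨φ, u, hu, hφ.trans (le_of_eq ?_), le_trans (le_of_eq ?_) hout⟩
  · rw [Nat.cast_pow, ← Real.rpow_natCast (K : ℝ) b, ← Real.rpow_mul hK0.le, Real.rpow_add hK0]
  · rw [hpow, Real.rpow_add hK0]
    ring

end Cases

/-! ### Comparison of critical indices -/

section Indices

/-- This monotonicity allows a supercritical lower-order term to be replaced by the terms of top
degree, to which the high-to-low mechanism applies. -/
theorem criticalIndex_lt {d P P' : ℕ} (hP : 2 ≤ P) (h : P < P') : criticalIndex d P < criticalIndex d P' := by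
  have h1 : (2 : ℝ) ≤ P := by exact_mod_cast hP
  have h2 : (P : ℝ) < P' := by exact_mod_cast h
  unfold criticalIndex
  have := div_lt_div_of_pos_left (c := (P : ℝ) - 1) (b := (P' : ℝ) - 1) (a := 2) two_pos (by linarith)
    (by linarith)
  linarith

theorem criticalIndex_le {d P P' : ℕ} (hP : 2 ≤ P) (h : P ≤ P') :
    criticalIndex d P ≤ criticalIndex d P' := by
  rcases h.eq_or_lt with rfl | h
  exacts [le_rfl, (criticalIndex_lt hP h).le]

theorem mul_eq_two_of_criticalIndex_eq {d P : ℕ} (hP : 2 ≤ P) (h : criticalIndex d P = -(d : ℝ) / 2) :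
    d * (P - 1) = 2 := by
  have h1 : (2 : ℝ) ≤ P := by exact_mod_cast hP
  have h2 : (P : ℝ) - 1 ≠ 0 := by linarith
  rw [criticalIndex] at h
  have h3 : (d : ℝ) = 2 / ((P : ℝ) - 1) := by linarith
  rw [eq_div_iff h2] at h3
  have h4 : ((d * (P - 1) : ℕ) : ℝ) = 2 := by
    rw [Nat.cast_mul, Nat.cast_sub (by omega), Nat.cast_one, h3]
  exact_mod_cast h4

theorem criticalIndex_one_three : criticalIndex 1 3 = -1 / 2 := by norm_num [criticalIndex]

theorem criticalIndex_one_four : criticalIndex 1 4 = -1 / 6 := by norm_num [criticalIndex]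

theorem criticalIndex_one_five : criticalIndex 1 5 = 0 := by norm_num [criticalIndex]

theorem criticalIndex_three_nonneg {d : ℕ} (hd : 2 ≤ d) : 0 ≤ criticalIndex d 3 := by
  have : (2 : ℝ) ≤ d := by exact_mod_cast hd
  norm_num [criticalIndex]
  linarith

end Indices

end NLS

end

/-! ### Assembly of the cases -/

theorem theorem1p2 (d₁ d₂ : ℕ) (hd : 1 ≤ d₁ + d₂)
    (n : ℕ) (p q : Fin n → ℕ) (ν : Fin n → ℂ)
    (hdistinct : Function.Injective fun j => (p j, q j))
    (hp : ∀ j, 2 ≤ p j) (hq : ∀ j, q j ≤ p j) (hν : ∀ j, ν j ≠ 0) :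
    -- every case but `Z = 𝕋` with a term `u ū`
    (¬ ((d₁ = 0 ∧ d₂ = 1) ∧ ∃ j, p j = 2 ∧ q j = 1) →
      ∀ s : ℝ, (∃ j, NLS.SingleTermRange d₁ d₂ (p j) (q j) s) →
        NLS.NormInflation d₁ d₂ (NLS.nonlinearity p q ν) s) ∧
    -- `Z = 𝕋` with a term `u ū`
    ((d₁ = 0 ∧ d₂ = 1) ∧ (∃ j, p j = 2 ∧ q j = 1) →
      ((∃ j, 5 ≤ p j ∨ (p j = 4 ∧ (q j = 3 ∨ q j = 2 ∨ q j = 1))) →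
        ∀ s : ℝ, s < 0 → NLS.NormInflation d₁ d₂ (NLS.nonlinearity p q ν) s) ∧
      ((∃ j, p j = 4 ∧ (q j = 4 ∨ q j = 0)) →
        (∀ j, 4 ≤ p j → p j = 4 ∧ (q j = 4 ∨ q j = 0)) →
        ∀ s : ℝ, s < -1 / 6 → NLS.NormInflation d₁ d₂ (NLS.nonlinearity p q ν) s) ∧
      ((∃ j, p j = 3) → (∀ j, p j ≤ 3) →
        ∀ s : ℝ, s ≤ -1 / 2 → NLS.NormInflation d₁ d₂ (NLS.nonlinearity p q ν) s) ∧
      ((∀ j, p j ≤ 2) →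
        ∀ s : ℝ, s < 0 → NLS.NormInflation d₁ d₂ (NLS.nonlinearity p q ν) s)) := by
  -- a supercritical term forces norm inflation through the terms of top degree
  have key : ∀ (j : Fin n) (s : ℝ) (r : ℕ), 2 ≤ r → r ≤ p j → s < 0 →
      s < NLS.criticalIndex (d₁ + d₂) r → NLS.NormInflation d₁ d₂ (NLS.nonlinearity p q ν) s := by
    intro j s r hr hrj hs hs'
    have : Nonempty (Fin n) := ⟨j⟩
    obtain ⟨i, hi⟩ := Finite.exists_max p
    exact NLS.normInflation_of_supercritical hd hdistinct hp hq hν hi ⟨i, rfl⟩ hs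
      (hs'.trans_le (NLS.criticalIndex_le hr (hrj.trans (hi j))))
  have quartic : (d₁ = 0 ∧ d₂ = 1) → ∀ j, p j = 4 → (q j = 1 ∨ q j = 2 ∨ q j = 3) → ∀ s : ℝ, s < 0 →
      NLS.NormInflation d₁ d₂ (NLS.nonlinearity p q ν) s := by
    rintro ⟨rfl, rfl⟩ j hpj hqj s hs
    -- A term of degree at least 5 has a nonnegative critical index on the circle, so every s < 0 is
    -- then supercritical.
    by_cases h : ∀ i, p i ≤ 4
    · exact NLS.normInflation_of_quartic_circle hdistinct hp hq hν h hpj hqj hs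
    · push Not at h
      obtain ⟨i, hi⟩ := h
      exact key i s 5 (by norm_num) hi hs (by rw [NLS.criticalIndex_one_five]; exact hs)
  refine ⟨fun hex s ⟨j, hj⟩ => ?_, fun ⟨⟨h₁, h₂⟩, j₀, hpj, hqj⟩ => ⟨?_, ?_, ?_, ?_⟩⟩
  · rcases hj with h | ⟨h, h'⟩ | ⟨h1, hpj, hqj, hs⟩ | ⟨h2, h1, -, hpj, hqj, hs⟩ | ⟨h3, h2, hpj, hqj, hs⟩ |
      ⟨h1, h2, hpj, hqj, hs⟩
    · exact key j s (p j) (hp j) le_rfl (h.trans_le (min_le_right _ _)) (h.trans_le (min_le_left _ _))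
    -- The critical mechanism needs j to have top degree; otherwise s lies strictly below the
    -- critical index of a higher term.
    · by_cases hP : ∀ i, p i ≤ p j
      · rw [h']
        exact NLS.normInflation_of_critical hd hdistinct hp hq hν hP ⟨j, rfl⟩
          (NLS.mul_eq_two_of_criticalIndex_eq (hp j) (h.symm.trans h'))
      · push Not at hP
        obtain ⟨i, hi⟩ := hP
        have hd' : (1 : ℝ) ≤ ((d₁ + d₂ : ℕ) : ℝ) := by exact_mod_cast hd
        exact key i s (p i) (hp i) le_rfl (by rw [h']; linarith)
          (h.trans_lt (NLS.criticalIndex_lt (hp j) hi))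
    · by_cases hP : ∀ i, p i ≤ 2
      · exact NLS.normInflation_of_quadratic_one_dim h1 hdistinct hp hq hν hP ⟨j, hpj⟩ hs
      · push Not at hP
        obtain ⟨i, hi⟩ := hP
        exact key i s 3 (by norm_num) hi (by linarith)
          (by rw [h1, NLS.criticalIndex_one_three]; linarith)
    · exact NLS.normInflation_of_mul_conj_euclidean h2 h1 hdistinct hp hq hν hpj hqj hs
    · by_cases hP : ∀ i, p i ≤ 2
      · exact NLS.normInflation_of_mul_conj_periodic h2 hdistinct hp hq hν hP hpj hqj hs
      · push Not at hP
        obtain ⟨i, hi⟩ := hP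
        -- In dimension one the domain would be the circle with a term u ū, which is excluded here.
        -- From dimension two on, a term of degree at least 3 has nonnegative critical index.
        have hd2 : 2 ≤ d₁ + d₂ := by
          by_contra h
          exact hex ⟨⟨by omega, by omega⟩, j, hpj, hqj⟩
        exact key i s 3 (by norm_num) hi hs (hs.trans_le (NLS.criticalIndex_three_nonneg hd2))
    · exact quartic ⟨h1, h2⟩ j hpj hqj s hs
  · rintro ⟨j, hj | ⟨hp4, hq4⟩⟩ s hs
    · exact key j s 5 (by norm_num) hj hs (by rw [h₁, h₂, NLS.criticalIndex_one_five]; exact hs)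
    · exact quartic ⟨h₁, h₂⟩ j hp4 (by omega) s hs
  · rintro ⟨j, hp4, -⟩ - s hs
    exact key j s 4 (by norm_num) hp4.ge (by linarith)
      (by rw [h₁, h₂, NLS.criticalIndex_one_four]; exact hs)
  · rintro ⟨j, hp3⟩ h3 s hs
    rcases hs.lt_or_eq with hs | hs
    · exact key j s 3 (by norm_num) hp3.ge (by linarith)
        (by rw [h₁, h₂, NLS.criticalIndex_one_three]; exact hs)
    · have h := NLS.normInflation_of_critical hd hdistinct hp hq hν h3 ⟨j, hp3⟩ (by rw [h₁, h₂])
      have e : s = -((d₁ + d₂ : ℕ) : ℝ) / 2 := by rw [hs, h₁, h₂]; norm_num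
      rw [e]
      exact h
  · exact fun hP s hs =>
      NLS.normInflation_of_mul_conj_periodic h₂.ge hdistinct hp hq hν hP hpj hqj hs
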